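/- **Setting.** Let $d,\upsilon\ge 1$ be integers and let $\mathcal G^d\subset[0,1]^d$ be the grid of granularity $2^{-\upsilon}$, i.e. the points all of whose coordinates are of the form $j2^{-\upsilon}$ with $0\le j\le 2^{\upsilon}$. For a finite set $P\subset\mathbb R^d$ let $\mathrm{TD}(x,P)=\min_{\|u\|=1}|\{p\in P:\langle p,u\rangle\le\langle x,u\rangle\}|$ be the Tukey depth and $D_P(\kappa)=\{x\in\mathbb R^d:\mathrm{TD}(x,P)\ge\kappa\}$ the $\kappa$-Tukey region. For $S\subset\mathbb R^d$ put $\mathrm{diam}(S)=\sup_{p,q\in S}\|p-q\|$ and $\mathrm{width}(S)=\inf_{\|u\|=1}\sup_{p,q\in S}\langle p-q,u\rangle$. For an affine map $M$, the region $M(D_P(\kappa))$ is called $(c,\Delta)$-fat if $\mathrm{width}(M(D_P(\kappa)))\ge\frac1c\,\mathrm{diam}(M(D_P(\kappa-\Delta)))$, and $c$-absolutely fat if $\mathrm{width}(M(D_P(\kappa)))\ge\frac1c$. A randomized algorithm $\mathcal A$ on finite subsets of $\mathbb R^d$ is $(\epsilon,\delta)$-differentially private if $\Pr[\mathcal A(P)\in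 S]\le e^{\epsilon}\Pr[\mathcal A(P')\in S]+\delta$ for every set $S$ of outputs and all $P,P'$ with $|P\triangle P'|=1$. **Depth gap.** Let $\Delta^{\rm BB}=\Delta^{\rm BB}(\epsilon,\delta,\beta)$ be any one of $$O\!\Big(\tfrac{d^3(\upsilon+\log(d/\beta))}{\epsilon}\Big),\qquad \tilde O\!\Big(\tfrac{d^3\log(d\upsilon/\epsilon\delta\beta)}{\epsilon}\Big),\qquad O\!\Big(\tfrac{d^3\log(d\upsilon/\beta)}{\epsilon}+\tfrac{d^3\,8^{\log^*\upsilon}\log^*(\upsilon)\,\log(d\log^*(\upsilon)/\delta\beta)}{\epsilon}\Big),$$ the last two only for $\delta>0$. Here $\tilde O(f)$ means $O\big(f\,(1+\log(1+f))^{k}\big)$ for some fixed $k$, all implied constants are absolute, and in the second bound $\epsilon$ inside the logarithm is read as $\min(\epsilon,1)$. **Lemma.** For suitable absolute constants in $\Delta^{\rm BB}$ the following holds. For all $d,\upsilon\ge1$, $\epsilon>0$, $\delta\ge0$, $\beta>0$ and every integer $\kappa\ge1$ there is an $(\epsilon,\delta)$-differentially private algorithm which, given a finite set $P\subset\mathcal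 G^d$, outputs two invertible affine maps $M,\tilde M$ of $\mathbb R^d$ such that the following is true. If $0\le\kappa'\le\kappa$ is an integer with $$\kappa-\kappa'\ge\Delta^{\rm BB},\qquad \mathrm{vol}(D_P(\kappa))>0,\qquad \mathrm{vol}(D_P(\kappa))\ge\tfrac12\mathrm{vol}(D_P(\kappa')),$$ then with probability at least $1-\beta$ both of these hold: (i) $M([0,1]^d)\subset[0,1]^d$, and $M(D_P(\kappa))$ is a convex polytope that is $(c_d,\kappa-\kappa')$-fat for $c_d=4d^{5/2}\,5^d\,d!$, that is, $\mathrm{width}(M(D_P(\kappa)))\ge\frac{1}{c_d}\mathrm{diam}(M(D_P(\kappa')))$; (ii) $\tilde M(D_P(\kappa))\subset[0,1]^d$, and $\tilde M(D_P(\kappa))$ is $(2d\cdot5^d\,d!)$-absolutely fat, that is, $\mathrm{width}(\tilde M(D_P(\kappa)))\ge\frac{1}{2d\cdot5^d\,d!}$. -/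

import Mathlib

open MeasureTheory
open scoped ENNReal RealInnerProductSpace

noncomputable section

namespace TukeyFat

/-- Euclidean space `ℝᵈ`. -/
abbrev E (d : ℕ) : Type := EuclideanSpace ℝ (Fin d)

/-- The unit cube `[0,1]ᵈ`. -/
def unitCube (d : ℕ) : Set (E d) := {x | ∀ i, 0 ≤ x i ∧ x i ≤ 1}

/-- The grid `𝒢ᵈ ⊆ [0,1]ᵈ` of granularity `Υ = 2^(-υ)`. -/
def grid (d υ : ℕ) : Set (E d) :=
  {x | ∀ i, ∃ j : ℕ, j ≤ 2 ^ υ ∧ x i = (j : ℝ) / 2 ^ υ}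

/-- Tukey depth: the least number of points of `P` in a closed half-space with `x` on its
boundary, `min_{u ∈ S^{d-1}} |{p ∈ P : ⟨p,u⟩ ≤ ⟨x,u⟩}|`. -/
def tukeyDepth {d : ℕ} (x : E d) (P : Finset (E d)) : ℕ :=
  ⨅ u : Metric.sphere (0 : E d) 1, {p : E d | p ∈ P ∧ ⟪p, (u : E d)⟫ ≤ ⟪x, (u : E d)⟫}.ncard

/-- The `κ`-Tukey region `D_P(κ)`. -/
def tukeyRegion {d : ℕ} (P : Finset (E d)) (κ : ℕ) : Set (E d) :=
  {x | κ ≤ tukeyDepth x P}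

/-- `width(S) = min_{u ∈ S^{d-1}} max_{p,q ∈ S} ⟨p-q,u⟩`, with values in `[0,∞]`. -/
def width {d : ℕ} (S : Set (E d)) : ℝ≥0∞ :=
  ⨅ u : Metric.sphere (0 : E d) 1, ⨆ p ∈ S, ⨆ q ∈ S, ENNReal.ofReal ⟪p - q, (u : E d)⟫

/-- A polytope: an intersection of finitely many closed half-spaces `{x | ⟨x,u⟩ ≤ a}`. -/
def IsPolytope {d : ℕ} (S : Set (E d)) : Prop :=
  ∃ H : Finset (E d × ℝ), S = {x | ∀ h ∈ H, ⟪x, h.1⟫ ≤ h.2}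

/-- The image under `M` of the `κ`-Tukey region of `P` is `(c,Δ)`-fat:
`width(M(D_P(κ))) ≥ (1/c) · diam(M(D_P(κ-Δ)))`. It is used for `Δ ≤ κ` only. -/
def IsFat {d : ℕ} (M : E d ≃ᵃ[ℝ] E d) (P : Finset (E d)) (κ : ℕ) (c : ℝ) (Δ : ℕ) : Prop :=
  ENNReal.ofReal (1 / c) * Metric.ediam (M '' tukeyRegion P (κ - Δ)) ≤
    width (M '' tukeyRegion P κ)

/-- The image under `M` of the `κ`-Tukey region of `P` is `c`-absolutely fat:
`width(M(D_P(κ))) ≥ 1/c`. -/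
def IsAbsolutelyFat {d : ℕ} (M : E d ≃ᵃ[ℝ] E d) (P : Finset (E d)) (κ : ℕ) (c : ℝ) : Prop :=
  ENNReal.ofReal (1 / c) ≤ width (M '' tukeyRegion P κ)

/-- Datasets are neighbouring if they differ in exactly one point. -/
def Neighboring {d : ℕ} (P P' : Finset (E d)) : Prop :=
  (symmDiff (P : Set (E d)) (P' : Set (E d))).ncard = 1

/-- A randomized algorithm with outputs in `α` assigns to every dataset a (discrete) probability
distribution on `α`. It is `(ε,δ)`-differentially private if
`Pr[A(P) ∈ S] ≤ e^ε · Pr[A(P') ∈ S] + δ` for all neighbouring `P`, `P'` and all sets `S`. -/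
def IsDP {d : ℕ} {α : Type*} (ε δ : ℝ) (A : Finset (E d) → PMF α) : Prop :=
  ∀ P P' : Finset (E d), Neighboring P P' → ∀ S : Set α,
    (A P).toOuterMeasure S ≤
      ENNReal.ofReal (Real.exp ε) * (A P').toOuterMeasure S + ENNReal.ofReal δ

/-- The iterated logarithm `log*`: how often `log₂` must be applied to reach a value `≤ 1`. -/
def logStar (x : ℝ) : ℕ := sInf {k : ℕ | (Real.logb 2)^[k] x ≤ 1}

/-- The three quasi-concave optimizers on which the bound `Δ^BB` depends. -/
inductive Optimizer : Type
  | binarySearch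
  | betweenThresholds
  | recConcave

/-- The bound `Δ^BB(ε,δ,β)`, with `C` the constant hidden in `O(·)`, and `C`, `k` those hidden in
`Õ(·)`, where `Õ(f)` stands for `C · f · (1 + log(1 + f))^k`.
For `ε ≤ 1` the factor `min ε 1` is just `ε`. -/
def deltaBB (C : ℝ) (k : ℕ) (d υ : ℕ) (ε δ β : ℝ) : Optimizer → ℝ
  | .binarySearch => C * ((d : ℝ) ^ 3 * (υ + Real.log (d / β)) / ε)
  | .betweenThresholds =>
      let f : ℝ := (d : ℝ) ^ 3 * Real.log (d * υ / (min ε 1 * δ * β)) / ε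
      C * (f * (1 + Real.log (1 + f)) ^ k)
  | .recConcave =>
      C * ((d : ℝ) ^ 3 * Real.log (d * υ / β) / ε +
        (d : ℝ) ^ 3 * 8 ^ logStar υ * logStar υ * Real.log (d * logStar υ / (δ * β)) / ε)

end TukeyFat

end

namespace TukeyFat

variable {d : ℕ}

/-! Call an affine map tight for a convex body `K` if it sends `K` into the unit cube onto a set of
volume at least a constant times `1 / (5 ^ d * d!)`. Tightness for `D_P(κ)` gives both conclusions
(`conclusion_of_isTight`). A subset of the cube of volume `v` has width at least `v / d`. If `K ⊆ L`
are convex and `vol L ≤ 2 vol K`, then `L` is at most `2d` times as wide as `K` in every direction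
(`sub_le_of_volume_le`), which bounds the diameter of the image of `D_P(κ')`. The second output is a
tight map, the first a copy of it shrunk so as to preserve the cube; shrinking does not affect the
ratio of width to diameter.

It remains to select a tight map privately. A maximal family of pairwise non-close maps contains a
tight one for every convex body (`IsNet.exists_isTight`), but only `exp(O(d³(1 + log d)))` that are
tight for the same body (`IsNet.packing`).

A map is ideal for `Q` if `D_Q(κ)` and `D_Q(κ - (2r - 1))` have volumes within a factor `2` and the
map is tight for the larger region. Its score at `P` falls with the number of points to be changed
before it becomes ideal, so the score has sensitivity one. Changing `r` points shifts depths by at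
most `r`; hence every map of positive score at `P` is tight for one of two intermediate regions of
`P` (`isTight_of_nearIdeal`), whether or not `P` is stable.

For `δ > 0` few members of the net thus have positive score, and the choosing mechanism
(`exists_approx_mechanism`) selects among them. For `δ = 0` the exponential mechanism needs a finite
candidate set fixed in advance. A quantitative Helly theorem (`exists_code`) encloses each Tukey
region of grid points in one of `exp(O(d³υ))` intersections of `2d + 1` half-spaces, of comparable
volume, and each of these contributes one packing number. The two resulting gaps lie below the three
bounds, apart from degenerate parameters. -/

lemma sphere_nonempty (hd : 1 ≤ d) : Nonempty (Metric.sphere (0 : E d) 1) := by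
  have : Nontrivial (E d) := by
    have : Nonempty (Fin d) := ⟨⟨0, hd⟩⟩
    infer_instance
  exact (NormedSpace.sphere_nonempty (E := E d) (x := 0) (r := 1)).2 zero_le_one |>.to_subtype

/-! ### Tukey regions as intersections of convex hulls -/

lemma mem_tukeyRegion_iff (hd : 1 ≤ d) {P : Finset (E d)} {κ : ℕ} {x : E d} :
    x ∈ tukeyRegion P κ ↔
      ∀ u : E d, ‖u‖ = 1 → κ ≤ {p : E d | p ∈ P ∧ ⟪p, u⟫ ≤ ⟪x, u⟫}.ncard := by
  have := sphere_nonempty hd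
  constructor
  · intro h u hu
    exact le_trans h (ciInf_le (OrderBot.bddBelow _) (⟨u, by simpa using hu⟩ : Metric.sphere (0 : E d) 1))
  · intro h
    change κ ≤ ⨅ u : Metric.sphere (0 : E d) 1, _
    refine le_ciInf ?_
    rintro ⟨u, hu⟩
    exact h u (mem_sphere_zero_iff_norm.1 hu)

lemma tukeyRegion_anti {P : Finset (E d)} {k l : ℕ} (h : k ≤ l) :
    tukeyRegion P l ⊆ tukeyRegion P k := fun _ hx => le_trans h hx

/-- A point of `P` outside `Q` adds at most one to the count in any half-space. This turns distances
between datasets into shifts of depth. -/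
lemma tukeyRegion_subset_of_sdiff (hd : 1 ≤ d) {P Q : Finset (E d)} {k l : ℕ}
    (h : l + ((P : Set (E d)) \ Q).ncard ≤ k) : tukeyRegion P k ⊆ tukeyRegion Q l := by
  intro x hx
  rw [mem_tukeyRegion_iff hd] at hx ⊢
  intro u hu
  have h1 := hx u hu
  have hfin : {p : E d | p ∈ Q ∧ ⟪p, u⟫ ≤ ⟪x, u⟫}.Finite :=
    Q.finite_toSet.subset fun p hp => hp.1
  have hfin2 : ((P : Set (E d)) \ Q).Finite := P.finite_toSet.subset Set.sdiff_subset
  have h2 : {p : E d | p ∈ P ∧ ⟪p, u⟫ ≤ ⟪x, u⟫}.ncard ≤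
      ({p : E d | p ∈ Q ∧ ⟪p, u⟫ ≤ ⟪x, u⟫} ∪ ((P : Set (E d)) \ Q)).ncard := by
    refine Set.ncard_le_ncard ?_ (hfin.union hfin2)
    rintro p ⟨hp, hpu⟩
    by_cases hq : p ∈ Q
    · exact Or.inl ⟨hq, hpu⟩
    · exact Or.inr ⟨hp, hq⟩
  have h3 := Set.ncard_union_le {p : E d | p ∈ Q ∧ ⟪p, u⟫ ≤ ⟪x, u⟫} ((P : Set (E d)) \ Q)
  omega

lemma exists_unit_separation (hd : 1 ≤ d) {Q : Finset (E d)} {x : E d}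
    (hx : x ∉ convexHull ℝ (Q : Set (E d))) :
    ∃ u : E d, ‖u‖ = 1 ∧ ∀ q ∈ Q, ⟪x, u⟫ < ⟪q, u⟫ := by
  rcases Q.eq_empty_or_nonempty with rfl | ⟨q0, hq0⟩
  · obtain ⟨u⟩ := sphere_nonempty hd
    exact ⟨u, mem_sphere_zero_iff_norm.1 u.2, by simp⟩
  · obtain ⟨f, c, hfx, hf⟩ := geometric_hahn_banach_point_closed (convex_convexHull ℝ (Q : Set (E d)))
      (Q.finite_toSet.isCompact_convexHull (𝕜 := ℝ)).isClosed hx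
    set w := (InnerProductSpace.toDual ℝ (E d)).symm f with hw
    have hfw : ∀ y, f y = ⟪y, w⟫ := by
      intro y
      rw [real_inner_comm, hw, InnerProductSpace.toDual_symm_apply]
    have hlt : ∀ q ∈ Q, ⟪x, w⟫ < ⟪q, w⟫ := by
      intro q hq
      rw [← hfw, ← hfw]
      exact hfx.trans (hf q (subset_convexHull ℝ _ hq))
    have hw0 : w ≠ 0 := by
      intro h
      have := hlt q0 hq0
      simp [h] at this
    have hn : 0 < ‖w‖ := norm_pos_iff.2 hw0
    refine ⟨‖w‖⁻¹ • w, by simp [norm_smul, hn.ne'], fun q hq => ?_⟩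
    rw [inner_smul_right, inner_smul_right]
    exact mul_lt_mul_of_pos_left (hlt q hq) (inv_pos.2 hn)

/-- A half-space separating `x` from `Q` contains only points of `P` that `Q` omits, so `x` has
depth below `k`. -/
lemma tukeyRegion_subset_convexHull (hd : 1 ≤ d) {P Q : Finset (E d)} {k : ℕ}
    (hQ : ((P : Set (E d)) \ Q).ncard < k) : tukeyRegion P k ⊆ convexHull ℝ (Q : Set (E d)) := by
  intro x hx
  by_contra hxQ
  obtain ⟨u, hu, hlt⟩ := exists_unit_separation hd hxQ
  have h1 := (mem_tukeyRegion_iff hd).1 hx u hu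
  have h2 : {p : E d | p ∈ P ∧ ⟪p, u⟫ ≤ ⟪x, u⟫}.ncard ≤ ((P : Set (E d)) \ Q).ncard := by
    refine Set.ncard_le_ncard ?_ (P.finite_toSet.subset Set.sdiff_subset)
    rintro p ⟨hp, hpu⟩
    exact ⟨hp, fun hq => absurd (hlt p hq) (not_lt.2 hpu)⟩
  omega

lemma exists_subset_of_notMem (hd : 1 ≤ d) {P : Finset (E d)} {k : ℕ} {x : E d}
    (hx : x ∉ tukeyRegion P k) :
    ∃ (u : E d) (Q : Finset (E d)), Q ⊆ P ∧ ((P : Set (E d)) \ Q).ncard < k ∧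
      ∀ q ∈ Q, ⟪x, u⟫ < ⟪q, u⟫ := by
  classical
  rw [mem_tukeyRegion_iff hd] at hx
  push Not at hx
  obtain ⟨u, hu, hlt⟩ := hx
  refine ⟨u, P.filter fun p => ⟪x, u⟫ < ⟪p, u⟫, Finset.filter_subset _ _, ?_, by simp⟩
  refine lt_of_eq_of_lt (congrArg Set.ncard ?_) hlt
  ext p
  simp only [Finset.coe_filter, Set.mem_sdiff, Finset.mem_coe, Set.mem_ofPred_eq, not_and, not_lt]
  tauto

/-- A point of depth below `k` has fewer than `k` points of `P` in some closed half-space; the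
others lie strictly on the far side, and so does their hull. Convexity and closedness of the region
follow. For `k = 0` the intersection is over nothing, so boundedness needs `1 ≤ k`. -/
lemma tukeyRegion_eq_iInter (hd : 1 ≤ d) (P : Finset (E d)) (k : ℕ) :
    tukeyRegion P k = ⋂ (Q : Finset (E d)) (_ : ((P : Set (E d)) \ Q).ncard < k),
      convexHull ℝ (Q : Set (E d)) := by
  refine Set.Subset.antisymm
    (Set.subset_iInter₂ fun Q hQ => tukeyRegion_subset_convexHull hd hQ) ?_
  intro x hx
  by_contra h
  obtain ⟨u, Q, -, hQ, hlt⟩ := exists_subset_of_notMem hd h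
  have hxQ : x ∈ convexHull ℝ (Q : Set (E d)) := Set.mem_iInter₂.1 hx Q hQ
  have hconv : Convex ℝ {y : E d | ⟪x, u⟫ < ⟪y, u⟫} := by
    have := convex_halfSpace_gt (𝕜 := ℝ) (f := fun y : E d => ⟪y, u⟫)
      ⟨fun a b => inner_add_left a b u, fun c a => by simp [inner_smul_left]⟩ ⟪x, u⟫
    exact this
  have := convexHull_min (fun q hq => hlt q hq) hconv hxQ
  exact lt_irrefl ⟪x, u⟫ this

lemma convex_tukeyRegion (hd : 1 ≤ d) (P : Finset (E d)) (k : ℕ) :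
    Convex ℝ (tukeyRegion P k) := by
  rw [tukeyRegion_eq_iInter hd]
  exact convex_iInter₂ fun Q _ => convex_convexHull ℝ _

lemma isClosed_tukeyRegion (hd : 1 ≤ d) (P : Finset (E d)) (k : ℕ) :
    IsClosed (tukeyRegion P k) := by
  rw [tukeyRegion_eq_iInter hd]
  exact isClosed_biInter fun Q _ => (Q.finite_toSet.isCompact_convexHull (𝕜 := ℝ)).isClosed

lemma tukeyRegion_subset_convexHull_self (hd : 1 ≤ d) (P : Finset (E d)) {k : ℕ} (hk : 1 ≤ k) :
    tukeyRegion P k ⊆ convexHull ℝ (P : Set (E d)) :=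
  tukeyRegion_subset_convexHull hd (by simp; omega)

lemma isCompact_tukeyRegion (hd : 1 ≤ d) (P : Finset (E d)) {k : ℕ} (hk : 1 ≤ k) :
    IsCompact (tukeyRegion P k) :=
  (P.finite_toSet.isCompact_convexHull (𝕜 := ℝ)).of_isClosed_subset (isClosed_tukeyRegion hd P k)
    (tukeyRegion_subset_convexHull_self hd P hk)

lemma tukeyRegion_zero (P : Finset (E d)) : tukeyRegion P 0 = Set.univ :=
  Set.eq_univ_of_forall fun _ => Nat.zero_le _

/-! ### Facets of Tukey regions -/

/-- A convex set of positive volume has nonempty interior. -/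
lemma interior_nonempty_of_volume_pos {K : Set (E d)} (hK : Convex ℝ K) (h : 0 < volume K) :
    (interior K).Nonempty := by
  by_contra hne
  rw [Set.not_nonempty_iff_eq_empty] at hne
  have h1 : volume K ≤ volume (frontier K) := by
    refine measure_mono fun x hx => ?_
    rw [frontier, hne, Set.sdiff_empty]
    exact subset_closure hx
  rw [hK.addHaar_frontier volume] at h1
  exact absurd h (not_lt.2 h1)

/-- A family of `d` linearly independent members of a spanning set. -/
lemma exists_linearIndependent_of_span_eq_top {S : Set (E d)} (hS : Submodule.span ℝ S = ⊤) :
    ∃ v : Fin d → E d, (∀ i, v i ∈ S) ∧ LinearIndependent ℝ v := by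
  obtain ⟨b, hbS, hspan, hli⟩ := exists_linearIndependent ℝ S
  have hB : ⊤ ≤ Submodule.span ℝ (Set.range ((↑) : b → E d)) := by
    rw [Subtype.range_coe, hspan, hS]
  let B := Module.Basis.mk hli hB
  let _ : Fintype b := FiniteDimensional.fintypeBasisIndex B
  have hcard : Fintype.card b = d := by
    rw [← Module.finrank_eq_card_basis B]; simp
  let e : Fin d ≃ b := (Fintype.equivFinOfCardEq hcard).symm
  exact ⟨fun i => (e i : E d), fun i => hbS (e i).2, hli.comp e e.injective⟩

/-- Facets of Tukey regions: a point outside the region is separated from it by a hyperplane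
spanned by points of `P`. -/
theorem exists_facet (hd : 1 ≤ d) {P : Finset (E d)} {k : ℕ} {p x : E d}
    (hp : p ∈ interior (tukeyRegion P k)) (hx : x ∉ tukeyRegion P k) :
    ∃ u : E d, (∃ q : Fin d → E d, (∀ i, q i ∈ P) ∧ LinearIndependent ℝ (fun i => q i - p) ∧
        ∀ i, ⟪u, q i - p⟫ = 1) ∧
      (∀ y ∈ tukeyRegion P k, ⟪u, y - p⟫ ≤ 1) ∧ 1 < ⟪u, x - p⟫ := by
  obtain ⟨e, Q, hQP, hQk, hlt⟩ := exists_subset_of_notMem hd hx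
  have hsub := tukeyRegion_subset_convexHull hd hQk
  obtain ⟨ρ, hρ, hball⟩ := Metric.isOpen_iff.1 isOpen_interior p hp
  have hball' : Metric.ball p ρ ⊆ convexHull ℝ (Q : Set (E d)) :=
    hball.trans (interior_subset.trans hsub)
  -- linear inequalities on `Q` extend to the hull
  have hext : ∀ (u : E d) (c : ℝ), (∀ q ∈ Q, ⟪u, q - p⟫ ≤ c) →
      ∀ y ∈ convexHull ℝ (Q : Set (E d)), ⟪u, y - p⟫ ≤ c := by
    intro u c h y hy
    have hconv : Convex ℝ {y : E d | ⟪u, y⟫ ≤ c + ⟪u, p⟫} :=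
      convex_halfSpace_le (𝕜 := ℝ) (f := fun y : E d => ⟪u, y⟫)
        ⟨fun a b => inner_add_right u a b, fun c a => by simp [inner_smul_right]⟩ _
    have := convexHull_min (s := (Q : Set (E d))) (fun q hq => by
      have := h q hq
      rw [inner_sub_right] at this
      change ⟪u, q⟫ ≤ c + ⟪u, p⟫
      linarith) hconv hy
    rw [inner_sub_right]
    change ⟪u, y⟫ ≤ c + ⟪u, p⟫ at this
    linarith
  -- The polar of `Q` seen from `p`; it is compact because the hull of `Q` contains a ball about
  -- `p`.
  let Z : Set (E d) := {u | ∀ q ∈ Q, ⟪u, q - p⟫ ≤ 1}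
  have hZclosed : IsClosed Z := by
    have : Z = ⋂ q ∈ Q, {u : E d | ⟪u, q - p⟫ ≤ 1} := by ext; simp [Z]
    rw [this]
    exact isClosed_biInter fun q _ => isClosed_le (by fun_prop) continuous_const
  have hZbdd : Z ⊆ Metric.closedBall 0 (2 / ρ) := by
    intro u hu
    rw [mem_closedBall_zero_iff]
    by_cases hu0 : u = 0
    · simp [hu0]; positivity
    have hn : 0 < ‖u‖ := norm_pos_iff.2 hu0
    have hmem : p + (ρ / 2 / ‖u‖) • u ∈ Metric.ball p ρ := by
      rw [mem_ball_iff_norm, add_sub_cancel_left, norm_smul, Real.norm_of_nonneg (by positivity),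
        div_mul_cancel₀ _ hn.ne']
      linarith
    have := hext u 1 hu _ (hball' hmem)
    rw [add_sub_cancel_left, inner_smul_right, real_inner_self_eq_norm_sq] at this
    rw [le_div_iff₀ hρ]
    have h2 : ρ / 2 / ‖u‖ * ‖u‖ ^ 2 = ρ / 2 * ‖u‖ := by field_simp
    rw [h2] at this
    linarith
  have hZcomp : IsCompact Z := (isCompact_closedBall _ _).of_isClosed_subset hZclosed hZbdd
  have hZne : Z.Nonempty := ⟨0, fun q _ => by simp⟩
  obtain ⟨u₀, hu₀, hmax⟩ := hZcomp.exists_isMaxOn hZne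
    (f := fun u : E d => ⟪u, x - p⟫) (by fun_prop)
  have hu₀x : 1 < ⟪u₀, x - p⟫ := by
    -- a functional separating `x` from `Q`, rescaled
    obtain ⟨q₀, hq₀⟩ : Q.Nonempty := by
      by_contra h
      rw [Finset.not_nonempty_iff_eq_empty] at h
      have := hball' (Metric.mem_ball_self hρ)
      simp [h] at this
    obtain ⟨q₁, hq₁, hq₁max⟩ := Q.exists_max_image (fun q => ⟪-e, q - p⟫) ⟨q₀, hq₀⟩
    have hlt1 : ⟪-e, q₁ - p⟫ < ⟪-e, x - p⟫ := by
      have := hlt q₁ hq₁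
      rw [real_inner_comm, real_inner_comm (y := q₁)] at this
      simp only [inner_neg_left, inner_sub_right]
      linarith
    have hM : 0 < ⟪-e, q₁ - p⟫ := by
      have hne : e ≠ 0 := by
        rintro rfl
        simp at hlt1
      have hn : 0 < ‖e‖ := norm_pos_iff.2 hne
      have hmem : p + (-(ρ / 2 / ‖e‖)) • e ∈ Metric.ball p ρ := by
        rw [mem_ball_iff_norm, add_sub_cancel_left, norm_smul, norm_neg,
          Real.norm_of_nonneg (by positivity), div_mul_cancel₀ _ hn.ne']
        linarith
      have := hext (-e) _ hq₁max _ (hball' hmem)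
      refine lt_of_lt_of_le ?_ this
      rw [add_sub_cancel_left, inner_smul_right, inner_neg_left, real_inner_self_eq_norm_sq]
      have : 0 < ρ / 2 / ‖e‖ * ‖e‖ ^ 2 := by positivity
      linarith
    have hmem : (⟪-e, q₁ - p⟫)⁻¹ • (-e) ∈ Z := by
      intro q hq
      rw [inner_smul_left]
      simp only [conj_trivial]
      rw [inv_mul_le_iff₀ hM, mul_one]
      exact hq₁max q hq
    have h1 : ⟪(⟪-e, q₁ - p⟫)⁻¹ • (-e), x - p⟫ ≤ ⟪u₀, x - p⟫ := hmax hmem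
    refine lt_of_lt_of_le ?_ h1
    rw [inner_smul_left]
    simp only [conj_trivial]
    rw [lt_inv_mul_iff₀ hM, mul_one]
    exact hlt1
  -- The face of maximizers. At an extreme point of it the active constraints span: a direction
  -- orthogonal to all of them could be followed both ways inside `Z`, and by maximality also inside
  -- `F`.
  let F : Set (E d) := {u ∈ Z | ⟪u, x - p⟫ = ⟪u₀, x - p⟫}
  have hFcomp : IsCompact F :=
    hZcomp.inter_right (isClosed_eq (by fun_prop) continuous_const)
  obtain ⟨u, huext⟩ := hFcomp.extremePoints_nonempty ⟨u₀, hu₀, rfl⟩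
  have huF : u ∈ F := huext.1
  have hspan : Submodule.span ℝ ((fun q => q - p) '' {q | q ∈ Q ∧ ⟪u, q - p⟫ = 1}) = ⊤ := by
    by_contra hne
    obtain ⟨w, hw, hw0⟩ := Submodule.exists_mem_ne_zero_of_ne_bot
      (mt Submodule.orthogonal_eq_bot_iff.1 hne)
    have hwq : ∀ q ∈ Q, ⟪u, q - p⟫ = 1 → ⟪w, q - p⟫ = 0 := by
      intro q hq hq1
      exact (Submodule.mem_orthogonal' _ _).1 hw _ (Submodule.subset_span ⟨q, ⟨hq, hq1⟩, rfl⟩)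
    -- small perturbations stay in `Z`
    have hev : ∀ᶠ t : ℝ in nhds 0, ∀ q ∈ Q, ⟪u + t • w, q - p⟫ ≤ 1 := by
      rw [Filter.eventually_all_finset]
      intro q hq
      by_cases hq1 : ⟪u, q - p⟫ = 1
      · refine Filter.Eventually.of_forall fun t => ?_
        rw [inner_add_left, inner_smul_left, hwq q hq hq1, hq1]
        simp
      · have hlt : ⟪u + (0 : ℝ) • w, q - p⟫ < 1 := by
          simpa using lt_of_le_of_ne (huF.1 q hq) hq1
        have hc : Continuous fun t : ℝ => ⟪u + t • w, q - p⟫ := by fun_prop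
        exact (hc.continuousAt.eventually (gt_mem_nhds hlt)).mono fun t ht => le_of_lt ht
    obtain ⟨t₀, ht₀, hball₀⟩ := Metric.eventually_nhds_iff.1 hev
    have hmem1 : u + (t₀ / 2) • w ∈ Z := hball₀ (by
      rw [Real.dist_eq, sub_zero, abs_of_pos (by positivity)]; linarith)
    have hmem2 : u + (-(t₀ / 2)) • w ∈ Z := hball₀ (by
      rw [Real.dist_eq, sub_zero, abs_neg, abs_of_pos (by positivity)]; linarith)
    have hx0 : ⟪w, x - p⟫ = 0 := by
      have h1 : ⟪u + (t₀ / 2) • w, x - p⟫ ≤ ⟪u₀, x - p⟫ := hmax hmem1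
      have h2 : ⟪u + (-(t₀ / 2)) • w, x - p⟫ ≤ ⟪u₀, x - p⟫ := hmax hmem2
      rw [inner_add_left, inner_smul_left, huF.2] at h1 h2
      simp only [conj_trivial] at h1 h2
      have h3 : t₀ / 2 * ⟪w, x - p⟫ ≤ 0 := by linarith
      have h4 : 0 ≤ t₀ / 2 * ⟪w, x - p⟫ := by linarith
      have h5 := le_antisymm h3 h4
      rcases mul_eq_zero.1 h5 with h | h
      · linarith
      · exact h
    have hF1 : u + (t₀ / 2) • w ∈ F := ⟨hmem1, by
      rw [inner_add_left, inner_smul_left, hx0, huF.2]; simp⟩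
    have hF2 : u + (-(t₀ / 2)) • w ∈ F := ⟨hmem2, by
      rw [inner_add_left, inner_smul_left, hx0, huF.2]; simp⟩
    have hseg : u ∈ openSegment ℝ (u + (t₀ / 2) • w) (u + (-(t₀ / 2)) • w) := by
      refine ⟨1 / 2, 1 / 2, by norm_num, by norm_num, by norm_num, ?_⟩
      module
    have := huext.2 hF1 hF2 hseg
    have h6 : (t₀ / 2) • w = 0 := by
      have h7 : u + (t₀ / 2) • w = u + 0 := by rw [this, add_zero]
      exact add_left_cancel h7
    rcases smul_eq_zero.1 h6 with h | h
    · linarith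
    · exact hw0 h
  obtain ⟨v, hv, hvli⟩ := exists_linearIndependent_of_span_eq_top hspan
  choose q hq hqv using hv
  refine ⟨u, ⟨q, fun i => hQP (hq i).1, ?_, fun i => (hq i).2⟩,
    fun y hy => hext u 1 huF.1 y (hsub hy), by rw [huF.2]; exact hu₀x⟩
  have : (fun i => q i - p) = v := funext hqv
  rw [this]; exact hvli

/-! ### Volumes of affine images, boxes, slabs and simplices -/

/-- The factor by which an affine equivalence multiplies volumes. -/
noncomputable def jac (T : E d ≃ᵃ[ℝ] E d) : ℝ := |LinearMap.det (T.linear : E d →ₗ[ℝ] E d)|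

lemma jac_pos (T : E d ≃ᵃ[ℝ] E d) : 0 < jac T :=
  abs_pos.2 (LinearEquiv.isUnit_det' T.linear).ne_zero

lemma volume_image (T : E d ≃ᵃ[ℝ] E d) (S : Set (E d)) :
    volume (T '' S) = ENNReal.ofReal (jac T) * volume S := by
  have h : T '' S = (fun x => x + T 0) '' ((T.linear : E d →ₗ[ℝ] E d) '' S) := by
    rw [Set.image_image]
    refine Set.image_congr fun x _ => ?_
    have := T.map_vadd 0 x
    simpa using this
  rw [h, Set.image_add_right, measure_preimage_add_right, Measure.addHaar_image_linearMap, jac]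

lemma volume_box (a b : Fin d → ℝ) :
    volume {x : E d | ∀ i, a i ≤ x i ∧ x i ≤ b i} = ∏ i, ENNReal.ofReal (b i - a i) := by
  rw [← Real.volume_Icc_pi, ← (PiLp.volume_preserving_ofLp (Fin d)).measure_preimage
    measurableSet_Icc.nullMeasurableSet]
  congr 1
  ext x
  simp [Pi.le_def, forall_and]

lemma volume_cube (a b : ℝ) :
    volume {x : E d | ∀ i, a ≤ x i ∧ x i ≤ b} = ENNReal.ofReal (b - a) ^ d := by
  have := volume_box (d := d) (fun _ => a) (fun _ => b)
  simpa using this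

lemma volume_unitCube : volume (unitCube d) = 1 := by
  have := volume_cube (d := d) 0 1
  rw [sub_zero, ENNReal.ofReal_one, one_pow] at this
  exact this

/-- A subset of the unit cube lying in a slab has small volume. -/
lemma volume_slab_le {C : Set (E d)} (hC : C ⊆ unitCube d) (a : Fin d → ℝ) (i : Fin d) {c l : ℝ}
    (h : ∀ x ∈ C, c ≤ ∑ j, a j * x j ∧ ∑ j, a j * x j ≤ c + l) :
    ENNReal.ofReal |a i| * volume C ≤ ENNReal.ofReal l := by
  classical
  -- Replacing the `i`-th coordinate by the functional `a` scales volumes by `|a i|` and sends `C`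
  -- into a box with sides `1`, except for the `i`-th, which is `l`.
  let M : Matrix (Fin d) (Fin d) ℝ := (1 : Matrix (Fin d) (Fin d) ℝ).updateRow i a
  have hdet : M.det = a i := by
    have h1 := Matrix.det_updateRow_sum (1 : Matrix (Fin d) (Fin d) ℝ) i a
    have h2 : (∑ k, a k • (1 : Matrix (Fin d) (Fin d) ℝ) k) = a := by
      ext j
      simp [Matrix.one_apply, Finset.sum_apply]
    rw [h2] at h1
    simpa using h1
  have hLdet : LinearMap.det (Matrix.toLpLin 2 2 M) = a i := by
    rw [Matrix.toLpLin_eq_toLin, LinearMap.det_toLin, hdet]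
  have himg : (Matrix.toLpLin 2 2 M) '' C ⊆
      {x : E d | ∀ j, (if j = i then c else 0) ≤ x j ∧ x j ≤ (if j = i then c + l else 1)} := by
    rintro _ ⟨x, hx, rfl⟩ j
    by_cases hj : j = i
    · subst hj
      simpa [M, Matrix.toLpLin_apply, Matrix.mulVec, dotProduct] using h x hx
    · simpa [M, hj, Matrix.toLpLin_apply, Matrix.mulVec, Matrix.updateRow_ne hj, dotProduct,
        Matrix.one_apply] using hC hx j
  have h1 := measure_mono (μ := volume) himg
  rw [Measure.addHaar_image_linearMap, hLdet, volume_box, Finset.prod_eq_single i] at h1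
  · simpa using h1
  · intro j _ hj
    simp [hj]
  · simp

lemma volume_crosspolytope (hd : 1 ≤ d) :
    volume {x : E d | ∑ i, |x i| ≤ 1} = ENNReal.ofReal (2 ^ d / d.factorial) := by
  have : Nonempty (Fin d) := ⟨⟨0, hd⟩⟩
  have h := MeasureTheory.volume_sum_rpow_le (Fin d) (p := 1) le_rfl 1
  have hm : MeasurableSet {x : Fin d → ℝ | ∑ i, |x i| ≤ 1} :=
    (isClosed_le (by fun_prop) continuous_const).measurableSet
  have h2 := (PiLp.volume_preserving_ofLp (Fin d)).measure_preimage hm.nullMeasurableSet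
  simp only [Real.rpow_one, ne_eq, one_ne_zero, not_false_eq_true, div_self, Fintype.card_fin,
    ENNReal.ofReal_one, one_pow, one_mul, div_one] at h
  rw [h] at h2
  have hg : Real.Gamma (1 + 1) = 1 := by simpa using Real.Gamma_nat_eq_factorial 1
  rw [hg, Real.Gamma_nat_eq_factorial, mul_one] at h2
  exact h2

/-- The corner simplex has volume at least `1 / d!`. -/
lemma volume_simplex_ge (hd : 1 ≤ d) :
    ENNReal.ofReal (1 / d.factorial) ≤ volume {x : E d | (∀ i, 0 ≤ x i) ∧ ∑ i, x i ≤ 1} := by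
  classical
  set S := {x : E d | (∀ i, 0 ≤ x i) ∧ ∑ i, x i ≤ 1} with hS
  let sg : Bool → ℝ := fun b => if b then 1 else -1
  have hsg : ∀ b, |sg b| = 1 := by intro b; cases b <;> simp [sg]
  let R : (Fin d → Bool) → E d →ₗ[ℝ] E d := fun s =>
    Matrix.toLpLin 2 2 (Matrix.diagonal fun i => sg (s i))
  have hR : ∀ s, volume (R s '' S) = volume S := by
    intro s
    simp only [R]
    rw [Measure.addHaar_image_linearMap, Matrix.toLpLin_eq_toLin, LinearMap.det_toLin,
      Matrix.det_diagonal, Finset.abs_prod]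
    simp [hsg]
  -- The `2 ^ d` reflections of the corner simplex cover the cross-polytope, whose volume is `2 ^ d
  -- / d!`.
  have hcov : {x : E d | ∑ i, |x i| ≤ 1} ⊆ ⋃ s, R s '' S := by
    intro x hx
    refine Set.mem_iUnion.2 ⟨fun i => decide (0 ≤ x i), WithLp.toLp 2 fun i => |x i|,
      ⟨fun i => abs_nonneg _, hx⟩, ?_⟩
    ext i
    by_cases h : 0 ≤ x i
    · simp [R, Matrix.toLpLin_apply, Matrix.mulVec_diagonal, sg, h, abs_of_nonneg]
    · simp [R, Matrix.toLpLin_apply, Matrix.mulVec_diagonal, sg, h, abs_of_neg (not_le.1 h)]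
  have h1 := (measure_mono (μ := volume) hcov).trans (measure_iUnion_fintype_le _ _)
  rw [volume_crosspolytope hd] at h1
  simp only [hR, Finset.sum_const, Finset.card_univ, Fintype.card_fun, Fintype.card_bool,
    Fintype.card_fin, nsmul_eq_mul] at h1
  have h2 : ENNReal.ofReal (2 ^ d / d.factorial) = ((2 ^ d : ℕ) : ℝ≥0∞) *
      ENNReal.ofReal (1 / d.factorial) := by
    rw [div_eq_mul_one_div, ENNReal.ofReal_mul (by positivity)]
    congr 1
    rw [← ENNReal.ofReal_natCast]
    push_cast; rfl
  rw [h2] at h1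
  exact (ENNReal.mul_le_mul_iff_right (by positivity) (ENNReal.natCast_ne_top _)).1 h1

/-! ### Positions of a convex body in the cube -/

/-- A compact spanning set contains a basis in which all its members have coordinates in
`[-1, 1]`: one of maximal determinant. -/
lemma exists_basis_abs_repr_le_one {S : Set (E d)} (hS : IsCompact S)
    (hspan : Submodule.span ℝ S = ⊤) :
    ∃ b : Module.Basis (Fin d) ℝ (E d), (∀ i, b i ∈ S) ∧ ∀ x ∈ S, ∀ i, |b.repr x i| ≤ 1 := by
  classical
  obtain ⟨v₀, hv₀, hli₀⟩ := exists_linearIndependent_of_span_eq_top hspan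
  let e : Module.Basis (Fin d) ℝ (E d) := PiLp.basisFun 2 ℝ (Fin d)
  have hcont : Continuous fun v : Fin d → E d => |e.det v| := by
    simp only [Module.Basis.det_apply]
    refine (Continuous.matrix_det ?_).abs
    refine continuous_matrix fun i j => ?_
    simp only [Module.Basis.toMatrix_apply, e, PiLp.basisFun_repr]
    fun_prop
  obtain ⟨v, hv, hmax⟩ := (isCompact_univ_pi fun _ : Fin d => hS).exists_isMaxOn
    ⟨v₀, fun i _ => hv₀ i⟩ hcont.continuousOn
  have hspan_of : ∀ {w : Fin d → E d}, LinearIndependent ℝ w →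
      ⊤ ≤ Submodule.span ℝ (Set.range w) := fun h =>
    (h.span_eq_top_of_card_eq_finrank' (by simp)).ge
  have hpos : 0 < |e.det v| := by
    refine lt_of_lt_of_le (abs_pos.2 ?_) (hmax (fun i _ => hv₀ i : v₀ ∈ Set.univ.pi fun _ => S))
    exact ((Module.Basis.is_basis_iff_det e).1 ⟨hli₀, top_le_iff.1 (hspan_of hli₀)⟩).ne_zero
  have hbasis := (Module.Basis.is_basis_iff_det e (v := v)).2
    (isUnit_iff_ne_zero.2 (abs_pos.1 hpos))
  refine ⟨Module.Basis.mk hbasis.1 hbasis.2.ge, fun i => ?_, fun x hx i => ?_⟩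
  · rw [Module.Basis.mk_apply]; exact hv i trivial
  -- Cramer's rule: a coordinate of `x` is the ratio of the determinant with `x` substituted to the
  -- maximal one.
  · have h1 := congrArg (fun f : E d →ₗ[ℝ] ℝ => f x)
      (e.det_smul_mk_coord_eq_det_update hbasis.1 hbasis.2.ge i)
    have h2 : e.det v * (Module.Basis.mk hbasis.1 hbasis.2.ge).repr x i =
        e.det (Function.update v i x) := h1
    have h3 : |e.det (Function.update v i x)| ≤ |e.det v| := by
      refine hmax (a := Function.update v i x) fun j _ => ?_
      by_cases hj : j = i
      · subst hj; simpa using hx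
      · simpa [hj] using hv j trivial
    rw [← h2, abs_mul] at h3
    exact le_of_mul_le_mul_left (by linarith) hpos

/-- Every convex body has an affine image between the corner simplex and `[-1, 1]ᵈ`. -/
lemma exists_affineEquiv_between {K : Set (E d)} (hK : IsCompact K) (hint : (interior K).Nonempty) :
    ∃ F : E d ≃ᵃ[ℝ] E d, (∀ x ∈ K, ∀ i, |F x i| ≤ 1) ∧ (0 : E d) ∈ F '' K ∧
      ∀ i, EuclideanSpace.single i 1 ∈ F '' K := by
  obtain ⟨p, hp⟩ := hint
  have hS : IsCompact ((fun x => x - p) '' K) := hK.image (by fun_prop)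
  have hspan : Submodule.span ℝ ((fun x => x - p) '' K) = ⊤ := by
    refine Submodule.eq_top_of_nonempty_interior' _ ⟨0, ?_⟩
    rw [mem_interior_iff_mem_nhds]
    have h1 : (fun x => x - p) '' K ∈ nhds (0 : E d) := by
      have := (Homeomorph.subRight p).isOpenMap.image_mem_nhds (mem_interior_iff_mem_nhds.1 hp)
      simpa using this
    exact Filter.mem_of_superset h1 Submodule.subset_span
  obtain ⟨b, hbS, hb⟩ := exists_basis_abs_repr_le_one hS hspan
  let A : E d ≃ₗ[ℝ] E d := b.equivFun.trans (WithLp.linearEquiv 2 ℝ (Fin d → ℝ)).symm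
  have hA : ∀ x i, A x i = b.repr x i := fun x i => rfl
  let F : E d ≃ᵃ[ℝ] E d := (AffineEquiv.constVAdd ℝ (E d) (-p)).trans A.toAffineEquiv
  have hF : ∀ x, F x = A (x - p) := by
    intro x
    simp [F, sub_eq_neg_add]
  refine ⟨F, fun x hx i => ?_, ⟨p, interior_subset hp, by simp [hF]⟩, fun i => ?_⟩
  · rw [hF, hA]; exact hb _ ⟨x, hx, rfl⟩ i
  · obtain ⟨x, hx, hxb⟩ := hbS i
    refine ⟨x, hx, ?_⟩
    ext j
    change x - p = b i at hxb
    rw [hF, hA, hxb]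
    simp [Finsupp.single_apply, eq_comm]

lemma simplex_subset_of_convex {K : Set (E d)} (hK : Convex ℝ K) (h0 : (0 : E d) ∈ K)
    (h1 : ∀ i, EuclideanSpace.single i (1 : ℝ) ∈ K) :
    {x : E d | (∀ i, 0 ≤ x i) ∧ ∑ i, x i ≤ 1} ⊆ K := by
  intro x hx
  have hsum : x = ∑ o : Option (Fin d), (o.elim (1 - ∑ i, x i) fun i => x i) •
      (o.elim (0 : E d) fun i => EuclideanSpace.single i (1 : ℝ)) := by
    ext j
    simp [Fintype.sum_option, Finset.sum_apply, Pi.single_apply]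
  rw [hsum]
  refine hK.sum_mem ?_ ?_ ?_
  · rintro (_ | i) -
    · simpa using hx.2
    · exact hx.1 i
  · simp [Fintype.sum_option]
  · rintro (_ | i) -
    · exact h0
    · exact h1 i

lemma convex_image (T : E d ≃ᵃ[ℝ] E d) {K : Set (E d)} (hK : Convex ℝ K) : Convex ℝ (T '' K) :=
  hK.affine_image (T : E d →ᵃ[ℝ] E d)

/-- Scaling by `s` followed by translation by `t`. -/
noncomputable def scale (s : ℝ) (hs : s ≠ 0) (t : E d) : E d ≃ᵃ[ℝ] E d :=
  (LinearEquiv.smulOfNeZero ℝ (E d) s hs).toAffineEquiv.trans (AffineEquiv.constVAdd ℝ (E d) t)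

lemma scale_apply (s : ℝ) (hs : s ≠ 0) (t x : E d) : scale s hs t x = s • x + t := by
  simp [scale, add_comm]

lemma jac_scale (s : ℝ) (hs : s ≠ 0) (t : E d) : jac (scale s hs t) = |s| ^ d := by
  have h : ((scale s hs t).linear : E d →ₗ[ℝ] E d) = s • LinearMap.id := by
    ext x : 1
    rfl
  rw [jac, h, LinearMap.det_smul, LinearMap.det_id, mul_one, abs_pow]
  simp

/-- Every convex body has a position in the middle of the unit cube with large volume. -/
lemma exists_position (hd : 1 ≤ d) {K : Set (E d)} (hK : IsCompact K) (hconv : Convex ℝ K)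
    (hint : (interior K).Nonempty) :
    ∃ T : E d ≃ᵃ[ℝ] E d, (∀ x ∈ K, ∀ i, 1 / 20 ≤ T x i ∧ T x i ≤ 19 / 20) ∧
      ENNReal.ofReal ((9 / 20) ^ d / d.factorial) ≤ volume (T '' K) := by
  obtain ⟨F, hF, h0, h1⟩ := exists_affineEquiv_between hK hint
  -- The factor `9/20` leaves a margin of `1/20` at the faces of the cube, just what passing to a
  -- close map may use up.
  have hs : (9 / 20 : ℝ) ≠ 0 := by norm_num
  let t : E d := WithLp.toLp 2 fun _ => 1 / 2
  refine ⟨F.trans (scale (9 / 20) hs t), fun x hx i => ?_, ?_⟩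
  · have := abs_le.1 (hF x hx i)
    simp only [AffineEquiv.trans_apply, scale_apply, PiLp.add_apply, PiLp.smul_apply, t,
      smul_eq_mul]
    constructor <;> linarith [this.1, this.2]
  · have h2 : (F.trans (scale (9 / 20) hs t)) '' K = scale (9 / 20) hs t '' (F '' K) := by
      rw [Set.image_image]; rfl
    have h3 := (volume_simplex_ge hd).trans
      (measure_mono (simplex_subset_of_convex (convex_image F hconv) h0 h1))
    rw [h2, volume_image, jac_scale, div_eq_mul_one_div, ENNReal.ofReal_mul (by positivity),
      abs_of_pos (by norm_num)]
    gcongr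

/-! ### Volume ratio and directional width -/

/-- If a convex set has at most twice the volume of a subset, then in every direction it is at most
`2d` times as wide. -/
lemma sub_le_of_volume_le {K L : Set (E d)} (hKL : K ⊆ L) (hL : Convex ℝ L) (hd : 1 ≤ d)
    (hKm : MeasurableSet K) (hLm : MeasurableSet L) (hpos : 0 < volume K) (hfin : volume L ≠ ⊤)
    (hvol : volume L ≤ 2 * volume K) (f : E d →ᵃ[ℝ] ℝ) {a b : ℝ}
    (hK : ∀ x ∈ K, a ≤ f x ∧ f x ≤ b) {x y : E d} (hx : x ∈ L) (hy : y ∈ L) :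
    f x - f y ≤ 2 * d * (b - a) := by
  by_contra hlt
  push Not at hlt
  have hd0 : (0 : ℝ) < d := by exact_mod_cast hd
  have hab : 0 ≤ b - a := by
    obtain ⟨z, hz⟩ := nonempty_of_measure_ne_zero hpos.ne'
    linarith [(hK z hz).1, (hK z hz).2]
  have hW : 0 < f x - f y := lt_of_le_of_lt (by positivity) hlt
  -- the ratio of the homotheties is `1 - w`
  obtain ⟨w, hw1, hw2⟩ : ∃ w, (b - a) / (f x - f y) < w ∧ w < 1 / (2 * d) := by
    refine exists_between ?_
    rw [div_lt_div_iff₀ hW (by positivity)]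
    linarith
  have hw0 : 0 < w := lt_of_le_of_lt (by positivity) hw1
  have hwd : w * (2 * d) < 1 := by rwa [lt_div_iff₀ (by positivity)] at hw2
  have hd1 : (1 : ℝ) ≤ d := by exact_mod_cast hd
  have hwlt : w < 1 := by nlinarith
  rw [div_lt_iff₀ hW] at hw1
  -- `L` is cut at the level `m = n / (1 - w)` of `f`. The upper part, shrunk towards `x`, lands
  -- above `b`; the lower part, shrunk towards `y`, lands below `a`. Such a level exists because `w
  -- * (f x - f y) > b - a`.
  obtain ⟨n, hn1, hn2⟩ : ∃ n, b - w * f x < n ∧ n < a - w * f y :=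
    exists_between (by linarith)
  set m := n / (1 - w) with hm
  have hmn : (1 - w) * m = n := by rw [hm]; field_simp [show (1 - w) ≠ 0 by linarith]
  have hl : ∀ c z, f (AffineMap.homothety c (1 - w) z) = w * f c + (1 - w) * f z := by
    intro c z
    rw [AffineMap.homothety_eq_lineMap, AffineMap.apply_lineMap, AffineMap.lineMap_apply]
    simp only [vsub_eq_sub, smul_eq_mul, vadd_eq_add]
    ring
  have hmemL : ∀ c ∈ L, ∀ z ∈ L, AffineMap.homothety c (1 - w) z ∈ L := by
    intro c hc z hz
    rw [AffineMap.homothety_eq_lineMap]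
    exact hL.lineMap_mem hc hz ⟨by linarith, by linarith⟩
  have hfc : Continuous f := f.continuous_of_finiteDimensional
  have hFm : MeasurableSet {z | m ≤ f z} := (isClosed_le continuous_const hfc).measurableSet
  set L1 := L ∩ {z | m ≤ f z}
  set L2 := L \ {z | m ≤ f z}
  have hdisj1 : Disjoint (AffineMap.homothety x (1 - w) '' L1 ∪ AffineMap.homothety y (1 - w) '' L2)
      K := by
    rw [Set.disjoint_left]
    rintro _ (⟨z, hz, rfl⟩ | ⟨z, hz, rfl⟩) hzK
    · have h1 := (hK _ hzK).2
      have h2 : m ≤ f z := hz.2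
      rw [hl] at h1
      nlinarith
    · have h1 := (hK _ hzK).1
      have h2 : f z < m := not_le.1 hz.2
      rw [hl] at h1
      nlinarith
  have hdisj2 : Disjoint (AffineMap.homothety x (1 - w) '' L1)
      (AffineMap.homothety y (1 - w) '' L2) := by
    rw [Set.disjoint_left]
    rintro _ ⟨z, hz, rfl⟩ ⟨z', hz', h⟩
    have h1 := congrArg f h
    rw [hl, hl] at h1
    have h2 : m ≤ f z := hz.2
    have h3 : f z' < m := not_le.1 hz'.2
    nlinarith
  have hsub : (AffineMap.homothety x (1 - w) '' L1 ∪ AffineMap.homothety y (1 - w) '' L2) ∪ K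
      ⊆ L := by
    refine Set.union_subset (Set.union_subset ?_ ?_) hKL
    · rintro _ ⟨z, hz, rfl⟩; exact hmemL x hx z hz.1
    · rintro _ ⟨z, hz, rfl⟩; exact hmemL y hy z hz.1
  have hL2m : MeasurableSet (AffineMap.homothety y (1 - w) '' L2) := by
    let U : ℝˣ := Units.mk0 (1 - w) (by linarith)
    have h : (AffineMap.homothety y (1 - w) : E d → E d) = AffineEquiv.homothetyUnitsMulHom y U :=
      rfl
    rw [h]
    exact ((AffineEquiv.toContinuousAffineEquiv
      (AffineEquiv.homothetyUnitsMulHom y U)).toHomeomorph.toMeasurableEquiv.measurableSet_image).2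
      (hLm.diff hFm)
  have hvol1 := measure_mono (μ := volume) hsub
  rw [measure_union hdisj1 hKm, measure_union hdisj2 hL2m, Measure.addHaar_image_homothety,
    Measure.addHaar_image_homothety, ← mul_add, measure_inter_add_sdiff _ hFm] at hvol1
  -- Bernoulli's inequality with `w * d < 1 / 2`. The shrunken parts fill more than half of `L` and
  -- miss `K`, which fills at least half: a contradiction.
  have hpow : 1 / 2 < (1 - w) ^ d := by
    have := one_add_mul_le_pow (a := -w) (by linarith) d
    rw [← sub_eq_add_neg] at this
    refine lt_of_lt_of_le ?_ this
    nlinarith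
  have hKfin : volume K ≠ ⊤ := ne_top_of_le_ne_top hfin (measure_mono hKL)
  have h1 := ENNReal.toReal_mono hfin hvol1
  have h2 := ENNReal.toReal_mono (ENNReal.mul_ne_top (by norm_num) hKfin) hvol
  have h3 : 0 < (volume K).toReal := ENNReal.toReal_pos hpos.ne' hKfin
  have h4 : (volume K).toReal ≤ (volume L).toReal := ENNReal.toReal_mono hfin (measure_mono hKL)
  rw [ENNReal.toReal_add (ENNReal.mul_ne_top ENNReal.ofReal_ne_top hfin) hKfin, ENNReal.toReal_mul,
    ENNReal.toReal_ofReal (abs_nonneg _), finrank_euclideanSpace, Fintype.card_fin,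
    abs_of_pos (by linarith)] at h1
  rw [ENNReal.toReal_mul, ENNReal.toReal_ofNat] at h2
  nlinarith

/-! ### Facet functionals and polytopes -/

/-- The facet functionals of a Tukey region, seen from an interior point `p` and normalized to have
value `1` on their facets. -/
def facets (P : Finset (E d)) (k : ℕ) (p : E d) : Set (E d) :=
  {u | (∃ q : Fin d → E d, (∀ i, q i ∈ P) ∧ LinearIndependent ℝ (fun i => q i - p) ∧
    ∀ i, ⟪u, q i - p⟫ = 1) ∧ ∀ y ∈ tukeyRegion P k, ⟪u, y - p⟫ ≤ 1}

/-- The `d` independent equations determine the functional, so there are at most as many as choices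
of `d` points of `P`. -/
lemma finite_facets (P : Finset (E d)) (k : ℕ) (p : E d) : (facets P k p).Finite := by
  have h1 : (Set.univ.pi fun _ : Fin d => (P : Set (E d))).Finite :=
    Set.Finite.pi fun _ => P.finite_toSet
  refine (h1.biUnion (t := fun q => {u : E d | LinearIndependent ℝ (fun i => q i - p) ∧
    ∀ i, ⟪u, q i - p⟫ = 1}) fun q _ => Set.Subsingleton.finite ?_).subset ?_
  · rintro u ⟨hli, hu⟩ u' ⟨-, hu'⟩
    have hspan := hli.span_eq_top_of_card_eq_finrank' (by simp)
    refine ext_inner_right ℝ fun v => ?_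
    have hv : v ∈ Submodule.span ℝ (Set.range fun i => q i - p) := by rw [hspan]; trivial
    induction hv using Submodule.span_induction with
    | mem x hx => obtain ⟨i, rfl⟩ := hx; rw [hu i, hu' i]
    | zero => simp
    | add x y _ _ hx hy => rw [inner_add_right, inner_add_right, hx, hy]
    | smul c x _ hx => rw [inner_smul_right, inner_smul_right, hx]
  · rintro u ⟨⟨q, hq, hli, hu⟩, -⟩
    exact Set.mem_biUnion (fun i _ => hq i) ⟨hli, hu⟩

lemma mem_tukeyRegion_iff_facets (hd : 1 ≤ d) {P : Finset (E d)} {k : ℕ} {p : E d}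
    (hp : p ∈ interior (tukeyRegion P k)) (x : E d) :
    x ∈ tukeyRegion P k ↔ ∀ u ∈ facets P k p, ⟪u, x - p⟫ ≤ 1 := by
  refine ⟨fun hx u hu => hu.2 x hx, fun h => ?_⟩
  by_contra hx
  obtain ⟨u, hq, hu, hlt⟩ := exists_facet hd hp hx
  exact absurd (h u ⟨hq, hu⟩) (not_le.2 hlt)

lemma isPolytope_image_tukeyRegion (hd : 1 ≤ d) {P : Finset (E d)} {k : ℕ}
    (hint : (interior (tukeyRegion P k)).Nonempty) (T : E d ≃ᵃ[ℝ] E d) :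
    IsPolytope (T '' tukeyRegion P k) := by
  classical
  obtain ⟨p, hp⟩ := hint
  let A : E d →ₗ[ℝ] E d := (T.symm.linear : E d →ₗ[ℝ] E d)
  refine ⟨(finite_facets P k p).toFinset.image fun u =>
    (LinearMap.adjoint A u, 1 - ⟪u, T.symm 0 - p⟫), ?_⟩
  have key : ∀ u y : E d, ⟪u, T.symm y - p⟫ = ⟪y, LinearMap.adjoint A u⟫ + ⟪u, T.symm 0 - p⟫ := by
    intro u y
    have h : T.symm y = A y + T.symm 0 := by
      have := T.symm.map_vadd 0 y
      rw [vadd_eq_add, vadd_eq_add, add_zero] at this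
      exact this
    rw [LinearMap.adjoint_inner_right, h, real_inner_comm u (A y), ← inner_add_right]
    congr 1
    abel
  ext y
  simp only [Finset.mem_image, Set.Finite.mem_toFinset, forall_exists_index, and_imp,
    forall_apply_eq_imp_iff₂, Set.mem_ofPred_eq]
  have hmem : y ∈ T '' tukeyRegion P k ↔ T.symm y ∈ tukeyRegion P k :=
    ⟨fun ⟨x, hx, h⟩ => by rw [← h, T.symm_apply_apply]; exact hx,
      fun h => ⟨_, h, T.apply_symm_apply y⟩⟩
  rw [hmem, mem_tukeyRegion_iff_facets hd hp]
  refine forall₂_congr fun u _ => ?_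
  rw [key u y]
  constructor <;> intro h <;> linarith

/-! ### From tight positions to fatness -/

lemma isCompact_cube (a b : ℝ) : IsCompact {x : E d | ∀ i, a ≤ x i ∧ x i ≤ b} := by
  have h : {x : E d | ∀ i, a ≤ x i ∧ x i ≤ b} =
      WithLp.toLp 2 '' Set.Icc (fun _ => a : Fin d → ℝ) (fun _ => b) := by
    ext x
    constructor
    · intro hx
      exact ⟨x.ofLp, ⟨fun i => (hx i).1, fun i => (hx i).2⟩, rfl⟩
    · rintro ⟨y, hy, rfl⟩ i
      exact ⟨hy.1 i, hy.2 i⟩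
  rw [h]
  exact isCompact_Icc.image (PiLp.continuous_toLp 2 _)

lemma isCompact_unitCube : IsCompact (unitCube d) := isCompact_cube 0 1

lemma continuous_affineEquiv (T : E d ≃ᵃ[ℝ] E d) : Continuous T :=
  (T : E d →ᵃ[ℝ] E d).continuous_of_finiteDimensional

/-- Every affine equivalence, scaled down and translated, maps the unit cube into itself. -/
lemma exists_scale_unitCube (T : E d ≃ᵃ[ℝ] E d) :
    ∃ (M : E d ≃ᵃ[ℝ] E d) (s : ℝ) (t : E d), 0 < s ∧ (∀ x, M x = s • T x + t) ∧
      M '' unitCube d ⊆ unitCube d := by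
  obtain ⟨R, hR⟩ := (isCompact_unitCube.image (continuous_affineEquiv T)).isBounded.exists_norm_le
  have hR0 : 0 < |R| + 1 := by positivity
  have hs : 0 < 1 / (2 * (|R| + 1)) := by positivity
  let t : E d := WithLp.toLp 2 fun _ => 1 / 2
  refine ⟨T.trans (scale _ hs.ne' t), _, t, hs, fun x => by simp [scale_apply], ?_⟩
  rintro _ ⟨x, hx, rfl⟩ i
  have h1 : |T x i| ≤ |R| + 1 := by
    have h2 := (PiLp.norm_apply_le (T x) i).trans (hR _ ⟨x, hx, rfl⟩)
    rw [Real.norm_eq_abs] at h2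
    linarith [le_abs_self R]
  have h3 := abs_le.1 h1
  have h4 : |1 / (2 * (|R| + 1)) * T x i| ≤ 1 / 2 := by
    rw [abs_mul, abs_of_pos hs, one_div_mul_eq_div, div_le_iff₀ (by positivity)]
    linarith
  have h5 := abs_le.1 h4
  simp only [AffineEquiv.trans_apply, scale_apply, PiLp.add_apply, PiLp.smul_apply, t, smul_eq_mul]
  constructor <;> linarith [h5.1, h5.2]

/-- A unit vector has a coordinate of size at least `1 / d` (even `1 / √d`), so by `volume_slab_le`
a slab containing `C` has thickness at least `v / d`. -/
lemma le_width_of_volume (hd : 1 ≤ d) {C : Set (E d)} (hC : C ⊆ unitCube d) {v : ℝ} (hv : 0 < v)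
    (hvol : ENNReal.ofReal v ≤ volume C) : ENNReal.ofReal (v / d) ≤ width C := by
  have hd0 : (0 : ℝ) < d := by exact_mod_cast hd
  refine le_iInf ?_
  rintro ⟨u, hu⟩
  have hu1 : ‖u‖ = 1 := mem_sphere_zero_iff_norm.1 hu
  obtain ⟨i, hi⟩ : ∃ i, 1 / (d : ℝ) ≤ |u i| := by
    by_contra h
    push Not at h
    have h1 : ∑ i, (u i) ^ 2 = 1 := by
      have := EuclideanSpace.real_norm_sq_eq u
      rw [hu1] at this
      linarith
    have : Nonempty (Fin d) := ⟨⟨0, hd⟩⟩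
    have h2 : ∑ i, (u i) ^ 2 < ∑ _i : Fin d, 1 / (d : ℝ) := by
      refine Finset.sum_lt_sum_of_nonempty Finset.univ_nonempty fun i _ => ?_
      have h3 : 1 / (d : ℝ) ≤ 1 := by
        rw [div_le_one hd0]; exact_mod_cast hd
      have := h i
      rw [← sq_abs]
      nlinarith [abs_nonneg (u i)]
    rw [h1] at h2
    simp [hd0.ne'] at h2
  set W := ⨆ p ∈ C, ⨆ q ∈ C, ENNReal.ofReal ⟪p - q, u⟫ with hW
  change _ ≤ W
  by_cases hWtop : W = ⊤
  · rw [hWtop]; exact le_top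
  have hle : ∀ p ∈ C, ∀ q ∈ C, ⟪p - q, u⟫ ≤ W.toReal := by
    intro p hp q hq
    rw [← ENNReal.ofReal_le_iff_le_toReal hWtop, hW]
    exact le_iSup₂_of_le p hp (le_iSup₂_of_le q hq le_rfl)
  obtain ⟨p₀, hp₀⟩ : C.Nonempty := nonempty_of_measure_ne_zero
    (lt_of_lt_of_le (ENNReal.ofReal_pos.2 hv) hvol).ne'
  have hbdd : BddBelow ((fun x => ⟪x, u⟫) '' C) := by
    refine ⟨⟪p₀, u⟫ - W.toReal, ?_⟩
    rintro _ ⟨x, hx, rfl⟩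
    have := hle p₀ hp₀ x hx
    rw [inner_sub_left] at this
    change _ ≤ ⟪x, u⟫
    linarith
  have hslab := volume_slab_le hC (fun j => u j) i
    (c := sInf ((fun x => ⟪x, u⟫) '' C)) (l := W.toReal) (by
      intro x hx
      have hin : ∑ j, u j * x j = ⟪x, u⟫ := by
        simp [PiLp.inner_apply]
      rw [hin]
      refine ⟨csInf_le hbdd ⟨x, hx, rfl⟩, ?_⟩
      rw [← sub_le_iff_le_add]
      refine le_csInf ⟨_, p₀, hp₀, rfl⟩ ?_
      rintro _ ⟨y, hy, rfl⟩
      have := hle x hx y hy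
      rw [inner_sub_left] at this
      change _ ≤ ⟪y, u⟫
      linarith)
  rw [ENNReal.ofReal_toReal hWtop] at hslab
  refine le_trans ?_ hslab
  rw [div_eq_inv_mul, ENNReal.ofReal_mul (by positivity), ← one_div]
  gcongr

lemma width_scale {S : Set (E d)} {T M : E d → E d} {s : ℝ} {t : E d} (hs : 0 < s)
    (hM : ∀ x, M x = s • T x + t) : ENNReal.ofReal s * width (T '' S) ≤ width (M '' S) := by
  refine le_iInf fun u => ?_
  refine (mul_le_mul_right (iInf_le _ u) _).trans ?_
  simp only [ENNReal.mul_iSup, iSup_image]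
  refine iSup₂_mono fun p hp => iSup₂_mono fun q hq => ?_
  rw [← ENNReal.ofReal_mul hs.le, hM, hM, add_sub_add_right_eq_sub, ← smul_sub, inner_smul_left]
  rfl

/-- `T` maps `K` into the unit cube, onto a set of volume at least `v`. -/
def IsTight (T : E d ≃ᵃ[ℝ] E d) (K : Set (E d)) (v : ℝ) : Prop :=
  T '' K ⊆ unitCube d ∧ ENNReal.ofReal v ≤ volume (T '' K)

lemma IsTight.volume_pos {T : E d ≃ᵃ[ℝ] E d} {K : Set (E d)} {v : ℝ} (h : IsTight T K v)
    (hv : 0 < v) : 0 < volume K := by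
  have h1 := lt_of_lt_of_le (ENNReal.ofReal_pos.2 hv) h.2
  rw [volume_image] at h1
  exact pos_of_mul_pos_right h1 zero_le

/-- Each coordinate of `T` varies by at most `1` on `K`, hence by at most `2d` on `L`; the `d`
coordinates together give `2d * √d`. -/
lemma ediam_image_le (hd : 1 ≤ d) {K L : Set (E d)} (hKL : K ⊆ L) (hL : Convex ℝ L)
    (hKm : MeasurableSet K) (hLm : MeasurableSet L) (hpos : 0 < volume K) (hfin : volume L ≠ ⊤)
    (hvol : volume L ≤ 2 * volume K) {T : E d ≃ᵃ[ℝ] E d} (hT : T '' K ⊆ unitCube d) :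
    Metric.ediam (T '' L) ≤ ENNReal.ofReal (2 * (d : ℝ) ^ (3 / 2 : ℝ)) := by
  have hd0 : (0 : ℝ) < d := by exact_mod_cast hd
  have hcoord : ∀ x ∈ L, ∀ y ∈ L, ∀ i, T x i - T y i ≤ 2 * d := by
    intro x hx y hy i
    let f : E d →ᵃ[ℝ] ℝ :=
      ((PiLp.projₗ 2 (fun _ : Fin d => ℝ) i).toAffineMap).comp (T : E d →ᵃ[ℝ] E d)
    have := sub_le_of_volume_le hKL hL hd hKm hLm hpos hfin hvol f (a := 0) (b := 1)
      (fun z hz => hT ⟨z, hz, rfl⟩ i) hx hy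
    rw [sub_zero, mul_one] at this
    exact this
  refine Metric.ediam_le ?_
  rintro _ ⟨x, hx, rfl⟩ _ ⟨y, hy, rfl⟩
  rw [edist_dist]
  refine ENNReal.ofReal_le_ofReal ?_
  rw [EuclideanSpace.dist_eq]
  refine Real.sqrt_le_iff.2 ⟨by positivity, ?_⟩
  have h1 : ∀ i, dist (T x i) (T y i) ^ 2 ≤ (2 * d) ^ 2 := by
    intro i
    rw [Real.dist_eq, sq_abs]
    have h2 := hcoord x hx y hy i
    have h3 := hcoord y hy x hx i
    exact sq_le_sq' (by linarith) h2
  refine (Finset.sum_le_sum fun i _ => h1 i).trans (le_of_eq ?_)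
  rw [mul_pow (2 : ℝ) ((d : ℝ) ^ (3 / 2 : ℝ)), ← Real.rpow_natCast ((d : ℝ) ^ (3 / 2 : ℝ)),
    ← Real.rpow_mul hd0.le]
  norm_num
  ring

/-- The two conclusions about the maps `M` and `M̃ = T`. -/
def Conclusion (T : (E d ≃ᵃ[ℝ] E d) × (E d ≃ᵃ[ℝ] E d)) (P : Finset (E d)) (κ κ' : ℕ) : Prop :=
  (T.1 '' unitCube d ⊆ unitCube d ∧ IsPolytope (T.1 '' tukeyRegion P κ) ∧
    IsFat T.1 P κ (4 * (d : ℝ) ^ (5 / 2 : ℝ) * 5 ^ d * (d.factorial : ℝ)) (κ - κ')) ∧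
  (T.2 '' tukeyRegion P κ ⊆ unitCube d ∧
    IsAbsolutelyFat T.2 P κ (2 * (d : ℝ) * 5 ^ d * (d.factorial : ℝ)))

/-- The pair consisting of a scaled copy of `T`, which maps the unit cube into itself, and `T`. -/
noncomputable def withShrunk (T : E d ≃ᵃ[ℝ] E d) : (E d ≃ᵃ[ℝ] E d) × (E d ≃ᵃ[ℝ] E d) :=
  ((exists_scale_unitCube T).choose, T)

/-- The width is at least `v / d` with `v = 1 / (2 * 5 ^ d * d!)`, the diameter at most `2 * d ^
(3/2)`; their quotient is the constant of (i). Passing to the shrunken map multiplies both by `s`.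
-/
theorem conclusion_of_isTight (hd : 1 ≤ d) {P : Finset (E d)} {κ κ' : ℕ} (hκ : 1 ≤ κ)
    (hκ' : κ' ≤ κ) (hpos : 0 < volume (tukeyRegion P κ))
    (hvol : volume (tukeyRegion P κ') / 2 ≤ volume (tukeyRegion P κ)) {T : E d ≃ᵃ[ℝ] E d}
    (hT : IsTight T (tukeyRegion P κ) (1 / (2 * (5 ^ d * d.factorial)))) :
    Conclusion (withShrunk T) P κ κ' := by
  have hd0 : (0 : ℝ) < d := by exact_mod_cast hd
  obtain ⟨s, t, hs, hM, hcube⟩ := (exists_scale_unitCube T).choose_spec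
  have hwidth := le_width_of_volume hd hT.1 (by positivity) hT.2
  have hc : 1 / (2 * (5 ^ d * (d.factorial : ℝ))) / d = 1 / (2 * (d : ℝ) * 5 ^ d * d.factorial) := by
    field_simp
  rw [hc] at hwidth
  have hfin : volume (tukeyRegion P κ) ≠ ⊤ := (isCompact_tukeyRegion hd P hκ).measure_lt_top.ne
  have hvol2 : volume (tukeyRegion P κ') ≤ 2 * volume (tukeyRegion P κ) := by
    rwa [ENNReal.div_le_iff' (by norm_num) (by norm_num)] at hvol
  refine ⟨⟨hcube, isPolytope_image_tukeyRegion hd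
    (interior_nonempty_of_volume_pos (convex_tukeyRegion hd P κ) hpos) _, ?_⟩, hT.1, hwidth⟩
  change _ * _ ≤ _
  rw [Nat.sub_sub_self hκ']
  refine le_trans ?_ (width_scale hs hM)
  have hdiam : Metric.ediam ((exists_scale_unitCube T).choose '' tukeyRegion P κ') ≤
      ENNReal.ofReal s * ENNReal.ofReal (2 * (d : ℝ) ^ (3 / 2 : ℝ)) := by
    refine le_trans ?_ (mul_le_mul_right (ediam_image_le hd (tukeyRegion_anti hκ')
      (convex_tukeyRegion hd P κ') (isClosed_tukeyRegion hd P κ).measurableSet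
      (isClosed_tukeyRegion hd P κ').measurableSet hpos
      (ne_top_of_le_ne_top (ENNReal.mul_ne_top (by norm_num) hfin) hvol2) hvol2 hT.1) _)
    refine Metric.ediam_le ?_
    rintro _ ⟨x, hx, rfl⟩ _ ⟨y, hy, rfl⟩
    rw [hM, hM, edist_add_right, edist_smul₀, ENNReal.smul_def, smul_eq_mul]
    refine mul_le_mul' (le_of_eq ?_) (Metric.edist_le_ediam_of_mem ⟨x, hx, rfl⟩ ⟨y, hy, rfl⟩)
    rw [← enorm_eq_nnnorm, Real.enorm_eq_ofReal hs.le]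
  refine (mul_le_mul_right hdiam _).trans ?_
  rw [mul_left_comm]
  refine mul_le_mul_right (le_trans (le_of_eq ?_) hwidth) _
  rw [← ENNReal.ofReal_mul (by positivity)]
  congr 1
  have h5 : (d : ℝ) ^ (5 / 2 : ℝ) = d * (d : ℝ) ^ (3 / 2 : ℝ) := by
    rw [← Real.rpow_one_add' hd0.le (by norm_num)]
    norm_num
  rw [h5]
  have : (0 : ℝ) < (d : ℝ) ^ (3 / 2 : ℝ) := by positivity
  field_simp
  norm_num

/-! ### Nets of positions and their packing number -/

/-- Two positions are close if each transition map moves the points of the cube by little. -/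
def Close (T T' : E d ≃ᵃ[ℝ] E d) : Prop :=
  ∀ y ∈ unitCube d, ∀ i, |T' (T.symm y) i - y i| ≤ 1 / 20 ∧ |T (T'.symm y) i - y i| ≤ 1 / 20

lemma Close.symm {T T' : E d ≃ᵃ[ℝ] E d} (h : Close T T') : Close T' T :=
  fun y hy i => (h y hy i).symm

lemma Close.refl (T : E d ≃ᵃ[ℝ] E d) : Close T T := by
  intro y _ i
  simp

/-- Maximal families of pairwise non-close positions. -/
def IsNet (N : Set (E d ≃ᵃ[ℝ] E d)) : Prop :=
  (∀ T ∈ N, ∀ T' ∈ N, Close T T' → T = T') ∧ ∀ T, ∃ T' ∈ N, Close T T'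

/-- Zorn's lemma. Maximality gives covering because closeness is reflexive and symmetric;
transitivity is not needed. -/
lemma exists_isNet (d : ℕ) : ∃ N : Set (E d ≃ᵃ[ℝ] E d), IsNet N := by
  obtain ⟨N, hN⟩ := zorn_subset {N : Set (E d ≃ᵃ[ℝ] E d) | ∀ T ∈ N, ∀ T' ∈ N, Close T T' → T = T'} (by
    intro c hc hchain
    refine ⟨⋃₀ c, ?_, fun s hs => Set.subset_sUnion_of_mem hs⟩
    rintro T ⟨s, hs, hT⟩ T' ⟨s', hs', hT'⟩ h
    rcases hchain.total hs hs' with hss | hss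
    · exact hc hs' T (hss hT) T' hT' h
    · exact hc hs T hT T' (hss hT') h)
  refine ⟨N, hN.1, fun T => ?_⟩
  by_contra hT
  push Not at hT
  have hins : insert T N ∈ {N : Set (E d ≃ᵃ[ℝ] E d) | ∀ T ∈ N, ∀ T' ∈ N, Close T T' → T = T'} := by
    rintro A (rfl | hA) B (rfl | hB) h
    · rfl
    · exact absurd h (hT B hB)
    · exact absurd h.symm (hT A hA)
    · exact hN.1 A hA B hB h
  exact hT T (hN.2 hins (Set.subset_insert T N) (Set.mem_insert T N)) (Close.refl T)

lemma image_trans (T₀ T : E d ≃ᵃ[ℝ] E d) (K : Set (E d)) :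
    T '' K = (T₀.symm.trans T) '' (T₀ '' K) := by
  rw [Set.image_image]
  exact Set.image_congr fun x _ => by simp

/-- A body placed with margin `1/20` stays in the cube under a close map, and its volume drops by a
factor of at most `(9/10) ^ d`. -/
lemma IsNet.exists_isTight (hd : 1 ≤ d) {N : Set (E d ≃ᵃ[ℝ] E d)} (hN : IsNet N) {K : Set (E d)}
    (hK : IsCompact K) (hconv : Convex ℝ K) (hint : (interior K).Nonempty) :
    ∃ T ∈ N, IsTight T K (2 / (5 ^ d * d.factorial)) := by
  obtain ⟨T₀, hT₀, hvol⟩ := exists_position hd hK hconv hint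
  obtain ⟨T, hTN, hclose⟩ := hN.2 T₀
  refine ⟨T, hTN, ?_, ?_⟩
  · rintro _ ⟨x, hx, rfl⟩ i
    have hmem : T₀ x ∈ unitCube d := fun i => by
      constructor <;> linarith [(hT₀ x hx i).1, (hT₀ x hx i).2]
    have h1 := abs_le.1 (hclose _ hmem i).1
    rw [T₀.symm_apply_apply] at h1
    constructor <;> linarith [(hT₀ x hx i).1, (hT₀ x hx i).2, h1.1, h1.2]
  -- The inverse transition moves cube points by at most `1/20`, so the transition maps the cube
  -- onto a set covering the concentric cube of side `9/10`.
  · have hjac : ENNReal.ofReal ((9 / 10) ^ d) ≤ ENNReal.ofReal (jac (T₀.symm.trans T)) := by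
      have h1 : {x : E d | ∀ i, (1 / 20 : ℝ) ≤ x i ∧ x i ≤ 19 / 20} ⊆
          (T₀.symm.trans T) '' unitCube d := by
        intro z hz
        have hzc : z ∈ unitCube d := fun i => by
          constructor <;> linarith [(hz i).1, (hz i).2]
        refine ⟨T₀ (T.symm z), fun i => ?_, by simp⟩
        have h2 := abs_le.1 (hclose z hzc i).2
        constructor <;> linarith [(hz i).1, (hz i).2, h2.1, h2.2]
      have h2 := measure_mono (μ := volume) h1
      rw [volume_cube, volume_image, volume_unitCube, mul_one,
        ← ENNReal.ofReal_pow (by norm_num)] at h2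
      norm_num at h2 ⊢
      exact h2
    rw [image_trans T₀ T, volume_image]
    refine le_trans ?_ (mul_le_mul' hjac hvol)
    rw [← ENNReal.ofReal_mul (by positivity)]
    refine ENNReal.ofReal_le_ofReal ?_
    have h2 : (2 : ℝ) ≤ 2 ^ d := by
      simpa using pow_le_pow_right₀ (one_le_two (α := ℝ)) hd
    -- Here `5 * (9/10) * (9/20) = 2.025`. The numerator `2` thus gained survives two later halvings
    -- of volume as the `1/2` in the final constants.
    have h3 : (2 : ℝ) ^ d ≤ 5 ^ d * ((9 / 10) ^ d * (9 / 20) ^ d) := by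
      rw [← mul_pow, ← mul_pow]
      gcongr
      norm_num
    rw [mul_div_assoc', div_le_div_iff₀ (by positivity) (by positivity)]
    have h4 : (0 : ℝ) < d.factorial := by positivity
    nlinarith

lemma affine_coord (A : E d ≃ᵃ[ℝ] E d) (x : E d) (i : Fin d) :
    A x i = A 0 i + ∑ j, (A (EuclideanSpace.single j 1) i - A 0 i) * x j := by
  have h : ∀ y, A y = A.linear y + A 0 := by
    intro y
    have := A.map_vadd 0 y
    rwa [vadd_eq_add, vadd_eq_add, add_zero] at this
  have hx : x = ∑ j, x j • EuclideanSpace.single j (1 : ℝ) := by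
    ext i
    simp [Finset.sum_apply, Pi.single_apply]
  have hl : A.linear x i = ∑ j, x j * A.linear (EuclideanSpace.single j 1) i := by
    conv_lhs => rw [hx]
    simp [Finset.sum_apply]
  rw [h x, PiLp.add_apply, hl, add_comm]
  congr 1
  refine Finset.sum_congr rfl fun j _ => ?_
  rw [h (EuclideanSpace.single j 1), PiLp.add_apply]
  ring

/-- Transition maps between tight positions of the same set are bounded on the cube. -/
lemma IsTight.abs_coord_le {T₀ T : E d ≃ᵃ[ℝ] E d} {K : Set (E d)} {v : ℝ} (hv : 0 < v)
    (h₀ : IsTight T₀ K v) (h : IsTight T K v) {y : E d} (hy : y ∈ unitCube d) (i : Fin d) :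
    |T (T₀.symm y) i| ≤ 1 + d / v := by
  set A := T₀.symm.trans T with hA
  change |A y i| ≤ _
  have hAC : ∀ x ∈ T₀ '' K, 0 ≤ A x i ∧ A x i ≤ 1 := by
    rintro _ ⟨x, hx, rfl⟩
    have := h.1 ⟨x, hx, rfl⟩ i
    simpa [hA] using this
  have hcoef : ∀ j, |A (EuclideanSpace.single j 1) i - A 0 i| ≤ 1 / v := by
    intro j
    have h1 := volume_slab_le h₀.1 (fun j => A (EuclideanSpace.single j 1) i - A 0 i) j
      (c := -A 0 i) (l := 1) (by
        intro x hx
        have h2 := hAC x hx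
        rw [affine_coord A x i] at h2
        constructor <;> linarith [h2.1, h2.2])
    have h2 := (mul_le_mul_right h₀.2 _).trans h1
    rw [← ENNReal.ofReal_mul (abs_nonneg _), ENNReal.ofReal_le_ofReal_iff zero_le_one] at h2
    rwa [le_div_iff₀ hv]
  obtain ⟨x, hx⟩ : (T₀ '' K).Nonempty := nonempty_of_measure_ne_zero
    (lt_of_lt_of_le (ENNReal.ofReal_pos.2 hv) h₀.2).ne'
  have hdiff : |A y i - A x i| ≤ d / v := by
    rw [affine_coord A y i, affine_coord A x i, add_sub_add_left_eq_sub, ← Finset.sum_sub_distrib]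
    refine (Finset.abs_sum_le_sum_abs _ _).trans ?_
    have h1 : ∀ j ∈ Finset.univ, |(A (EuclideanSpace.single j 1) i - A 0 i) * y j -
        (A (EuclideanSpace.single j 1) i - A 0 i) * x j| ≤ 1 / v := by
      intro j _
      rw [← mul_sub, abs_mul]
      have h2 : |y j - x j| ≤ 1 := by
        rw [abs_le]
        constructor <;> linarith [(hy j).1, (hy j).2, (h₀.1 hx j).1, (h₀.1 hx j).2]
      calc _ ≤ 1 / v * 1 := mul_le_mul (hcoef j) h2 (abs_nonneg _) (by positivity)
        _ = 1 / v := mul_one _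
    refine (Finset.sum_le_sum h1).trans (le_of_eq ?_)
    simp [div_eq_mul_inv]
  have h1 := hAC x hx
  have h2 := abs_le.1 hdiff
  rw [abs_le]
  constructor <;> linarith [h1.1, h1.2, h2.1, h2.2]

/-- The range of the rounded entries of the transition maps between tight positions. -/
noncomputable def roundBound (d : ℕ) (v : ℝ) : ℕ :=
  ⌈(1 + d / v) * (20 * (1 + 2 * d * (1 + d / v)))⌉₊

/-- An upper bound for the number of positions in a net that are tight together with a given one. -/
noncomputable def packingBound (d : ℕ) (v : ℝ) : ℕ := (2 * roundBound d v + 1) ^ ((d + 1) * d)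

lemma packingBound_pos (d : ℕ) (v : ℝ) : 1 ≤ packingBound d v := Nat.one_le_pow _ _ (by omega)

/-- A transition map is given by its values at `0` and the unit vectors, which are `(d + 1) * d`
numbers bounded by `IsTight.abs_coord_le`. Members with equal rounded values are close, hence equal.
The body may vary with the member, so one reference position serves all regions with the same code.
-/
lemma IsNet.packing {N : Set (E d ≃ᵃ[ℝ] E d)} (hN : IsNet N) {v : ℝ} (hv : 0 < v)
    (T₀ : E d ≃ᵃ[ℝ] E d) :
    {T | T ∈ N ∧ ∃ K, IsTight T₀ K v ∧ IsTight T K v}.Finite ∧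
      {T | T ∈ N ∧ ∃ K, IsTight T₀ K v ∧ IsTight T K v}.ncard ≤ packingBound d v := by
  classical
  set S := {T | T ∈ N ∧ ∃ K, IsTight T₀ K v ∧ IsTight T K v} with hS
  set R : ℝ := 1 + d / v with hR
  have hR0 : 0 < R := by positivity
  -- An error of `1 / M` at the vertices grows by a factor of at most `1 + 2dR` at points with
  -- coordinates bounded by `R`; this choice makes the result `1/20`.
  set M : ℝ := 20 * (1 + 2 * d * R) with hM
  have hM0 : 0 < M := by positivity
  have hB : R * M ≤ roundBound d v := Nat.le_ceil _
  let pt : Option (Fin d) → E d := fun o => o.elim 0 fun j => EuclideanSpace.single j 1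
  have hpt : ∀ o, pt o ∈ unitCube d := by
    rintro (_ | j) i
    · simp [pt]
    · by_cases h : i = j <;> simp [pt, h]
  let Φ : (E d ≃ᵃ[ℝ] E d) → (Option (Fin d) × Fin d → ℤ) := fun T o =>
    ⌊T (T₀.symm (pt o.1)) o.2 * M⌋
  let t : Finset (Option (Fin d) × Fin d → ℤ) :=
    Fintype.piFinset fun _ => Finset.Icc (-(roundBound d v : ℤ)) (roundBound d v)
  have htcard : t.card = packingBound d v := by
    simp only [t, Fintype.card_piFinset, Finset.prod_const, Int.card_Icc, Finset.card_univ,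
      Fintype.card_prod, Fintype.card_option, Fintype.card_fin, packingBound]
    congr 1
    omega
  have hmaps : ∀ T ∈ S, Φ T ∈ (t : Set (Option (Fin d) × Fin d → ℤ)) := by
    rintro T ⟨-, K, h₀, h⟩
    simp only [t, Finset.mem_coe, Fintype.mem_piFinset, Finset.mem_Icc, Φ]
    intro o
    have h1 : |T (T₀.symm (pt o.1)) o.2 * M| ≤ roundBound d v := by
      rw [abs_mul, abs_of_pos hM0]
      exact (mul_le_mul_of_nonneg_right (h₀.abs_coord_le hv h (hpt _) _) hM0.le).trans hB
    have h2 := abs_le.1 h1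
    constructor
    · rw [Int.le_floor]; push_cast; exact h2.1
    · rw [← Int.cast_le (R := ℝ)]; push_cast; exact (Int.floor_le _).trans h2.2
  have hclose : ∀ T T', (∃ K, IsTight T₀ K v ∧ IsTight T K v) → Φ T = Φ T' →
      ∀ y ∈ unitCube d, ∀ i, |T' (T.symm y) i - y i| ≤ 1 / 20 := by
    rintro T T' ⟨K, h₀, h⟩ hΦ y hy i
    set x := T₀ (T.symm y) with hx
    have hxR : ∀ j, |x j| ≤ R := fun j => h.abs_coord_le hv h₀ hy j
    have hpts : ∀ o, |T' (T₀.symm (pt o)) i - T (T₀.symm (pt o)) i| ≤ 1 / M := by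
      intro o
      have h1 : ⌊T' (T₀.symm (pt o)) i * M⌋ = ⌊T (T₀.symm (pt o)) i * M⌋ :=
        (congrFun hΦ (o, i)).symm
      have h2 := Int.abs_sub_lt_one_of_floor_eq_floor h1
      rw [← sub_mul, abs_mul, abs_of_pos hM0] at h2
      rw [le_div_iff₀ hM0]
      exact h2.le
    have e1 := affine_coord (T₀.symm.trans T) x i
    have e2 := affine_coord (T₀.symm.trans T') x i
    simp only [AffineEquiv.trans_apply, hx, AffineEquiv.symm_apply_apply,
      AffineEquiv.apply_symm_apply] at e1 e2
    rw [← hx] at e1 e2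
    have e3 : T' (T.symm y) i - y i = (T' (T₀.symm (pt none)) i - T (T₀.symm (pt none)) i) +
        ∑ j, ((T' (T₀.symm (pt (some j))) i - T (T₀.symm (pt (some j))) i) -
          (T' (T₀.symm (pt none)) i - T (T₀.symm (pt none)) i)) * x j := by
      rw [e1, e2, add_sub_add_comm, ← Finset.sum_sub_distrib]
      congr 1
      refine Finset.sum_congr rfl fun j _ => ?_
      simp only [pt, Option.elim]
      ring
    rw [e3]
    refine (abs_add_le _ _).trans ?_
    have h4 : |∑ j, ((T' (T₀.symm (pt (some j))) i - T (T₀.symm (pt (some j))) i) -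
          (T' (T₀.symm (pt none)) i - T (T₀.symm (pt none)) i)) * x j| ≤ d * (2 / M * R) := by
      refine (Finset.abs_sum_le_sum_abs _ _).trans ?_
      have h5 : ∀ j ∈ Finset.univ, |((T' (T₀.symm (pt (some j))) i - T (T₀.symm (pt (some j))) i) -
          (T' (T₀.symm (pt none)) i - T (T₀.symm (pt none)) i)) * x j| ≤ 2 / M * R := by
        intro j _
        rw [abs_mul]
        refine mul_le_mul ?_ (hxR j) (abs_nonneg _) (by positivity)
        refine (abs_sub _ _).trans ?_
        have := add_le_add (hpts (some j)) (hpts none)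
        rw [← add_div] at this
        norm_num at this ⊢
        exact this
      refine (Finset.sum_le_sum h5).trans (le_of_eq ?_)
      simp
    refine (add_le_add (hpts none) h4).trans (le_of_eq ?_)
    have hne : 1 + 2 * (d : ℝ) * R ≠ 0 := by positivity
    rw [hM]
    field_simp
  have hinj : Set.InjOn Φ S := by
    intro T hT T' hT' hΦ
    exact hN.1 T hT.1 T' hT'.1 fun y hy i =>
      ⟨hclose T T' hT.2 hΦ y hy i, hclose T' T hT'.2 hΦ.symm y hy i⟩
  refine ⟨Set.Finite.of_injOn hmaps hinj t.finite_toSet, ?_⟩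
  rw [← htcard, ← Set.ncard_coe_finset]
  exact Set.ncard_le_ncard_of_injOn Φ hmaps hinj t.finite_toSet

/-! ### Quantitative Helly theorem for half-spaces through grid points -/

lemma affine_expand (A : E d ≃ᵃ[ℝ] E d) (z : E d) :
    A z = A 0 + ∑ j, z j • (A (EuclideanSpace.single j 1) - A 0) := by
  ext i
  rw [affine_coord A z i]
  simp [Finset.sum_apply, mul_comm]

/-- The side of the hyperplane through the points `q i` given by the sign `b`. -/
def halfSpaceThrough (q : Fin d → E d) (b : Bool) : Set (E d) :=
  {y | 0 ≤ (if b then 1 else -1 : ℝ) * (Matrix.of fun i => (q i - y).ofLp).det}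

/-- Expanding `y - p` in the basis `q i - p` exhibits the matrix as a rank-one perturbation of the
identity times the matrix at `p`; the matrix determinant lemma applies. -/
lemma det_sub_eq {q : Fin d → E d} {p u : E d} (hli : LinearIndependent ℝ fun i => q i - p)
    (hu : ∀ i, ⟪u, q i - p⟫ = 1) (y : E d) :
    (Matrix.of fun i => (q i - y).ofLp).det =
      (1 - ⟪u, y - p⟫) * (Matrix.of fun i => (q i - p).ofLp).det := by
  have hspan := hli.span_eq_top_of_card_eq_finrank' (by simp)
  obtain ⟨c, hc⟩ := (Submodule.mem_span_range_iff_exists_fun ℝ).1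
    (show y - p ∈ Submodule.span ℝ (Set.range fun i => q i - p) by rw [hspan]; trivial)
  have huy : ⟪u, y - p⟫ = ∑ i, c i := by
    rw [← hc, inner_sum]
    exact Finset.sum_congr rfl fun i _ => by rw [inner_smul_right, hu, mul_one]
  have hM : (Matrix.of fun i => (q i - y).ofLp) =
      (1 + Matrix.replicateCol Unit (fun _ : Fin d => (-1 : ℝ)) * Matrix.replicateRow Unit c) *
        Matrix.of fun i => (q i - p).ofLp := by
    ext i j
    have h1 : q i - y = (q i - p) - ∑ l, c l • (q l - p) := by rw [hc]; abel
    rw [add_mul, one_mul, Matrix.add_apply, Matrix.of_apply, h1]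
    simp [Matrix.mul_apply, Finset.sum_apply, sub_eq_add_neg]
    exact Finset.sum_congr rfl fun _ _ => by ring
  rw [hM, Matrix.det_mul, Matrix.det_one_add_replicateCol_mul_replicateRow, huy]
  simp [dotProduct, sub_eq_add_neg]

/-- The half-space is recovered from its boundary points and a sign alone, without `p`, so grid data
leave only finitely many possibilities. -/
lemma exists_halfSpaceThrough {q : Fin d → E d} {p u : E d}
    (hli : LinearIndependent ℝ fun i => q i - p) (hu : ∀ i, ⟪u, q i - p⟫ = 1) :
    ∃ b, halfSpaceThrough q b = {y | ⟪u, y - p⟫ ≤ 1} := by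
  set D := (Matrix.of fun i => (q i - p).ofLp).det with hD
  have hD0 : D ≠ 0 := by
    have h1 : LinearIndependent ℝ (Matrix.of fun i => (q i - p).ofLp).row :=
      hli.map' (WithLp.linearEquiv 2 ℝ (Fin d → ℝ)).toLinearMap (LinearEquiv.ker _)
    exact ((Matrix.isUnit_iff_isUnit_det _).1
      (Matrix.linearIndependent_rows_iff_isUnit.1 h1)).ne_zero
  rcases lt_or_gt_of_ne hD0 with h | h
  · refine ⟨false, Set.ext fun y => ?_⟩
    simp only [halfSpaceThrough, Set.mem_ofPred_eq]
    rw [det_sub_eq hli hu, ← hD]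
    simp only [Bool.false_eq_true, if_false]
    constructor <;> intro h1 <;> nlinarith
  · refine ⟨true, Set.ext fun y => ?_⟩
    simp only [halfSpaceThrough, Set.mem_ofPred_eq]
    rw [det_sub_eq hli hu, ← hD]
    simp only [if_true]
    constructor <;> intro h1 <;> nlinarith

/-- The grid point with the given integer coordinates. -/
noncomputable def gridPoint (υ : ℕ) (g : Fin d → Fin (2 ^ υ + 1)) : E d :=
  WithLp.toLp 2 fun i => ((g i : ℕ) : ℝ) / 2 ^ υ

lemma exists_gridPoint {υ : ℕ} {x : E d} (hx : x ∈ grid d υ) : ∃ g, gridPoint υ g = x := by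
  choose j hj hx using hx
  refine ⟨fun i => ⟨j i, by have := hj i; omega⟩, ?_⟩
  ext i
  simp [gridPoint, hx]

/-- Codes for intersections of `2d + 1` half-spaces bounded by hyperplanes through grid points. -/
abbrev Code (d υ : ℕ) : Type := Fin d ⊕ Fin (d + 1) → (Fin d → Fin d → Fin (2 ^ υ + 1)) × Bool

/-- The intersection of half-spaces described by a code. -/
def Code.region {υ : ℕ} (c : Code d υ) : Set (E d) :=
  ⋂ o, halfSpaceThrough (fun i => gridPoint υ ((c o).1 i)) (c o).2

lemma card_code (d υ : ℕ) : Fintype.card (Code d υ) =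
    ((2 ^ υ + 1) ^ (d * d) * 2) ^ (2 * d + 1) := by
  simp only [Fintype.card_fun, Fintype.card_prod, Fintype.card_fin, Fintype.card_bool,
    Fintype.card_sum, ← pow_mul]
  congr 1
  omega

/-- A direction orthogonal to all facet functionals could be followed forever inside the region,
which is bounded. -/
lemma span_facets (hd : 1 ≤ d) {P : Finset (E d)} {k : ℕ} (hk : 1 ≤ k) {p : E d}
    (hp : p ∈ interior (tukeyRegion P k)) : Submodule.span ℝ (facets P k p) = ⊤ := by
  by_contra hne
  obtain ⟨w, hw, hw0⟩ := Submodule.exists_mem_ne_zero_of_ne_bot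
    (mt Submodule.orthogonal_eq_bot_iff.1 hne)
  obtain ⟨R, hR⟩ := (isCompact_tukeyRegion hd P hk).isBounded.exists_norm_le
  have hn : 0 < ‖w‖ := norm_pos_iff.2 hw0
  have hmem : p + ((|R| + ‖p‖ + 1) / ‖w‖) • w ∈ tukeyRegion P k := by
    rw [mem_tukeyRegion_iff_facets hd hp]
    intro u hu
    rw [add_sub_cancel_left, inner_smul_right,
      (Submodule.mem_orthogonal _ _).1 hw u (Submodule.subset_span hu)]
    simp
  have h1 := hR _ hmem
  have h2 := norm_sub_le (p + ((|R| + ‖p‖ + 1) / ‖w‖) • w) p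
  rw [add_sub_cancel_left, norm_smul, Real.norm_of_nonneg (by positivity),
    div_mul_cancel₀ _ hn.ne'] at h2
  linarith [le_abs_self R]

/-- An interior point from which every bounding half-space is comparably far in both directions. -/
lemma exists_center {K : Set (E d)} (hK : IsCompact K) (hconv : Convex ℝ K)
    (hint : (interior K).Nonempty) :
    ∃ p ∈ interior K, ∀ u : E d, (∀ y ∈ K, ⟪u, y - p⟫ ≤ 1) →
      ∀ y ∈ K, -((d : ℝ) ^ 2 + 2 * d) ≤ ⟪u, y - p⟫ := by
  obtain ⟨F, hF, h0, h1⟩ := exists_affineEquiv_between hK hint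
  have hsub := simplex_subset_of_convex (convex_image F hconv) h0 h1
  -- The centroid of the corner simplex. An affine functional vanishing there has vertex values of
  -- sum zero; as each is at most `1`, each is at least `-d`.
  let c : E d := WithLp.toLp 2 fun _ => 1 / ((d : ℝ) + 1)
  have hd1 : (0 : ℝ) < (d : ℝ) + 1 := by positivity
  have hmem : ∀ {z}, z ∈ F '' K → F.symm z ∈ K := by
    rintro _ ⟨x, hx, rfl⟩
    rwa [F.symm_apply_apply]
  refine ⟨F.symm c, ?_, fun u hu => ?_⟩
  · have hopen : IsOpen {z : E d | (∀ i, 0 < z i) ∧ ∑ i, z i < 1} := by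
      have h : {z : E d | (∀ i, 0 < z i) ∧ ∑ i, z i < 1} =
          (⋂ i, {z : E d | 0 < z i}) ∩ {z : E d | ∑ i, z i < 1} := by
        ext; simp
      rw [h]
      exact (isOpen_iInter_of_finite fun i => isOpen_lt continuous_const (by fun_prop)).inter
        (isOpen_lt (by fun_prop) continuous_const)
    refine mem_interior.2 ⟨_, ?_, hopen.preimage (continuous_affineEquiv F), ?_⟩
    · intro x hx
      obtain ⟨y, hy, hyx⟩ := hsub (show F x ∈ _ from ⟨fun i => (hx.1 i).le, hx.2.le⟩)
      rwa [← F.injective hyx]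
    · rw [Set.mem_preimage, F.apply_symm_apply]
      refine ⟨fun i => by simp only [c]; positivity, ?_⟩
      simp only [c, Finset.sum_const, Finset.card_univ, Fintype.card_fin, nsmul_eq_mul]
      rw [mul_one_div, div_lt_one hd1]
      linarith
  · set p := F.symm c with hp
    set g₀ := ⟪u, F.symm 0 - p⟫ with hg₀
    set g : Fin d → ℝ := fun j => ⟪u, F.symm (EuclideanSpace.single j 1) - p⟫ with hg
    have hexp : ∀ z, ⟪u, F.symm z - p⟫ = g₀ + ∑ j, z j * (g j - g₀) := by
      intro z
      rw [affine_expand F.symm z, add_sub_right_comm, inner_add_right, inner_sum, hg₀]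
      congr 1
      refine Finset.sum_congr rfl fun j _ => ?_
      rw [inner_smul_right, hg]
      simp only [← inner_sub_right, sub_sub_sub_cancel_right]
    have hg₀1 : g₀ ≤ 1 := hu _ (hmem h0)
    have hg1 : ∀ j, g j ≤ 1 := fun j => hu _ (hmem (h1 j))
    have hsum : g₀ + ∑ j, g j = 0 := by
      have h2 := hexp c
      rw [← hp, sub_self, inner_zero_right] at h2
      simp only [c, ← Finset.mul_sum, Finset.sum_sub_distrib, Finset.sum_const, Finset.card_univ,
        Fintype.card_fin, nsmul_eq_mul] at h2
      field_simp at h2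
      linarith
    have hslack : ∀ j, 1 - g j ≤ d - ∑ j, g j := by
      intro j
      have h2 := Finset.single_le_sum (f := fun j => 1 - g j) (fun i _ => by linarith [hg1 i])
        (Finset.mem_univ j)
      simpa using h2
    have hg₀d : -(d : ℝ) ≤ g₀ := by
      have : ∑ j, g j ≤ ∑ _j : Fin d, (1 : ℝ) := Finset.sum_le_sum fun j _ => hg1 j
      simp at this
      linarith
    have hgd : ∀ j, -(d : ℝ) ≤ g j := fun j => by linarith [hslack j]
    intro y hy
    have hy2 := hexp (F y)
    rw [F.symm_apply_apply] at hy2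
    rw [hy2]
    -- Vertex values differ by at most `d + 1` and the coordinates lie in `[-1, 1]`; in total `-d -
    -- d(d + 1) = -(d² + 2d)`.
    have h3 : ∀ j ∈ Finset.univ, -((d : ℝ) + 1) ≤ F y j * (g j - g₀) := by
      intro j _
      have h4 : |F y j * (g j - g₀)| ≤ 1 * ((d : ℝ) + 1) := by
        rw [abs_mul]
        refine mul_le_mul (hF y hy j) ?_ (abs_nonneg _) zero_le_one
        rw [abs_le]
        constructor <;> linarith [hg1 j, hgd j]
      linarith [(abs_le.1 h4).1]
    have h5 := Finset.sum_le_sum h3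
    simp only [Finset.sum_const, Finset.card_univ, Fintype.card_fin, nsmul_eq_mul] at h5
    nlinarith

/-- The affine map whose coordinates are the values of `⟪b i, y - p⟫` for a basis `b`. -/
lemma exists_affineEquiv_inner (b : Module.Basis (Fin d) ℝ (E d)) (p : E d) :
    ∃ G : E d ≃ᵃ[ℝ] E d, ∀ y i, G y i = ⟪b i, y - p⟫ := by
  let A : E d →ₗ[ℝ] E d := (WithLp.linearEquiv 2 ℝ (Fin d → ℝ)).symm.toLinearMap ∘ₗ
    LinearMap.pi fun i => (innerₛₗ ℝ (b i))
  have hA : ∀ y i, A y i = ⟪b i, y⟫ := fun y i => rfl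
  have hinj : Function.Injective A := by
    rw [← LinearMap.ker_eq_bot, LinearMap.ker_eq_bot']
    intro y hy
    refine InnerProductSpace.ext_inner_left_basis b fun i => ?_
    rw [← hA, hy, inner_zero_right]
    rfl
  refine ⟨(AffineEquiv.constVAdd ℝ (E d) (-p)).trans
    (LinearEquiv.ofInjectiveEndo A hinj).toAffineEquiv, fun y i => ?_⟩
  rw [← hA]
  simp [sub_eq_neg_add]

/-- Quantitative Helly theorem for Tukey regions: `2d + 1` of the bounding half-spaces intersect
in a set of comparable volume. -/
theorem exists_code (hd : 1 ≤ d) {υ : ℕ} {P : Finset (E d)} (hP : (P : Set (E d)) ⊆ grid d υ)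
    {k : ℕ} (hk : 1 ≤ k) (hint : (interior (tukeyRegion P k)).Nonempty) :
    ∃ c : Code d υ, tukeyRegion P k ⊆ c.region ∧ Convex ℝ c.region ∧ IsCompact c.region ∧
      volume c.region ≤ ENNReal.ofReal ((5 * (d : ℝ) ^ 4) ^ d) * volume (tukeyRegion P k) := by
  classical
  have hd1 : (1 : ℝ) ≤ d := by exact_mod_cast hd
  have hd0 : (0 : ℝ) < d := by linarith
  obtain ⟨p, hp, hcenter⟩ := exists_center (isCompact_tukeyRegion hd P hk)
    (convex_tukeyRegion hd P k) hint
  set U := facets P k p with hU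
  obtain ⟨b, hbU, hb⟩ := exists_basis_abs_repr_le_one (finite_facets P k p).isCompact
    (span_facets hd hk hp)
  -- On the region the functional `∑ i, b i` is at least `-m`. So `z₀` is at most `1` there, and by
  -- polarity it lies in the hull of `0` and the facet functionals.
  set m : ℝ := d * ((d : ℝ) ^ 2 + 2 * d) with hm
  have hm0 : 0 < m := by positivity
  set z₀ : E d := (-(1 / m)) • ∑ i, b i with hz₀
  have hz₀mem : z₀ ∈ convexHull ℝ (insert 0 U) := by
    by_contra hnot
    have hcl : IsClosed (convexHull ℝ (insert 0 U)) :=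
      (((finite_facets P k p).insert 0).isCompact_convexHull (𝕜 := ℝ)).isClosed
    obtain ⟨f, c, hfz, hf⟩ := geometric_hahn_banach_point_closed (convex_convexHull ℝ _) hcl hnot
    set w := (InnerProductSpace.toDual ℝ (E d)).symm f with hw
    have hfw : ∀ y, f y = ⟪y, w⟫ := by
      intro y
      rw [real_inner_comm, hw, InnerProductSpace.toDual_symm_apply]
    have hc : c < 0 := by
      have := hf 0 (subset_convexHull ℝ _ (Set.mem_insert _ _))
      rwa [map_zero] at this
    have hmem : p + c⁻¹ • w ∈ tukeyRegion P k := by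
      rw [mem_tukeyRegion_iff_facets hd hp]
      intro u hu
      have h1 := hf u (subset_convexHull ℝ _ (Set.mem_insert_of_mem _ hu))
      rw [hfw] at h1
      rw [add_sub_cancel_left, inner_smul_right, ← inv_mul_cancel₀ hc.ne]
      exact mul_le_mul_of_nonpos_left h1.le (inv_nonpos.2 hc.le)
    have h2 : ∀ i ∈ Finset.univ, -((d : ℝ) ^ 2 + 2 * d) ≤ ⟪b i, c⁻¹ • w⟫ := by
      intro i _
      have := hcenter (b i) (hbU i).2 _ hmem
      rwa [add_sub_cancel_left] at this
    have h3 := Finset.sum_le_sum h2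
    simp only [Finset.sum_const, Finset.card_univ, Fintype.card_fin, nsmul_eq_mul] at h3
    rw [← sum_inner, inner_smul_right] at h3
    rw [hfw, hz₀, inner_smul_left] at hfz
    simp only [conj_trivial] at hfz
    set s := ⟪∑ i, b i, w⟫ with hs
    have h4 : -m ≤ c⁻¹ * s := by rw [hm]; linarith
    have h5 : s ≤ -m * c := by
      have := mul_le_mul_of_nonpos_right h4 hc.le
      rwa [mul_comm c⁻¹, mul_assoc, inv_mul_cancel₀ hc.ne, mul_one] at this
    have h6 : -(1 / m) * s * m = -s := by field_simp
    have h7 := mul_lt_mul_of_pos_right hfz hm0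
    rw [h6] at h7
    linarith
  -- Carathéodory: at most `d + 1` functionals suffice. With the `d` members of the basis they make
  -- `2d + 1` half-spaces.
  obtain ⟨ι, hι, z, w, hzU, hzind, hw0, hw1, hwz⟩ := eq_pos_convex_span_of_mem_convexHull hz₀mem
  have hcard : Fintype.card ι ≤ d + 1 := by
    have := hzind.card_le_finrank_succ
    refine this.trans (Nat.succ_le_succ ?_)
    exact (Submodule.finrank_le _).trans (by simp)
  have : Nonempty ι := by
    by_contra h
    rw [not_nonempty_iff] at h
    simp at hw1
  obtain ⟨e⟩ : Nonempty (ι ↪ Fin (d + 1)) :=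
    Function.Embedding.nonempty_of_card_le (by simpa using hcard)
  have hzU' : ∀ i, ∃ u ∈ U, z i = u ∨ z i = 0 := by
    intro i
    rcases hzU ⟨i, rfl⟩ with h | h
    · exact ⟨b ⟨0, hd⟩, hbU _, Or.inr h⟩
    · exact ⟨z i, h, Or.inl rfl⟩
  choose u' hu'U hu' using hzU'
  let h : Fin d ⊕ Fin (d + 1) → E d := Sum.elim (fun i => b i) fun j => u' (Function.invFun e j)
  have hhU : ∀ o, h o ∈ U := by
    rintro (i | j)
    · exact hbU i
    · exact hu'U _
  have hcode : ∀ u ∈ U, ∃ c : (Fin d → Fin d → Fin (2 ^ υ + 1)) × Bool,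
      halfSpaceThrough (fun i => gridPoint υ (c.1 i)) c.2 = {y | ⟪u, y - p⟫ ≤ 1} := by
    rintro u ⟨⟨q, hq, hli, hqu⟩, -⟩
    obtain ⟨s, hs⟩ := exists_halfSpaceThrough hli hqu
    choose g hg using fun i => exists_gridPoint (hP (hq i))
    exact ⟨(g, s), by simpa only [hg] using hs⟩
  choose c hc using fun o => hcode (h o) (hhU o)
  have hregion : Code.region c = ⋂ o, {y | ⟪h o, y - p⟫ ≤ 1} := by
    simp only [Code.region, hc]
  obtain ⟨G, hG⟩ := exists_affineEquiv_inner b p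
  -- The basis functionals bound each coordinate above by `1`, the Carathéodory functionals bound
  -- the sum below by `-m`; hence each coordinate is at least `-m - (d - 1)`.
  have hbox : ∀ y ∈ Code.region c, G y ∈ {x : E d | ∀ i, -(m + d) ≤ x i ∧ x i ≤ 1} := by
    intro y hy i
    rw [hregion, Set.mem_iInter] at hy
    have h1 : ∀ i, G y i ≤ 1 := fun i => by rw [hG]; exact hy (Sum.inl i)
    refine ⟨?_, h1 i⟩
    have h2 : ⟪z₀, y - p⟫ ≤ 1 := by
      rw [← hwz, sum_inner]
      refine (Finset.sum_le_sum (g := w) fun i _ => ?_).trans hw1.le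
      rw [inner_smul_left]
      simp only [conj_trivial]
      refine (mul_le_mul_of_nonneg_left (?_ : _ ≤ (1 : ℝ)) (hw0 i).le).trans (mul_one _).le
      rcases hu' i with h3 | h3
      · have h4 := hy (Sum.inr (e i))
        simp only [h, Sum.elim_inr, Function.leftInverse_invFun e.injective i] at h4
        rw [h3]
        exact h4
      · rw [h3, inner_zero_left]; exact zero_le_one
    rw [hz₀, inner_smul_left, sum_inner] at h2
    simp only [conj_trivial, ← hG] at h2
    have h3 : -m ≤ ∑ i, G y i := by
      have h4 := mul_le_mul_of_nonneg_right h2 hm0.le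
      have h5 : -(1 / m) * (∑ i, G y i) * m = -∑ i, G y i := by field_simp
      rw [h5] at h4
      linarith
    have h4 := Finset.single_le_sum (f := fun j => 1 - G y j) (fun i _ => by linarith [h1 i])
      (Finset.mem_univ i)
    simp only [Finset.sum_sub_distrib, Finset.sum_const, Finset.card_univ, Fintype.card_fin,
      nsmul_eq_mul, mul_one] at h4
    linarith
  have hclosed : IsClosed (Code.region c) := by
    rw [hregion]
    exact isClosed_iInter fun o => isClosed_le (by fun_prop) continuous_const
  refine ⟨c, ?_, ?_, ?_, ?_⟩
  · rw [hregion]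
    exact Set.subset_iInter fun o y hy => (hhU o).2 y hy
  · rw [hregion]
    refine convex_iInter fun o => ?_
    have h1 := convex_halfSpace_le (𝕜 := ℝ) (f := fun y : E d => ⟪h o, y⟫)
      ⟨fun a b => inner_add_right _ a b, fun c a => by simp [inner_smul_right]⟩ (1 + ⟪h o, p⟫)
    have h2 : {y : E d | ⟪h o, y - p⟫ ≤ 1} = {y : E d | ⟪h o, y⟫ ≤ 1 + ⟪h o, p⟫} := by
      ext y
      simp only [Set.mem_ofPred_eq, inner_sub_right, sub_le_iff_le_add]
    rw [h2]
    exact h1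
  · refine ((isCompact_cube (-(m + d)) 1).image
      (continuous_affineEquiv G.symm)).of_isClosed_subset hclosed fun y hy => ?_
    exact ⟨G y, hbox y hy, by simp⟩
  · have hupper : ENNReal.ofReal (jac G) * volume (Code.region c) ≤
        ENNReal.ofReal ((m + d + 1) ^ d) := by
      rw [← volume_image, ENNReal.ofReal_pow (by positivity)]
      have himg : G '' Code.region c ⊆ {x : E d | ∀ i, -(m + d) ≤ x i ∧ x i ≤ 1} := by
        rintro _ ⟨y, hy, rfl⟩
        exact hbox y hy
      refine (measure_mono himg).trans (le_of_eq ?_)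
      rw [volume_cube]
      congr 2
      ring
    -- Facet functionals have coefficients of size at most `1` in the basis `b`, so they are at most
    -- `1` on `[0, 1/d]ᵈ`, which therefore lies in the image of the region.
    have hlower : ENNReal.ofReal ((1 / d : ℝ) ^ d) ≤
        ENNReal.ofReal (jac G) * volume (tukeyRegion P k) := by
      rw [← volume_image, ENNReal.ofReal_pow (by positivity)]
      have h1 := volume_cube (d := d) 0 (1 / d)
      rw [sub_zero] at h1
      rw [← h1]
      refine measure_mono fun x hx => ⟨G.symm x, ?_, by simp⟩
      rw [mem_tukeyRegion_iff_facets hd hp]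
      intro u hu
      have h2 : ⟪u, G.symm x - p⟫ = ∑ i, b.repr u i * x i := by
        conv_lhs => rw [← b.sum_repr u]
        rw [sum_inner]
        refine Finset.sum_congr rfl fun i _ => ?_
        rw [inner_smul_left, ← hG, G.apply_symm_apply]
        rfl
      have h3 : ∀ i ∈ Finset.univ, b.repr u i * x i ≤ 1 / d := by
        intro i _
        have h4 := (abs_le.1 (hb u hu i)).2
        have h5 := hx i
        nlinarith
      rw [h2]
      refine (Finset.sum_le_sum h3).trans (le_of_eq ?_)
      simp [hd0.ne']
    have hL : (m + d + 1) ^ d ≤ (5 * (d : ℝ) ^ 4) ^ d * (1 / d : ℝ) ^ d := by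
      rw [← mul_pow]
      refine pow_le_pow_left₀ (by positivity) ?_ d
      have h1 : 5 * (d : ℝ) ^ 4 * (1 / d) = 5 * (d : ℝ) ^ 3 := by field_simp
      rw [h1, hm]
      nlinarith [mul_nonneg (sub_nonneg.2 hd1) (sub_nonneg.2 hd1), pow_pos hd0 2, pow_pos hd0 3,
        mul_nonneg (pow_pos hd0 2).le (sub_nonneg.2 hd1)]
    have hfinal : ENNReal.ofReal (jac G) * volume (Code.region c) ≤ ENNReal.ofReal (jac G) *
        (ENNReal.ofReal ((5 * (d : ℝ) ^ 4) ^ d) * volume (tukeyRegion P k)) := by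
      refine hupper.trans ((ENNReal.ofReal_le_ofReal hL).trans ?_)
      rw [ENNReal.ofReal_mul (by positivity), mul_left_comm]
      exact mul_le_mul_right hlower _
    exact (ENNReal.mul_le_mul_iff_right (ENNReal.ofReal_pos.2 (jac_pos G)).ne'
      ENNReal.ofReal_ne_top).1 hfinal

/-- The volume up to which positions of Tukey regions of grid points are compared. -/
noncomputable def gridTightness (d : ℕ) : ℝ := (9 / 20) ^ d / d.factorial / (5 * (d : ℝ) ^ 4) ^ d

/-- Only few members of a net are tight for Tukey regions of grid points. -/
theorem IsNet.finite_isTight_grid (hd : 1 ≤ d) {N : Set (E d ≃ᵃ[ℝ] E d)} (hN : IsNet N) (υ : ℕ) :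
    ∃ s : Finset (E d ≃ᵃ[ℝ] E d),
      s.card ≤ ((2 ^ υ + 1) ^ (d * d) * 2) ^ (2 * d + 1) * packingBound d (gridTightness d) ∧
      ∀ T ∈ N, ∀ P : Finset (E d), (P : Set (E d)) ⊆ grid d υ → ∀ k, 1 ≤ k →
        IsTight T (tukeyRegion P k) (gridTightness d) → T ∈ s := by
  classical
  have hd0 : (0 : ℝ) < d := by exact_mod_cast hd
  have hv : 0 < gridTightness d := by unfold gridTightness; positivity
  -- The reference position depends on the code only; the identity is a default where none is tight.
  have hT : ∀ c : Code d υ, ∃ T₀ : E d ≃ᵃ[ℝ] E d, (∃ T : E d ≃ᵃ[ℝ] E d,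
      IsTight T c.region ((9 / 20) ^ d / d.factorial)) →
      IsTight T₀ c.region ((9 / 20) ^ d / d.factorial) := by
    intro c
    by_cases h : ∃ T : E d ≃ᵃ[ℝ] E d, IsTight T c.region ((9 / 20) ^ d / d.factorial)
    · exact ⟨h.choose, fun _ => h.choose_spec⟩
    · exact ⟨AffineEquiv.refl ℝ _, fun h' => absurd h' h⟩
  choose T₀ hT₀ using hT
  refine ⟨Finset.univ.biUnion fun c => (hN.packing hv (T₀ c)).1.toFinset, ?_, ?_⟩
  · rw [← card_code, ← Finset.card_univ]
    refine Finset.card_biUnion_le_card_mul _ _ _ fun c _ => ?_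
    rw [← Set.ncard_eq_toFinset_card _ (hN.packing hv (T₀ c)).1]
    exact (hN.packing hv (T₀ c)).2
  · intro T hTN P hP k hk htight
    have hint := interior_nonempty_of_volume_pos (convex_tukeyRegion hd P k) (htight.volume_pos hv)
    obtain ⟨c, hsub, hconv, hcomp, hvol⟩ := exists_code hd hP hk hint
    simp only [Finset.mem_biUnion, Finset.mem_univ, true_and, Set.Finite.mem_toFinset]
    refine ⟨c, hTN, _, ?_, htight⟩
    have hTc : IsTight (T₀ c) c.region ((9 / 20) ^ d / d.factorial) := by
      refine hT₀ c ?_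
      obtain ⟨T, hT, hTv⟩ := exists_position hd hcomp hconv (hint.mono (interior_mono hsub))
      refine ⟨T, ?_, hTv⟩
      rintro _ ⟨x, hx, rfl⟩ i
      constructor <;> linarith [(hT x hx i).1, (hT x hx i).2]
    refine ⟨(Set.image_mono hsub).trans hTc.1, ?_⟩
    have hL : (0 : ℝ) < (5 * (d : ℝ) ^ 4) ^ d := by positivity
    rw [gridTightness, ENNReal.ofReal_div_of_pos hL]
    refine ENNReal.div_le_of_le_mul' (hTc.2.trans ?_)
    rw [volume_image, volume_image, mul_left_comm]
    exact mul_le_mul_right hvol _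

end TukeyFat

namespace TukeyFat

variable {d : ℕ} {α : Type*}

/-! ### Scores of sensitivity one -/

lemma Neighboring.symm {P P' : Finset (E d)} (h : Neighboring P P') : Neighboring P' P := by
  unfold Neighboring at *
  rwa [symmDiff_comm]

/-- The outcome `a` is ideal for a dataset that differs from `P` in at most `k` points. -/
def NearIdeal (Ideal : α → Finset (E d) → Prop) (P : Finset (E d)) (a : α) (k : ℕ) : Prop :=
  ∃ Q, Ideal a Q ∧ (symmDiff (P : Set (E d)) (Q : Set (E d))).ncard ≤ k

section Score

variable {Ideal : α → Finset (E d) → Prop} {P P' : Finset (E d)} {a : α} {k l r : ℕ}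

lemma NearIdeal.mono (h : NearIdeal Ideal P a k) (hkl : k ≤ l) : NearIdeal Ideal P a l := by
  obtain ⟨Q, hQ, hle⟩ := h
  exact ⟨Q, hQ, hle.trans hkl⟩

lemma NearIdeal.of_neighboring (hPP' : Neighboring P P') (h : NearIdeal Ideal P a k) :
    NearIdeal Ideal P' a (k + 1) := by
  obtain ⟨Q, hQ, hle⟩ := h
  refine ⟨Q, hQ, ?_⟩
  have h1 := hPP'.symm
  unfold Neighboring at h1
  have hfin : ∀ A B : Finset (E d), (symmDiff (A : Set (E d)) (B : Set (E d))).Finite :=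
    fun A B => A.finite_toSet.symmDiff B.finite_toSet
  have h2 := Set.ncard_le_ncard (symmDiff_triangle (P' : Set (E d)) P Q)
    ((hfin P' P).union (hfin P Q))
  have h3 := Set.ncard_union_le (symmDiff (P' : Set (E d)) (P : Set (E d)))
    (symmDiff (P : Set (E d)) (Q : Set (E d)))
  change _ ≤ (symmDiff (P' : Set (E d)) (P : Set (E d)) ∪ symmDiff (P : Set (E d)) Q).ncard at h2
  omega

open Classical in
/-- The number of distances up to `r` within which `a` is ideal: a score of
sensitivity `1`. -/
noncomputable def score (Ideal : α → Finset (E d) → Prop) (r : ℕ) (P : Finset (E d)) (a : α) : ℕ :=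
  ((Finset.range (r + 1)).filter fun k => NearIdeal Ideal P a k).card

/-- Being near ideal is monotone in the distance, and passing to a neighbour costs one unit of
distance. So `k ↦ k + 1` injects the admissible distances below `r` into those of the neighbour, and
only `k = r` may be lost. -/
lemma score_le_succ (hPP' : Neighboring P P') : score Ideal r P a ≤ score Ideal r P' a + 1 := by
  classical
  unfold score
  have h1 : (Finset.range (r + 1)).filter (fun k => NearIdeal Ideal P a k) ⊆
      insert r ((Finset.range r).filter fun k => NearIdeal Ideal P a k) := by
    intro k hk
    simp only [Finset.mem_filter, Finset.mem_range, Finset.mem_insert] at hk ⊢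
    by_cases h : k = r
    · exact Or.inl h
    · exact Or.inr ⟨by omega, hk.2⟩
  have h2 : ((Finset.range r).filter fun k => NearIdeal Ideal P a k).image Nat.succ ⊆
      (Finset.range (r + 1)).filter fun k => NearIdeal Ideal P' a k := by
    intro k hk
    simp only [Finset.mem_image, Finset.mem_filter, Finset.mem_range] at hk ⊢
    obtain ⟨j, ⟨hj, hnear⟩, rfl⟩ := hk
    exact ⟨by omega, hnear.of_neighboring hPP'⟩
  have h3 := Finset.card_le_card h1
  have h4 := Finset.card_le_card h2
  rw [Finset.card_image_of_injective _ Nat.succ_injective] at h4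
  have h5 := Finset.card_insert_le r ((Finset.range r).filter fun k => NearIdeal Ideal P a k)
  omega

lemma score_le (r : ℕ) (P : Finset (E d)) (a : α) : score Ideal r P a ≤ r + 1 := by
  classical
  exact (Finset.card_filter_le _ _).trans (by simp)

lemma score_of_ideal (h : Ideal a P) : score Ideal r P a = r + 1 := by
  classical
  unfold score
  rw [Finset.filter_true_of_mem, Finset.card_range]
  intro k _
  exact ⟨P, h, by simp⟩

lemma nearIdeal_of_score_ne_zero (h : score Ideal r P a ≠ 0) : NearIdeal Ideal P a r := by
  classical
  obtain ⟨k, hk⟩ := Finset.card_ne_zero.1 h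
  simp only [Finset.mem_filter, Finset.mem_range] at hk
  exact hk.2.mono (by omega)

end Score

/-! ### Private selection mechanisms -/

lemma IsDP.mono {ε δ δ' : ℝ} {A : Finset (E d) → PMF α} (h : IsDP ε δ A) (hδ : δ ≤ δ') :
    IsDP ε δ' A := fun P P' hPP' S =>
  (h P P' hPP' S).trans (add_le_add_right (ENNReal.ofReal_le_ofReal hδ) _)

lemma IsDP.map {γ : Type*} {ε δ : ℝ} {A : Finset (E d) → PMF α} (h : IsDP ε δ A) (g : α → γ) :
    IsDP ε δ fun P => (A P).map g := by
  intro P P' hPP' S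
  simp only [PMF.toOuterMeasure_map_apply]
  exact h P P' hPP' _

lemma toOuterMeasure_le_one (p : PMF α) (S : Set α) : p.toOuterMeasure S ≤ 1 := by
  rw [PMF.toOuterMeasure_apply, ← p.tsum_coe]
  exact ENNReal.tsum_le_tsum fun a => Set.indicator_le_self S p a

lemma isDP_of_one_le {ε δ : ℝ} (hδ : 1 ≤ δ) (A : Finset (E d) → PMF α) : IsDP ε δ A := by
  intro P P' _ S
  refine (toOuterMeasure_le_one _ _).trans (le_trans ?_ le_add_self)
  simpa using hδ

lemma isDP_const {ε δ : ℝ} (hε : 0 ≤ ε) (p : PMF α) : IsDP ε δ fun _ : Finset (E d) => p := by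
  intro P P' _ S
  refine le_trans ?_ le_self_add
  refine le_mul_of_one_le_left zero_le ?_
  simpa using hε

section Normalize

variable {f : Finset (E d) → α → ℝ≥0∞} (h0 : ∀ P, ∑' a, f P a ≠ 0) (htop : ∀ P, ∑' a, f P a ≠ ⊤)

lemma toOuterMeasure_normalize {g : α → ℝ≥0∞} (hg0 : ∑' a, g a ≠ 0) (hgtop : ∑' a, g a ≠ ⊤)
    (S : Set α) : (PMF.normalize g hg0 hgtop).toOuterMeasure S =
      (∑' a, S.indicator g a) * (∑' a, g a)⁻¹ := by
  rw [PMF.toOuterMeasure_apply, ← ENNReal.tsum_mul_right]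
  refine tsum_congr fun a => ?_
  by_cases ha : a ∈ S <;> simp [ha, PMF.normalize_apply]

/-- Selection with probabilities proportional to weights that vary little between neighbours. -/
lemma isDP_normalize {ε δ : ℝ}
    (hZ : ∀ P P', Neighboring P P' →
      ∑' a, f P a ≤ ENNReal.ofReal (Real.exp (ε / 2)) * ∑' a, f P' a)
    (hS : ∀ P P', Neighboring P P' → ∀ S : Set α, ∑' a, S.indicator (f P) a ≤
      ENNReal.ofReal (Real.exp (ε / 2)) * ∑' a, S.indicator (f P') a +
        ENNReal.ofReal δ * ∑' a, f P a) :
    IsDP ε δ fun P => PMF.normalize (f P) (h0 P) (htop P) := by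
  intro P P' hPP' S
  simp only [toOuterMeasure_normalize]
  have he0 : ENNReal.ofReal (Real.exp (ε / 2)) ≠ 0 := (ENNReal.ofReal_pos.2 (Real.exp_pos _)).ne'
  -- The normalizing constant uses up the other half of `ε`.
  have hinv : (∑' a, f P a)⁻¹ ≤
      ENNReal.ofReal (Real.exp (ε / 2)) * (∑' a, f P' a)⁻¹ := by
    have h1 := ENNReal.inv_le_inv.2 (hZ P' P hPP'.symm)
    rw [ENNReal.mul_inv (Or.inl he0) (Or.inl ENNReal.ofReal_ne_top)] at h1
    calc (∑' a, f P a)⁻¹ = ENNReal.ofReal (Real.exp (ε / 2)) *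
          ((ENNReal.ofReal (Real.exp (ε / 2)))⁻¹ * (∑' a, f P a)⁻¹) := by
            rw [← mul_assoc, ENNReal.mul_inv_cancel he0 ENNReal.ofReal_ne_top, one_mul]
      _ ≤ _ := mul_le_mul_right h1 _
  refine (mul_le_mul_left (hS P P' hPP' S) _).trans ?_
  rw [add_mul, mul_assoc (ENNReal.ofReal δ), ENNReal.mul_inv_cancel (h0 P) (htop P), mul_one]
  refine add_le_add_left ?_ _
  refine (mul_le_mul_right hinv _).trans (le_of_eq ?_)
  have hee : ENNReal.ofReal (Real.exp ε) =
      ENNReal.ofReal (Real.exp (ε / 2)) * ENNReal.ofReal (Real.exp (ε / 2)) := by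
    rw [← ENNReal.ofReal_mul (Real.exp_pos _).le, ← Real.exp_add, add_halves]
  rw [hee]
  ring

lemma le_toOuterMeasure_normalize {g : α → ℝ≥0∞} (hg0 : ∑' a, g a ≠ 0) (hgtop : ∑' a, g a ≠ ⊤)
    {S : Set α} {β : ℝ} (hβ : 0 ≤ β)
    (hbad : ∑' a, Sᶜ.indicator g a ≤ ENNReal.ofReal β * ∑' a, g a) :
    ENNReal.ofReal (1 - β) ≤ (PMF.normalize g hg0 hgtop).toOuterMeasure S := by
  rw [toOuterMeasure_normalize, ← div_eq_mul_inv,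
    ENNReal.le_div_iff_mul_le (Or.inl hg0) (Or.inl hgtop), ENNReal.ofReal_sub _ hβ,
    ENNReal.ofReal_one, ENNReal.sub_mul (fun _ _ => hgtop), one_mul, tsub_le_iff_right]
  have h1 : ∑' a, g a = ∑' a, S.indicator g a + ∑' a, Sᶜ.indicator g a := by
    rw [← ENNReal.tsum_add]
    refine tsum_congr fun a => ?_
    by_cases ha : a ∈ S <;> simp [ha]
  conv_lhs => rw [h1]
  exact add_le_add_right hbad _

end Normalize

/-- The exponential mechanism on a finite set of outcomes. -/
theorem exists_pure_mechanism [Nonempty α] (Ideal : α → Finset (E d) → Prop) (s : Finset α)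
    {ε β : ℝ} (hε : 0 < ε) (hβ : 0 < β) {r : ℕ} (hr : s.card ≤ β * Real.exp (ε / 2 * r)) :
    ∃ A : Finset (E d) → PMF α, IsDP ε 0 A ∧ ∀ P, (∃ a ∈ s, Ideal a P) →
      ENNReal.ofReal (1 - β) ≤ (A P).toOuterMeasure {a | NearIdeal Ideal P a r} := by
  classical
  rcases s.eq_empty_or_nonempty with rfl | ⟨a₀, ha₀⟩
  · exact ⟨fun _ => PMF.pure (Classical.arbitrary α), isDP_const hε.le _, by simp⟩
  let f : Finset (E d) → α → ℝ≥0∞ := fun P a =>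
    if a ∈ s then ENNReal.ofReal (Real.exp (ε / 2 * score Ideal r P a)) else 0
  have hf : ∀ P, ∀ a ∉ s, f P a = 0 := fun P a ha => by simp [f, ha]
  have hterm : ∀ P, ∀ a ∈ s, f P a ≤ ∑' a, f P a := fun P a _ => ENNReal.le_tsum a
  have h0 : ∀ P, ∑' a, f P a ≠ 0 := by
    intro P h
    have h1 := hterm P a₀ ha₀
    rw [h] at h1
    simp only [f, ha₀, if_true, nonpos_iff_eq_zero, ENNReal.ofReal_eq_zero] at h1
    exact absurd (Real.exp_pos _) (not_lt.2 h1)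
  have htop : ∀ P, ∑' a, f P a ≠ ⊤ := by
    intro P
    rw [tsum_eq_sum (s := s) (fun a ha => hf P a ha)]
    refine ENNReal.sum_ne_top.2 fun a ha => ?_
    simp [f, ha]
  have hpt : ∀ P P', Neighboring P P' → ∀ a,
      f P a ≤ ENNReal.ofReal (Real.exp (ε / 2)) * f P' a := by
    intro P P' hPP' a
    by_cases ha : a ∈ s
    · simp only [f, ha, if_true]
      rw [← ENNReal.ofReal_mul (Real.exp_pos _).le, ← Real.exp_add]
      refine ENNReal.ofReal_le_ofReal (Real.exp_le_exp.2 ?_)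
      have h1 : (score Ideal r P a : ℝ) ≤ score Ideal r P' a + 1 := by
        exact_mod_cast score_le_succ (Ideal := Ideal) (r := r) (a := a) hPP'
      nlinarith
    · simp [hf P a ha]
  have hS : ∀ P P', Neighboring P P' → ∀ S : Set α, ∑' a, S.indicator (f P) a ≤
      ENNReal.ofReal (Real.exp (ε / 2)) * ∑' a, S.indicator (f P') a := by
    intro P P' hPP' S
    rw [← ENNReal.tsum_mul_left]
    refine ENNReal.tsum_le_tsum fun a => ?_
    by_cases ha : a ∈ S
    · simpa [ha] using hpt P P' hPP' a
    · simp [ha]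
  refine ⟨fun P => PMF.normalize (f P) (h0 P) (htop P), isDP_normalize h0 htop
    (fun P P' h => by simpa using hS P P' h Set.univ)
    (fun P P' h S => (hS P P' h S).trans le_self_add), ?_⟩
  rintro P ⟨a, ha, hideal⟩
  refine le_toOuterMeasure_normalize _ _ hβ.le ?_
  -- Outcomes that are not near ideal have score `0` and weight at most `1`, against weight `exp (ε
  -- / 2 * (r + 1))` of an ideal one.
  have hbad : ∑' a, {a | NearIdeal Ideal P a r}ᶜ.indicator (f P) a ≤ s.card := by
    rw [tsum_eq_sum (s := s) (fun a ha => by simp [Set.indicator, hf P a ha])]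
    calc _ ≤ ∑ _a ∈ s, (1 : ℝ≥0∞) := by
          refine Finset.sum_le_sum fun a ha => ?_
          by_cases hn : NearIdeal Ideal P a r
          · simp [hn]
          · have : score Ideal r P a = 0 := by
              by_contra h; exact hn (nearIdeal_of_score_ne_zero h)
            simp [hn, f, ha, this]
      _ = s.card := by simp
  refine hbad.trans ?_
  refine le_trans ?_ (mul_le_mul_right (hterm P a ha) _)
  simp only [f, ha, if_true, score_of_ideal hideal]
  rw [← ENNReal.ofReal_mul hβ.le, ← ENNReal.ofReal_natCast]
  refine ENNReal.ofReal_le_ofReal (hr.trans ?_)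
  push_cast
  gcongr
  linarith

/-- The choosing mechanism: selection from a possibly infinite set of outcomes of which, for every
dataset, only few have positive score. -/
theorem exists_approx_mechanism [Nonempty α] (Ideal : α → Finset (E d) → Prop) (N : Set α)
    {ε δ β : ℝ} (hε : 0 < ε) (hδ : 0 < δ) (hδ1 : δ ≤ 1) (hβ : 0 < β) {r G : ℕ} (hG1 : 1 ≤ G)
    (hG : ∀ P, {a | a ∈ N ∧ NearIdeal Ideal P a r}.encard ≤ G)
    (hr : G ≤ δ * β * Real.exp (ε / 2 * r)) :
    ∃ A : Finset (E d) → PMF α, IsDP ε δ A ∧ ∀ P, (∃ a ∈ N, Ideal a P) →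
      ENNReal.ofReal (1 - β) ≤ (A P).toOuterMeasure {a | NearIdeal Ideal P a r} := by
  classical
  obtain ⟨a₀⟩ := ‹Nonempty α›
  set e := Real.exp (ε / 2) with he
  have he1 : 1 ≤ e := Real.one_le_exp (by positivity)
  have hG1' : (1 : ℝ) ≤ G := by exact_mod_cast hG1
  -- The weight of a fallback outcome, so large that the additive error `G * (e - 1)` is at most `δ
  -- * W`, hence at most `δ` after normalization.
  set W : ℝ := e * G / δ with hW
  have hGW : (G : ℝ) ≤ W := by
    rw [hW, le_div_iff₀ hδ]
    nlinarith
  have hW0 : 0 < W := by linarith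
  -- Subtracting `1` removes all outcomes of score `0`, so the total is finite even if `N` is
  -- infinite. The price is an additive `e - 1` for each outcome of positive score.
  let g : Finset (E d) → α → ℝ≥0∞ := fun P a =>
    if a ∈ N then ENNReal.ofReal (Real.exp (ε / 2 * score Ideal r P a) - 1) else 0
  let b : α → ℝ≥0∞ := fun a => if a = a₀ then ENNReal.ofReal W else 0
  let f : Finset (E d) → α → ℝ≥0∞ := fun P a => b a + g P a
  have hb : ∑' a, b a = ENNReal.ofReal W := tsum_ite_eq _ _
  have hf : ∀ P, ∑' a, f P a = ENNReal.ofReal W + ∑' a, g P a := fun P => by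
    rw [← hb]; exact ENNReal.tsum_add
  have hg0 : ∀ P a, ¬ (a ∈ N ∧ NearIdeal Ideal P a r) → g P a = 0 := by
    intro P a h
    by_cases ha : a ∈ N
    · have : score Ideal r P a = 0 := by
        by_contra hs; exact h ⟨ha, nearIdeal_of_score_ne_zero hs⟩
      simp [g, this]
    · simp [g, ha]
  -- sums of constants over the outcomes of positive score
  have hconst : ∀ P (c : ℝ≥0∞),
      ∑' a, {a | a ∈ N ∧ NearIdeal Ideal P a r}.indicator (fun _ => c) a ≤ G * c := by
    intro P c
    rw [← tsum_subtype, ENNReal.tsum_set_const]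
    refine mul_le_mul_left ?_ _
    exact_mod_cast hG P
  have h0 : ∀ P, ∑' a, f P a ≠ 0 := by
    intro P
    rw [hf]
    exact (lt_of_lt_of_le (ENNReal.ofReal_pos.2 hW0) le_self_add).ne'
  have htop : ∀ P, ∑' a, f P a ≠ ⊤ := by
    intro P
    rw [hf]
    refine ENNReal.add_ne_top.2 ⟨ENNReal.ofReal_ne_top, ?_⟩
    refine ne_top_of_le_ne_top ?_ ((ENNReal.tsum_le_tsum fun a => ?_).trans
      (hconst P (ENNReal.ofReal (Real.exp (ε / 2 * (r + 1))))))
    · exact ENNReal.mul_ne_top (ENNReal.natCast_ne_top _) ENNReal.ofReal_ne_top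
    · by_cases h : a ∈ N ∧ NearIdeal Ideal P a r
      · rw [Set.indicator_of_mem (show a ∈ {a | a ∈ N ∧ NearIdeal Ideal P a r} from h)]
        simp only [g, h.1, if_true]
        refine ENNReal.ofReal_le_ofReal ?_
        have h1 : (score Ideal r P a : ℝ) ≤ r + 1 := by exact_mod_cast score_le r P a
        have h2 : Real.exp (ε / 2 * score Ideal r P a) ≤ Real.exp (ε / 2 * (r + 1)) := by gcongr
        linarith
      · rw [hg0 P a h]; exact zero_le
  have hpt : ∀ P P', Neighboring P P' → ∀ a, g P a ≤ ENNReal.ofReal e * g P' a +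
      {a | a ∈ N ∧ NearIdeal Ideal P a r}.indicator (fun _ => ENNReal.ofReal (e - 1)) a := by
    intro P P' hPP' a
    by_cases h : a ∈ N ∧ NearIdeal Ideal P a r
    · rw [Set.indicator_of_mem (show a ∈ {a | a ∈ N ∧ NearIdeal Ideal P a r} from h)]
      simp only [g, h.1, if_true]
      have h3 : 1 ≤ Real.exp (ε / 2 * score Ideal r P' a) := Real.one_le_exp (by positivity)
      rw [← ENNReal.ofReal_mul (by linarith), ← ENNReal.ofReal_add (by nlinarith) (by linarith)]
      refine ENNReal.ofReal_le_ofReal ?_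
      have h1 : (score Ideal r P a : ℝ) ≤ score Ideal r P' a + 1 := by
        exact_mod_cast score_le_succ (Ideal := Ideal) (r := r) (a := a) hPP'
      have h2 : Real.exp (ε / 2 * score Ideal r P a) ≤
          e * Real.exp (ε / 2 * score Ideal r P' a) := by
        rw [he, ← Real.exp_add]
        refine Real.exp_le_exp.2 ?_
        nlinarith
      linarith
    · rw [hg0 P a h]; exact zero_le
  have hgS : ∀ P P', Neighboring P P' → ∀ S : Set α, ∑' a, S.indicator (g P) a ≤
      ENNReal.ofReal e * ∑' a, S.indicator (g P') a + G * ENNReal.ofReal (e - 1) := by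
    intro P P' hPP' S
    refine le_trans ?_ (add_le_add_right (hconst P _) _)
    rw [← ENNReal.tsum_mul_left, ← ENNReal.tsum_add]
    refine ENNReal.tsum_le_tsum fun a => ?_
    by_cases ha : a ∈ S
    · simpa only [Set.indicator_of_mem ha] using hpt P P' hPP' a
    · simp [Set.indicator_of_notMem ha]
  have hfS : ∀ P (S : Set α), ∑' a, S.indicator (f P) a =
      ∑' a, S.indicator b a + ∑' a, S.indicator (g P) a := by
    intro P S
    rw [← ENNReal.tsum_add]
    refine tsum_congr fun a => ?_
    by_cases ha : a ∈ S <;> simp [ha, f]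
  have he1' : 1 ≤ ENNReal.ofReal e := by simpa using he1
  refine ⟨fun P => PMF.normalize (f P) (h0 P) (htop P), isDP_normalize h0 htop ?_ ?_, ?_⟩
  · intro P P' hPP'
    rw [hf, hf, ← he]
    have h1 := hgS P P' hPP' Set.univ
    simp only [Set.indicator_univ] at h1
    refine (add_le_add_right h1 _).trans ?_
    rw [mul_add, add_left_comm, add_comm (ENNReal.ofReal e * ENNReal.ofReal W)]
    refine add_le_add_right ?_ _
    rw [← ENNReal.ofReal_mul (by linarith), ← ENNReal.ofReal_natCast,
      ← ENNReal.ofReal_mul (by positivity), ← ENNReal.ofReal_add hW0.le (by nlinarith)]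
    refine ENNReal.ofReal_le_ofReal ?_
    nlinarith
  · intro P P' hPP' S
    rw [hfS, hfS, hf, ← he, mul_add, add_assoc]
    refine add_le_add (le_mul_of_one_le_left zero_le he1') ((hgS P P' hPP' S).trans ?_)
    refine add_le_add_right ?_ _
    refine le_trans ?_ (mul_le_mul_right (le_self_add : ENNReal.ofReal W ≤ _) _)
    rw [← ENNReal.ofReal_natCast, ← ENNReal.ofReal_mul (by positivity),
      ← ENNReal.ofReal_mul hδ.le]
    refine ENNReal.ofReal_le_ofReal ?_
    have : δ * W = e * G := by rw [hW]; field_simp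
    rw [this]
    nlinarith
  · rintro P ⟨a, ha, hideal⟩
    refine le_toOuterMeasure_normalize _ _ hβ.le ?_
    have hbad : ∑' a, {a | NearIdeal Ideal P a r}ᶜ.indicator (f P) a ≤ ENNReal.ofReal W := by
      rw [← hb]
      refine ENNReal.tsum_le_tsum fun a => ?_
      by_cases hn : NearIdeal Ideal P a r
      · simp [hn]
      · simp [hn, f, hg0 P a fun h => hn h.2]
    refine hbad.trans ?_
    have hZ : ENNReal.ofReal (Real.exp (ε / 2 * (r + 1))) ≤ ∑' a, f P a := by
      have h1 : g P a ≤ ∑' a, g P a := ENNReal.le_tsum a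
      simp only [g, ha, if_true, score_of_ideal hideal] at h1
      rw [hf]
      refine le_trans ?_ (add_le_add_right h1 _)
      have h2 : 1 ≤ Real.exp (ε / 2 * ((r + 1 : ℕ) : ℝ)) := Real.one_le_exp (by positivity)
      rw [← ENNReal.ofReal_add hW0.le (by linarith)]
      refine ENNReal.ofReal_le_ofReal ?_
      push_cast
      linarith
    refine le_trans ?_ (mul_le_mul_right hZ _)
    rw [← ENNReal.ofReal_mul hβ.le]
    refine ENNReal.ofReal_le_ofReal ?_
    rw [hW, div_le_iff₀ hδ, mul_add, mul_one, Real.exp_add, ← he]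
    nlinarith

/-! ### Ideal positions and stable datasets -/

lemma IsTight.mono {T : E d ≃ᵃ[ℝ] E d} {K : Set (E d)} {v v' : ℝ} (h : IsTight T K v)
    (hv : v' ≤ v) : IsTight T K v' :=
  ⟨h.1, (ENNReal.ofReal_le_ofReal hv).trans h.2⟩

lemma IsTight.of_subset {T : E d ≃ᵃ[ℝ] E d} {K K' : Set (E d)} {v : ℝ} (h : IsTight T K v)
    (hK : K' ⊆ K) (hvol : volume K ≤ 2 * volume K') : IsTight T K' (v / 2) := by
  refine ⟨(Set.image_mono hK).trans h.1, ?_⟩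
  rw [ENNReal.ofReal_div_of_pos (by norm_num), ENNReal.ofReal_ofNat]
  refine ENNReal.div_le_of_le_mul' (h.2.trans ?_)
  rw [volume_image, volume_image, mul_left_comm]
  exact mul_le_mul_right hvol _

/-- `T` is ideal for `Q` if the volumes of the two Tukey regions are comparable and `T` is tight
for the larger one. -/
def IsIdealPosition (κ r : ℕ) (T : E d ≃ᵃ[ℝ] E d) (Q : Finset (E d)) : Prop :=
  volume (tukeyRegion Q (κ - (2 * r - 1))) ≤ 2 * volume (tukeyRegion Q κ) ∧
    IsTight T (tukeyRegion Q (κ - (2 * r - 1))) (2 / (5 ^ d * d.factorial))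

/-- For a suitable `k` the region `D_P(k)` is caught between `D_Q(κ)` and `D_Q(κ - (2r - 1))`, whose
volumes differ by a factor of at most `2`; tightness for the larger passes to `D_P(k)` with half the
volume. Stability of `P` plays no role, so this also bounds the number of competitors at arbitrary
datasets. -/
lemma isTight_of_nearIdeal (hd : 1 ≤ d) {κ r : ℕ} (hr : 1 ≤ r) (hκ : 2 * r - 1 ≤ κ)
    {P : Finset (E d)} {T : E d ≃ᵃ[ℝ] E d} (h : NearIdeal (IsIdealPosition κ r) P T r) :
    IsTight T (tukeyRegion P (κ - (r - 1))) (1 / (5 ^ d * d.factorial)) ∨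
      IsTight T (tukeyRegion P (κ - r)) (1 / (5 ^ d * d.factorial)) := by
  obtain ⟨Q, ⟨hvol, htight⟩, hdist⟩ := h
  have hcard : ((P : Set (E d)) \ Q).ncard + ((Q : Set (E d)) \ P).ncard ≤ r := by
    rw [← Set.ncard_union_eq disjoint_sdiff_sdiff (P.finite_toSet.subset Set.sdiff_subset)
      (Q.finite_toSet.subset Set.sdiff_subset)]
    exact hdist
  have key : ∀ k, κ - (2 * r - 1) + ((P : Set (E d)) \ Q).ncard ≤ k →
      k + ((Q : Set (E d)) \ P).ncard ≤ κ →
      IsTight T (tukeyRegion P k) (1 / (5 ^ d * d.factorial)) := by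
    intro k hk1 hk2
    have h1 := htight.of_subset (tukeyRegion_subset_of_sdiff hd hk1)
      (hvol.trans (mul_le_mul_right (measure_mono (tukeyRegion_subset_of_sdiff hd hk2)) _))
    convert h1 using 1
    ring
  -- Depth `κ - (r - 1)` works unless `Q` has `r` points outside `P`. Then `P` has none outside `Q`,
  -- and depth `κ - r` works. The two cases allow a window of `2r - 1` instead of `2r`.
  by_cases hj : ((Q : Set (E d)) \ P).ncard ≤ r - 1
  · exact Or.inl (key _ (by omega) (by omega))
  · exact Or.inr (key _ (by omega) (by omega))

/-- The hypotheses on the dataset: both regions have comparable positive volume. -/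
structure IsStable (P : Finset (E d)) (κ κ' : ℕ) : Prop where
  le : κ' ≤ κ
  pos : 0 < volume (tukeyRegion P κ)
  half_le : volume (tukeyRegion P κ') / 2 ≤ volume (tukeyRegion P κ)

namespace IsStable

variable {P : Finset (E d)} {κ κ' : ℕ}

lemma volume_le (h : IsStable P κ κ') : volume (tukeyRegion P κ') ≤ 2 * volume (tukeyRegion P κ) := by
  have := h.half_le
  rwa [ENNReal.div_le_iff' (by norm_num) (by norm_num)] at this

/-- The region of depth `0` is the whole space, of infinite volume, while `D_P(κ)` is bounded. -/
lemma one_le (h : IsStable P κ κ') (hd : 1 ≤ d) (hκ : 1 ≤ κ) : 1 ≤ κ' := by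
  have : Nonempty (Fin d) := ⟨⟨0, hd⟩⟩
  by_contra h0
  have h1 := h.volume_le
  rw [show κ' = 0 by omega, tukeyRegion_zero, measure_univ_of_isAddLeftInvariant] at h1
  exact ENNReal.mul_ne_top (by norm_num) (isCompact_tukeyRegion hd P hκ).measure_lt_top.ne
    (top_le_iff.1 h1)

lemma exists_isTight (h : IsStable P κ κ') (hd : 1 ≤ d) (hκ : 1 ≤ κ)
    {N : Set (E d ≃ᵃ[ℝ] E d)} (hN : IsNet N) {k : ℕ} (hk : κ' ≤ k) (hk' : k ≤ κ) :
    ∃ T ∈ N, IsTight T (tukeyRegion P k) (2 / (5 ^ d * d.factorial)) :=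
  hN.exists_isTight hd (isCompact_tukeyRegion hd P ((h.one_le hd hκ).trans hk))
    (convex_tukeyRegion hd P k) (interior_nonempty_of_volume_pos (convex_tukeyRegion hd P k)
      (h.pos.trans_le (measure_mono (tukeyRegion_anti hk'))))

lemma exists_isIdealPosition (h : IsStable P κ κ') (hd : 1 ≤ d) (hκ : 1 ≤ κ)
    {N : Set (E d ≃ᵃ[ℝ] E d)} (hN : IsNet N) {r : ℕ} (hr : κ' + (2 * r - 1) ≤ κ) :
    ∃ T ∈ N, IsIdealPosition κ r T P := by
  obtain ⟨T, hTN, hT⟩ := h.exists_isTight hd hκ hN (k := κ - (2 * r - 1)) (by omega) (by omega)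
  exact ⟨T, hTN, (measure_mono (tukeyRegion_anti (by omega))).trans h.volume_le, hT⟩

lemma conclusion (h : IsStable P κ κ') (hd : 1 ≤ d) (hκ : 1 ≤ κ) {k : ℕ} (hk : κ' ≤ k)
    (hk' : k ≤ κ) {T : E d ≃ᵃ[ℝ] E d}
    (hT : IsTight T (tukeyRegion P k) (1 / (5 ^ d * d.factorial))) :
    Conclusion (withShrunk T) P κ κ' := by
  refine conclusion_of_isTight hd hκ h.le h.pos h.half_le ?_
  have h1 := hT.of_subset (tukeyRegion_anti hk')
    ((measure_mono (tukeyRegion_anti hk)).trans h.volume_le)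
  convert h1 using 1
  rw [div_div, mul_comm (2 : ℝ)]

lemma conclusion_of_nearIdeal (h : IsStable P κ κ') (hd : 1 ≤ d) (hκ : 1 ≤ κ) {r : ℕ} (hr1 : 1 ≤ r)
    (hr : κ' + (2 * r - 1) ≤ κ) {T : E d ≃ᵃ[ℝ] E d}
    (hT : NearIdeal (IsIdealPosition κ r) P T r) : Conclusion (withShrunk T) P κ κ' := by
  rcases isTight_of_nearIdeal hd hr1 (by omega) hT with hT | hT
  · exact h.conclusion hd hκ (by omega) (by omega) hT
  · exact h.conclusion hd hκ (by omega) (by omega) hT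

end IsStable

lemma IsNet.encard_isTight_le {N : Set (E d ≃ᵃ[ℝ] E d)} (hN : IsNet N) {v : ℝ} (hv : 0 < v)
    (K : Set (E d)) : {T | T ∈ N ∧ IsTight T K v}.encard ≤ packingBound d v := by
  rcases Set.eq_empty_or_nonempty {T | T ∈ N ∧ IsTight T K v} with h | ⟨T₀, -, hT₀⟩
  · simp [h]
  · obtain ⟨hfin, hcard⟩ := hN.packing hv T₀
    refine (Set.encard_le_encard (t := {T | T ∈ N ∧ ∃ K, IsTight T₀ K v ∧ IsTight T K v})
      fun T hT => ⟨hT.1, K, hT₀, hT.2⟩).trans ?_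
    rw [← hfin.cast_ncard_eq]
    exact_mod_cast hcard

/-! ### Private algorithms in terms of counting bounds -/

/-- There is an `(ε, δ)`-differentially private algorithm that fails with probability at most `β`
on stable datasets in the grid whose depth gap is at least `Δ`. -/
def Solvable (d υ κ : ℕ) (ε δ β Δ : ℝ) : Prop :=
  ∃ A : Finset (E d) → PMF ((E d ≃ᵃ[ℝ] E d) × (E d ≃ᵃ[ℝ] E d)), IsDP ε δ A ∧
    ∀ P : Finset (E d), (P : Set (E d)) ⊆ grid d υ → ∀ κ', IsStable P κ κ' →
      Δ ≤ (κ : ℝ) - κ' → ENNReal.ofReal (1 - β) ≤ (A P).toOuterMeasure {T | Conclusion T P κ κ'}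

lemma Solvable.mono {υ κ : ℕ} {ε δ δ' β Δ Δ' : ℝ} (h : Solvable d υ κ ε δ β Δ) (hδ : δ ≤ δ')
    (hΔ : Δ ≤ Δ') : Solvable d υ κ ε δ' β Δ' := by
  obtain ⟨A, hA, hP⟩ := h
  exact ⟨A, hA.mono hδ, fun P hPg κ' hs h => hP P hPg κ' hs (hΔ.trans h)⟩

/-- The number of candidate positions of the exponential mechanism. -/
noncomputable def candidateBound (d υ : ℕ) : ℕ :=
  ((2 ^ υ + 1) ^ (d * d) * 2) ^ (2 * d + 1) * packingBound d (gridTightness d)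

/-- `2 * x > 2 * ⌈x⌉₊ - 2` and `κ - κ'` is an integer. Thanks to the odd window no additive constant
enters the gap, which may be less than one. -/
lemma ceil_gap {x : ℝ} (hx : 0 < x) {κ κ' : ℕ} (h : 2 * x ≤ (κ : ℝ) - κ') :
    1 ≤ ⌈x⌉₊ ∧ κ' + (2 * ⌈x⌉₊ - 1) ≤ κ := by
  have h1 : 1 ≤ ⌈x⌉₊ := Nat.one_le_ceil_iff.2 hx
  refine ⟨h1, ?_⟩
  have h2 := Nat.ceil_lt_add_one hx.le
  have h3 : (2 * ⌈x⌉₊ : ℝ) < κ - κ' + 2 := by linarith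
  have h4 : 2 * ⌈x⌉₊ + κ' < κ + 2 := by
    have : (2 * ⌈x⌉₊ + κ' : ℝ) < κ + 2 := by linarith
    exact_mod_cast this
  omega

lemma gridTightness_le (hd : 1 ≤ d) : gridTightness d ≤ 2 / (5 ^ d * d.factorial) := by
  have hd1 : (1 : ℝ) ≤ d := by exact_mod_cast hd
  have h5 : (5 : ℝ) ^ d ≤ (5 * (d : ℝ) ^ 4) ^ d :=
    pow_le_pow_left₀ (by norm_num) (by nlinarith [one_le_pow₀ hd1 (n := 4)]) d
  have h9 : (9 / 20 : ℝ) ^ d ≤ 2 := (pow_le_one₀ (by norm_num) (by norm_num)).trans one_le_two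
  rw [gridTightness, div_div, mul_comm (d.factorial : ℝ)]
  gcongr

/-- With `r = ⌈2B/ε⌉₊` the gain `exp (ε / 2 * r)` is at least `exp B`, and a window of `2r - 1`
costs a gap of `4B/ε`. The candidate set depends on the grid alone; that `P` lies in the grid is
used for success only, not for privacy. -/
theorem solvable_pure (hd : 1 ≤ d) {υ κ : ℕ} (hκ : 1 ≤ κ) {ε β B : ℝ} (hε : 0 < ε) (hβ : 0 < β)
    (hB : 0 < B) (h : candidateBound d υ ≤ β * Real.exp B) :
    Solvable d υ κ ε 0 β (4 * B / ε) := by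
  obtain ⟨N, hN⟩ := exists_isNet d
  obtain ⟨s, hs, hmem⟩ := hN.finite_isTight_grid hd υ
  have hx : 0 < 2 * B / ε := by positivity
  set r := ⌈2 * B / ε⌉₊ with hr
  have hcard : (s.card : ℝ) ≤ β * Real.exp (ε / 2 * r) := by
    refine le_trans (by exact_mod_cast hs) (h.trans ?_)
    have h1 : B ≤ ε / 2 * r := by
      have := Nat.le_ceil (2 * B / ε)
      rw [div_le_iff₀ hε] at this
      linarith
    gcongr
  have : Nonempty (E d ≃ᵃ[ℝ] E d) := ⟨AffineEquiv.refl ℝ _⟩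
  obtain ⟨A, hA, hP⟩ := exists_pure_mechanism (IsIdealPosition κ r) s hε hβ hcard
  refine ⟨fun P => (A P).map withShrunk, hA.map _, fun P hPg κ' hstab hgap => ?_⟩
  obtain ⟨hr1, hgap'⟩ := ceil_gap hx (κ' := κ')
    (by rw [show 2 * (2 * B / ε) = 4 * B / ε by ring]; exact hgap)
  obtain ⟨T, hTN, hT⟩ := hstab.exists_isIdealPosition hd hκ hN hgap'
  rw [PMF.toOuterMeasure_map_apply]
  refine (hP P ⟨T, ?_, hT⟩).trans ((A P).toOuterMeasure.mono fun T hT => ?_)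
  · have := hstab.one_le hd hκ
    exact hmem T hTN P hPg (κ - (2 * r - 1)) (by omega) (hT.2.mono (gridTightness_le hd))
  · exact hstab.conclusion_of_nearIdeal hd hκ hr1 hgap' hT

/-- A near-ideal member of the net is tight for one of two regions of `P`, each with one packing
number: hence the factor `2`. The count does not involve the grid. -/
theorem solvable_approx (hd : 1 ≤ d) {υ κ : ℕ} (hκ : 1 ≤ κ) {ε δ β B : ℝ} (hε : 0 < ε)
    (hδ : 0 < δ) (hδ1 : δ ≤ 1) (hβ : 0 < β) (hB : 0 < B)
    (h : 2 * packingBound d (1 / (5 ^ d * d.factorial)) ≤ δ * β * Real.exp B) :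
    Solvable d υ κ ε δ β (4 * B / ε) := by
  obtain ⟨N, hN⟩ := exists_isNet d
  have hx : 0 < 2 * B / ε := by positivity
  set r := ⌈2 * B / ε⌉₊ with hr
  have hr1 : 1 ≤ r := Nat.one_le_ceil_iff.2 hx
  have : Nonempty (E d ≃ᵃ[ℝ] E d) := ⟨AffineEquiv.refl ℝ _⟩
  by_cases hκr : 2 * r - 1 ≤ κ
  · have hv : (0 : ℝ) < 1 / (5 ^ d * d.factorial) := by positivity
    have hcount : ∀ P : Finset (E d), {T | T ∈ N ∧ NearIdeal (IsIdealPosition κ r) P T r}.encard ≤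
        (2 * packingBound d (1 / (5 ^ d * d.factorial)) : ℕ) := by
      intro P
      have hsub : {T | T ∈ N ∧ NearIdeal (IsIdealPosition κ r) P T r} ⊆
          {T | T ∈ N ∧ IsTight T (tukeyRegion P (κ - (r - 1))) (1 / (5 ^ d * d.factorial))} ∪
          {T | T ∈ N ∧ IsTight T (tukeyRegion P (κ - r)) (1 / (5 ^ d * d.factorial))} := by
        rintro T ⟨hTN, hT⟩
        exact (isTight_of_nearIdeal hd hr1 hκr hT).imp (fun h => ⟨hTN, h⟩) fun h => ⟨hTN, h⟩
      refine ((Set.encard_le_encard hsub).trans (Set.encard_union_le _ _)).trans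
        ((add_le_add (hN.encard_isTight_le hv _) (hN.encard_isTight_le hv _)).trans (le_of_eq ?_))
      push_cast
      ring
    have hcard : ((2 * packingBound d (1 / (5 ^ d * d.factorial)) : ℕ) : ℝ) ≤
        δ * β * Real.exp (ε / 2 * r) := by
      push_cast
      refine h.trans ?_
      have h1 : B ≤ ε / 2 * r := by
        have := Nat.le_ceil (2 * B / ε)
        rw [div_le_iff₀ hε] at this
        linarith
      gcongr
    obtain ⟨A, hA, hP⟩ := exists_approx_mechanism (IsIdealPosition κ r) N hε hδ hδ1 hβ
      (by have := packingBound_pos d (1 / (5 ^ d * d.factorial)); omega) hcount hcard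
    refine ⟨fun P => (A P).map withShrunk, hA.map _, fun P hPg κ' hstab hgap => ?_⟩
    obtain ⟨-, hgap'⟩ := ceil_gap hx (κ' := κ')
      (by rw [show 2 * (2 * B / ε) = 4 * B / ε by ring]; exact hgap)
    rw [PMF.toOuterMeasure_map_apply]
    exact (hP P (hstab.exists_isIdealPosition hd hκ hN hgap')).trans
      ((A P).toOuterMeasure.mono fun T hT =>
        hstab.conclusion_of_nearIdeal hd hκ hr1 hgap' hT)
  -- If `κ < 2r - 1`, no dataset has the required gap and any constant output will do.
  · refine ⟨fun _ => PMF.pure (withShrunk (AffineEquiv.refl ℝ _)),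
      (isDP_const hε.le _), fun P hPg κ' hstab hgap => ?_⟩
    obtain ⟨-, hgap'⟩ := ceil_gap hx (κ' := κ')
      (by rw [show 2 * (2 * B / ε) = 4 * B / ε by ring]; exact hgap)
    omega

/-! ### Degenerate parameters -/

lemma solvable_of_one_le_beta {υ κ : ℕ} {ε δ β Δ : ℝ} (hε : 0 ≤ ε) (hβ : 1 ≤ β) :
    Solvable d υ κ ε δ β Δ := by
  refine ⟨fun _ => PMF.pure (withShrunk (AffineEquiv.refl ℝ _)), isDP_const hε _,
    fun P _ κ' _ _ => ?_⟩
  rw [ENNReal.ofReal_of_nonpos (by linarith)]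
  exact zero_le

lemma ofReal_le_toOuterMeasure_pure {α : Type*} {a : α} {S : Set α} (ha : a ∈ S) {β : ℝ}
    (hβ : 0 ≤ β) : ENNReal.ofReal (1 - β) ≤ (PMF.pure a).toOuterMeasure S := by
  rw [PMF.toOuterMeasure_pure_apply, if_pos ha, ENNReal.ofReal_le_one]
  linarith

/-- For `δ ≥ 1` every algorithm is private. -/
lemma solvable_of_one_le_delta (hd : 1 ≤ d) {υ κ : ℕ} (hκ : 1 ≤ κ) {ε δ β Δ : ℝ} (hδ : 1 ≤ δ)
    (hβ : 0 ≤ β) : Solvable d υ κ ε δ β Δ := by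
  obtain ⟨N, hN⟩ := exists_isNet d
  have hT : ∀ P : Finset (E d), ∃ T : E d ≃ᵃ[ℝ] E d, (∃ T' : E d ≃ᵃ[ℝ] E d,
      IsTight T' (tukeyRegion P κ) (1 / (5 ^ d * d.factorial))) →
      IsTight T (tukeyRegion P κ) (1 / (5 ^ d * d.factorial)) := by
    intro P
    by_cases h : ∃ T' : E d ≃ᵃ[ℝ] E d, IsTight T' (tukeyRegion P κ) (1 / (5 ^ d * d.factorial))
    · exact ⟨h.choose, fun _ => h.choose_spec⟩
    · exact ⟨AffineEquiv.refl ℝ _, fun h' => absurd h' h⟩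
  choose T hT using hT
  refine ⟨fun P => PMF.pure (withShrunk (T P)), isDP_of_one_le hδ _, fun P _ κ' hstab _ => ?_⟩
  refine ofReal_le_toOuterMeasure_pure ?_ hβ
  obtain ⟨T', -, hT'⟩ := hstab.exists_isTight hd hκ hN hstab.le le_rfl
  refine hstab.conclusion hd hκ hstab.le le_rfl (hT P ⟨T', hT'.mono ?_⟩)
  gcongr
  norm_num

lemma convex_unitCube : Convex ℝ (unitCube d) := by
  intro x hx y hy a b ha hb hab i
  simp only [PiLp.add_apply, PiLp.smul_apply, smul_eq_mul]
  constructor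
  · have := mul_nonneg ha (hx i).1
    have := mul_nonneg hb (hy i).1
    linarith
  · have := mul_le_mul_of_nonneg_left (hx i).2 ha
    have := mul_le_mul_of_nonneg_left (hy i).2 hb
    linarith

lemma grid_subset_unitCube (d υ : ℕ) : grid d υ ⊆ unitCube d := by
  intro x hx i
  obtain ⟨j, hj, hx⟩ := hx i
  have h : (j : ℝ) ≤ 2 ^ υ := by exact_mod_cast hj
  rw [hx]
  exact ⟨by positivity, (div_le_one (by positivity)).2 h⟩

/-- For the three-point grid on a line the identity is tight. -/
lemma isTight_refl_of_one {P : Finset (E 1)} (hP : (P : Set (E 1)) ⊆ grid 1 1) {κ : ℕ} (hκ : 1 ≤ κ)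
    (hpos : 0 < volume (tukeyRegion P κ)) :
    IsTight (AffineEquiv.refl ℝ (E 1)) (tukeyRegion P κ) (1 / 5) := by
  have himg : (AffineEquiv.refl ℝ (E 1)) '' tukeyRegion P κ = tukeyRegion P κ := by
    simp [AffineEquiv.coe_refl]
  have hsub : tukeyRegion P κ ⊆ unitCube 1 :=
    (tukeyRegion_subset_convexHull_self le_rfl P hκ).trans
      (convexHull_min (hP.trans (grid_subset_unitCube 1 1)) convex_unitCube)
  have hgrid : ∀ p ∈ P, p 0 = 0 ∨ p 0 = 1 / 2 ∨ p 0 = 1 := by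
    intro p hp
    obtain ⟨j, hj, h⟩ := hP hp 0
    have hj2 : j ≤ 2 := by simpa using hj
    interval_cases j
    · left; simpa using h
    · right; left; simpa using h
    · right; right; rw [h]; norm_num
  have hinner : ∀ p u : E 1, ⟪p, u⟫ = p 0 * u 0 := by
    intro p u
    simp [PiLp.inner_apply, mul_comm]
  -- A set of positive volume contains more than the three grid points.
  obtain ⟨x, hx, hx0, hx1, hx2⟩ : ∃ x ∈ tukeyRegion P κ, x 0 ≠ 0 ∧ x 0 ≠ 1 / 2 ∧ x 0 ≠ 1 := by
    by_contra h
    push Not at h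
    have hfin : (tukeyRegion P κ).Finite := by
      refine ((Set.toFinite ({0, 1 / 2, 1} : Set ℝ)).preimage
        (f := fun x : E 1 => x 0) ?_).subset ?_
      · intro x _ y _ hxy
        ext i
        rw [Subsingleton.elim i 0]
        exact hxy
      · intro x hx
        by_cases h0 : x 0 = 0
        · exact Or.inl h0
        · by_cases h1 : x 0 = 1 / 2
          · exact Or.inr (Or.inl h1)
          · exact Or.inr (Or.inr (h x hx h0 h1))
    rw [hfin.measure_zero] at hpos
    exact lt_irrefl _ hpos
  -- the depth is constant between grid points
  have htrans : ∀ y : E 1, (∀ p ∈ P, (p 0 ≤ x 0 ↔ p 0 ≤ y 0) ∧ (x 0 ≤ p 0 ↔ y 0 ≤ p 0)) →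
      y ∈ tukeyRegion P κ := by
    intro y hy
    rw [mem_tukeyRegion_iff le_rfl] at hx ⊢
    intro u hu
    have h1 : {p : E 1 | p ∈ P ∧ ⟪p, u⟫ ≤ ⟪y, u⟫} = {p : E 1 | p ∈ P ∧ ⟪p, u⟫ ≤ ⟪x, u⟫} := by
      ext p
      simp only [Set.mem_ofPred_eq, hinner]
      refine and_congr_right fun hp => ?_
      rcases lt_trichotomy (u 0) 0 with hu0 | hu0 | hu0
      · rw [mul_le_mul_right_of_neg hu0, mul_le_mul_right_of_neg hu0]
        exact (hy p hp).2.symm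
      · simp [hu0]
      · rw [mul_le_mul_iff_left₀ hu0, mul_le_mul_iff_left₀ hu0]
        exact (hy p hp).1.symm
    rw [h1]
    exact hx u hu
  have hmain : ∀ a b : ℝ, b - a = 2 / 5 → {y : E 1 | ∀ i, a ≤ y i ∧ y i ≤ b} ⊆ tukeyRegion P κ →
      IsTight (AffineEquiv.refl ℝ (E 1)) (tukeyRegion P κ) (1 / 5) := by
    intro a b hab h
    refine ⟨by rw [himg]; exact hsub, ?_⟩
    rw [himg]
    refine le_trans ?_ (measure_mono h)
    rw [volume_cube, hab, pow_one]
    exact ENNReal.ofReal_le_ofReal (by norm_num)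
  have hxc := hsub hx 0
  rcases lt_or_gt_of_ne hx1 with hlt | hgt
  · have hx0' : 0 < x 0 := lt_of_le_of_ne hxc.1 (Ne.symm hx0)
    refine hmain (1 / 20) (9 / 20) (by norm_num) fun y hy => htrans y fun p hp => ?_
    have hy0 := hy 0
    rcases hgrid p hp with h | h | h <;> rw [h] <;>
      constructor <;> constructor <;> intro h' <;> linarith [hy0.1, hy0.2]
  · have hx2' : x 0 < 1 := lt_of_le_of_ne hxc.2 hx2
    refine hmain (11 / 20) (19 / 20) (by norm_num) fun y hy => htrans y fun p hp => ?_
    have hy0 := hy 0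
    rcases hgrid p hp with h | h | h <;> rw [h] <;>
      constructor <;> constructor <;> intro h' <;> linarith [hy0.1, hy0.2]

/-- For `d = υ = 1` the logarithms in the bounds can be arbitrarily close to `0`, too small to pay
for a selection; but here the identity works without looking at the data. -/
lemma solvable_one_one {κ : ℕ} (hκ : 1 ≤ κ) {ε δ β Δ : ℝ} (hε : 0 ≤ ε) (hβ : 0 ≤ β) :
    Solvable 1 1 κ ε δ β Δ := by
  refine ⟨fun _ => PMF.pure (withShrunk (AffineEquiv.refl ℝ _)), isDP_const hε _,
    fun P hP κ' hstab _ => ofReal_le_toOuterMeasure_pure ?_ hβ⟩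
  refine hstab.conclusion le_rfl hκ hstab.le le_rfl ?_
  simpa using isTight_refl_of_one hP hκ hstab.pos

end TukeyFat

namespace TukeyFat

/-! ### Numerical bounds -/

/-- The hypothesis on `1 / v` holds for both tightness constants in use. Each rounded entry has at
most `exp (17 * d * (1 + log d))` values, and the number of entries is `(d + 1) * d ≤ 2 * d ^ 2`:
hence the `34`. -/
lemma packingBound_le {d : ℕ} (hd : 1 ≤ d) {v : ℝ} (hv : 0 < v)
    (hv' : 1 / v ≤ Real.exp (5 * d * (1 + Real.log d))) :
    (packingBound d v : ℝ) ≤ Real.exp (34 * d ^ 3 * (1 + Real.log d)) := by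
  have hd1 : (1 : ℝ) ≤ d := by exact_mod_cast hd
  have hd0 : (0 : ℝ) < d := by linarith
  set l := Real.log d with hl
  have hl0 : 0 ≤ l := Real.log_nonneg hd1
  have hdl : (d : ℝ) = Real.exp l := (Real.exp_log hd0).symm
  set t := Real.exp (5 * d * (1 + l)) with ht
  have ht1 : 1 ≤ t := Real.one_le_exp (by positivity)
  have hR : 1 + d / v ≤ 2 * d * t := by
    have h1 : (d : ℝ) / v ≤ d * t := by
      rw [div_eq_mul_one_div]; gcongr
    nlinarith
  have hR0 : 0 ≤ 1 + d / v := by positivity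
  have hX : (1 + d / v) * (20 * (1 + 2 * d * (1 + d / v))) ≤ 200 * d ^ 3 * t ^ 2 := by
    have h2 : 1 ≤ d * t := by nlinarith
    have h1 : 1 + 2 * d * (1 + d / v) ≤ 5 * d ^ 2 * t := by
      have h3 : 2 * (d : ℝ) * (1 + d / v) ≤ 2 * d * (2 * d * t) := by gcongr
      have h4 : 1 ≤ (d : ℝ) ^ 2 * t := by nlinarith
      nlinarith
    calc (1 + d / v) * (20 * (1 + 2 * d * (1 + d / v)))
        ≤ (2 * d * t) * (20 * (5 * d ^ 2 * t)) := by gcongr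
      _ = 200 * d ^ 3 * t ^ 2 := by ring
  have hround : (2 * roundBound d v + 1 : ℝ) ≤ Real.exp (17 * d * (1 + l)) := by
    have h1 : (roundBound d v : ℝ) ≤ 200 * d ^ 3 * t ^ 2 + 1 :=
      (Nat.ceil_lt_add_one (by positivity)).le.trans (by linarith)
    have h2 : (1 : ℝ) ≤ d ^ 3 * t ^ 2 :=
      one_le_mul_of_one_le_of_one_le (one_le_pow₀ hd1) (one_le_pow₀ ht1)
    have h3 : (403 : ℝ) ≤ Real.exp 7 := by
      have h4 : (2.7 : ℝ) ^ 7 ≤ Real.exp 1 ^ 7 := by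
        gcongr
        linarith [Real.exp_one_gt_d9]
      rw [← Real.exp_nat_mul] at h4
      norm_num at h4 ⊢
      linarith
    calc (2 * roundBound d v + 1 : ℝ) ≤ 403 * (d ^ 3 * t ^ 2) := by linarith
      _ ≤ Real.exp 7 * (d ^ 3 * t ^ 2) := by gcongr
      _ = Real.exp (7 + (3 * l + 2 * (5 * d * (1 + l)))) := by
          rw [Real.exp_add, Real.exp_add, ht, ← Real.exp_nat_mul]
          nth_rewrite 1 [hdl]
          rw [← Real.exp_nat_mul]
          norm_num
      _ ≤ Real.exp (17 * d * (1 + l)) := by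
          refine Real.exp_le_exp.2 ?_
          nlinarith [mul_nonneg (sub_nonneg.2 hd1) hl0]
  unfold packingBound
  push_cast
  calc (2 * roundBound d v + 1 : ℝ) ^ ((d + 1) * d) ≤ Real.exp (17 * d * (1 + l)) ^ ((d + 1) * d) := by
        gcongr
    _ = Real.exp ((d + 1) * d * (17 * d * (1 + l))) := by
        rw [← Real.exp_nat_mul]; push_cast; rfl
    _ ≤ Real.exp (34 * d ^ 3 * (1 + l)) := by
        refine Real.exp_le_exp.2 ?_
        have h1 : 0 ≤ 17 * (d : ℝ) ^ 2 * (1 + l) := by positivity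
        nlinarith [mul_nonneg (sub_nonneg.2 hd1) h1]

lemma factorial_mul_pow_le {d : ℕ} (hd : 1 ≤ d) :
    (5 : ℝ) ^ d * d.factorial ≤ Real.exp (2 * d + d * Real.log d) := by
  have hd0 : (0 : ℝ) < d := by exact_mod_cast hd
  have h1 : (d.factorial : ℝ) ≤ d ^ d := by exact_mod_cast Nat.factorial_le_pow d
  have h2 : (d : ℝ) ^ d = Real.exp (d * Real.log d) := by
    rw [Real.exp_nat_mul, Real.exp_log hd0]
  have h3 : (5 : ℝ) ^ d ≤ Real.exp (2 * d) := by
    rw [mul_comm, Real.exp_nat_mul]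
    gcongr
    have h4 : (2.7 : ℝ) ^ 2 ≤ Real.exp 1 ^ 2 := by
      gcongr
      linarith [Real.exp_one_gt_d9]
    rw [← Real.exp_nat_mul] at h4
    norm_num at h4 ⊢
    linarith
  rw [Real.exp_add, ← h2]
  gcongr

lemma packingBound_tight_le {d : ℕ} (hd : 1 ≤ d) :
    (packingBound d (1 / (5 ^ d * d.factorial)) : ℝ) ≤
      Real.exp (34 * d ^ 3 * (1 + Real.log d)) := by
  refine packingBound_le hd (by positivity) ?_
  rw [one_div_one_div]
  refine (factorial_mul_pow_le hd).trans (Real.exp_le_exp.2 ?_)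
  have : 0 ≤ Real.log d := Real.log_natCast_nonneg d
  have hd0 : (0 : ℝ) < d := by exact_mod_cast hd
  nlinarith

lemma packingBound_grid_le {d : ℕ} (hd : 1 ≤ d) :
    (packingBound d (gridTightness d) : ℝ) ≤ Real.exp (34 * d ^ 3 * (1 + Real.log d)) := by
  have hd0 : (0 : ℝ) < d := by exact_mod_cast hd
  have hl : 0 ≤ Real.log d := Real.log_natCast_nonneg d
  refine packingBound_le hd (by unfold gridTightness; positivity) ?_
  have h1 : 1 / gridTightness d = (20 / 9 * (d : ℝ) ^ 4) ^ d * (5 ^ d * d.factorial) := by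
    have h9 : (20 / 9 : ℝ) ^ d = 1 / (9 / 20) ^ d := by rw [← one_div_pow]; norm_num
    rw [gridTightness, mul_pow, mul_pow, h9]
    field_simp
  have h2 : (20 / 9 * (d : ℝ) ^ 4) ^ d ≤ Real.exp (d * (1 + 4 * Real.log d)) := by
    rw [Real.exp_nat_mul, Real.exp_add]
    have h3 : Real.exp (4 * Real.log d) = (d : ℝ) ^ 4 := by
      rw [show (4 : ℝ) = ((4 : ℕ) : ℝ) by norm_num, Real.exp_nat_mul, Real.exp_log hd0]
    rw [h3]
    gcongr
    linarith [Real.exp_one_gt_d9]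
  rw [h1]
  refine (mul_le_mul h2 (factorial_mul_pow_le hd) (by positivity) (by positivity)).trans ?_
  rw [← Real.exp_add]
  refine Real.exp_le_exp.2 ?_
  nlinarith

/-- The codes contribute `9 * d ^ 3 * υ` to the exponent and the packing number `34 * d ^ 3 * (1 +
log d)`; `43 = 9 + 34`, as `1 ≤ υ`. -/
lemma candidateBound_le {d υ : ℕ} (hd : 1 ≤ d) (hυ : 1 ≤ υ) :
    (candidateBound d υ : ℝ) ≤ Real.exp (43 * d ^ 3 * (υ + Real.log d)) := by
  have hd1 : (1 : ℝ) ≤ d := by exact_mod_cast hd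
  have hd0 : (0 : ℝ) < d := by linarith
  have hυ1 : (1 : ℝ) ≤ υ := by exact_mod_cast hυ
  have hl : 0 ≤ Real.log d := Real.log_natCast_nonneg d
  have h2e : (2 : ℝ) ≤ Real.exp 1 := by linarith [Real.exp_one_gt_d9]
  have hbase : (2 ^ υ + 1 : ℝ) ≤ Real.exp (2 * υ) := by
    have h1 : (2 : ℝ) ^ υ ≤ Real.exp υ := by
      calc (2 : ℝ) ^ υ ≤ Real.exp 1 ^ υ := by gcongr
        _ = Real.exp υ := by rw [← Real.exp_nat_mul, mul_one]
    have h2 : (2 : ℝ) ≤ Real.exp υ := h2e.trans (Real.exp_le_exp.2 hυ1)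
    have h3 : Real.exp (2 * υ) = Real.exp υ * Real.exp υ := by rw [← Real.exp_add]; ring_nf
    rw [h3]
    nlinarith
  have hcodes : (((2 ^ υ + 1) ^ (d * d) * 2) ^ (2 * d + 1) : ℝ) ≤ Real.exp (9 * d ^ 3 * υ) := by
    have h1 : ((2 ^ υ + 1) ^ (d * d) * 2 : ℝ) ≤ Real.exp (d * d * (2 * υ) + 1) := by
      rw [Real.exp_add]
      refine mul_le_mul ?_ h2e (by norm_num) (Real.exp_pos _).le
      refine (pow_le_pow_left₀ (by positivity) hbase _).trans (le_of_eq ?_)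
      rw [← Real.exp_nat_mul]; push_cast; rfl
    refine (pow_le_pow_left₀ (by positivity) h1 _).trans ?_
    rw [← Real.exp_nat_mul]
    refine Real.exp_le_exp.2 ?_
    push_cast
    have h2 : (d : ℝ) * d * (2 * υ) + 1 ≤ 3 * d ^ 2 * υ := by
      nlinarith [one_le_mul_of_one_le_of_one_le (one_le_pow₀ hd1 (n := 2)) hυ1]
    calc (2 * (d : ℝ) + 1) * (d * d * (2 * υ) + 1) ≤ (3 * d) * (3 * d ^ 2 * υ) := by
          gcongr; linarith
      _ = 9 * d ^ 3 * υ := by ring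
  unfold candidateBound
  push_cast
  refine (mul_le_mul hcodes (packingBound_grid_le hd) (by positivity) (by positivity)).trans ?_
  rw [← Real.exp_add]
  refine Real.exp_le_exp.2 ?_
  have h3 : 0 ≤ (d : ℝ) ^ 3 := by positivity
  nlinarith [mul_nonneg h3 hl, mul_nonneg h3 (sub_nonneg.2 hυ1)]

lemma le_mul_exp {β B : ℝ} {n : ℝ} (hβ : 0 < β) (h : n ≤ Real.exp (B - Real.log (1 / β))) :
    n ≤ β * Real.exp B := by
  rw [Real.exp_sub, Real.exp_log (by positivity)] at h
  refine h.trans (le_of_eq ?_)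
  field_simp

/-! ### The three depth gaps -/

theorem solvable_log_size {d υ κ : ℕ} (hd : 1 ≤ d) (hυ : 1 ≤ υ) (hκ : 1 ≤ κ) {ε β : ℝ}
    (hε : 0 < ε) (hβ : 0 < β) (hβ1 : β < 1) :
    Solvable d υ κ ε 0 β (172 * (d ^ 3 * (υ + Real.log (d / β)) / ε)) := by
  have hd1 : (1 : ℝ) ≤ d := by exact_mod_cast hd
  have hυ1 : (1 : ℝ) ≤ υ := by exact_mod_cast hυ
  have hl : 0 ≤ Real.log d := Real.log_natCast_nonneg d
  have hlog : Real.log (d / β) = Real.log d + Real.log (1 / β) := by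
    rw [← Real.log_mul (by positivity) (by positivity), mul_one_div]
  have hβl : 0 < Real.log (1 / β) := Real.log_pos (by rw [lt_div_iff₀ hβ]; linarith)
  have hd3 : (1 : ℝ) ≤ d ^ 3 := one_le_pow₀ hd1
  have hB : 0 < 43 * d ^ 3 * (υ + Real.log (d / β)) := by
    rw [hlog]; positivity
  have := solvable_pure hd hκ (υ := υ) hε hβ hB (le_mul_exp hβ
    ((candidateBound_le hd hυ).trans (Real.exp_le_exp.2 (by
      rw [hlog]
      nlinarith))))
  refine this.mono le_rfl (le_of_eq ?_)
  ring

/-- `2 ≤ d * υ` keeps `log (d * υ)` above `log 2`, which gives `1 + log d ≤ 2.5 * log (d * υ)`; so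
`34 * 2.5 = 85`, together with the `log 2` from the two packing numbers, stays below `107`. -/
theorem solvable_log_log_size {d υ κ : ℕ} (hd : 1 ≤ d) (hdυ : 2 ≤ d * υ) (hκ : 1 ≤ κ) {ε δ β : ℝ}
    (hε : 0 < ε) (hδ : 0 < δ) (hδ1 : δ < 1) (hβ : 0 < β) (hβ1 : β < 1) :
    Solvable d υ κ ε δ β (430 * (d ^ 3 * Real.log (d * υ / (δ * β)) / ε)) := by
  have hd1 : (1 : ℝ) ≤ d := by exact_mod_cast hd
  have hdυ' : (2 : ℝ) ≤ d * υ := by exact_mod_cast hdυ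
  have hυ1 : (1 : ℝ) ≤ υ := by
    have : 1 ≤ υ := by
      by_contra h
      rw [show υ = 0 by omega] at hdυ
      omega
    exact_mod_cast this
  have hδβ : 0 < δ * β := by positivity
  have hlog : Real.log (d * υ / (δ * β)) = Real.log (d * υ) + Real.log (1 / (δ * β)) := by
    rw [← Real.log_mul (by positivity) (by positivity), mul_one_div]
  have hβl : 0 < Real.log (1 / (δ * β)) := Real.log_pos (by
    rw [lt_div_iff₀ hδβ]; nlinarith)
  have h2 : 0.69 ≤ Real.log 2 := by linarith [Real.log_two_gt_d9]
  have h2l : Real.log 2 ≤ Real.log (d * υ) := Real.log_le_log (by norm_num) hdυ'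
  have hl : 0 < Real.log (d * υ) := by linarith
  have hdl : Real.log d ≤ Real.log (d * υ) := Real.log_le_log (by positivity) (by nlinarith)
  have hd3 : (1 : ℝ) ≤ d ^ 3 := one_le_pow₀ hd1
  have hB : 0 < 107 * d ^ 3 * Real.log (d * υ / (δ * β)) := by
    rw [hlog]; positivity
  have := solvable_approx hd hκ (υ := υ) hε hδ hδ1.le hβ hB (le_mul_exp hδβ (by
    calc (2 * packingBound d (1 / (5 ^ d * d.factorial)) : ℝ)
        ≤ Real.exp (Real.log 2) * Real.exp (34 * d ^ 3 * (1 + Real.log d)) := by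
          rw [Real.exp_log (by norm_num)]
          gcongr
          exact packingBound_tight_le hd
      _ ≤ _ := by
          rw [← Real.exp_add, hlog]
          refine Real.exp_le_exp.2 ?_
          set l := Real.log (d * υ)
          have h3 : 34 * (d : ℝ) ^ 3 * (1 + Real.log d) ≤ 34 * d ^ 3 * (2.5 * l) := by
            gcongr; linarith
          nlinarith [mul_nonneg (sub_nonneg.2 hd3) hβl.le,
            mul_nonneg (sub_nonneg.2 hd3) (h2.trans h2l |>.trans' (by norm_num : (0 : ℝ) ≤ 0.69))]))
  refine this.mono le_rfl ?_
  rw [mul_div_assoc', ← sub_nonneg, ← sub_div]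
  refine div_nonneg ?_ hε.le
  have : 0 ≤ d ^ 3 * Real.log (d * υ / (δ * β)) := by rw [hlog]; positivity
  linarith

/-- Above `2` a logarithm lowers the argument by at least one. Hence the set defining `logStar` is
never empty and its infimum is not the default value `0`. -/
lemma exists_iterate_logb_le_one (n : ℕ) : ∀ x : ℝ, x ≤ n + 1 → ∃ k, (Real.logb 2)^[k] x ≤ 1 := by
  induction n with
  | zero => intro x hx; exact ⟨0, by simpa using hx⟩
  | succ n ih =>
    intro x hx
    push_cast at hx
    by_cases h1 : x ≤ 1
    · exact ⟨0, h1⟩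
    by_cases h2 : x ≤ 2
    · refine ⟨1, ?_⟩
      rw [Function.iterate_one, Real.logb_le_iff_le_rpow (by norm_num) (by linarith)]
      simpa using h2
    · have h3 : Real.logb 2 x ≤ x - 1 := by
        rw [Real.logb_le_iff_le_rpow (by norm_num) (by linarith)]
        have := one_add_mul_self_le_rpow_one_add (s := 1) (by norm_num) (p := x - 1) (by linarith)
        norm_num at this
        linarith
      obtain ⟨k, hk⟩ := ih (Real.logb 2 x) (by linarith)
      exact ⟨k + 1, hk⟩

lemma one_le_logStar {υ : ℕ} (hυ : 2 ≤ υ) : 1 ≤ logStar υ := by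
  rw [Nat.one_le_iff_ne_zero]
  intro h
  rw [logStar, Nat.sInf_eq_zero] at h
  have h2 : (2 : ℝ) ≤ υ := by exact_mod_cast hυ
  rcases h with h | h
  · simp only [Set.mem_ofPred_eq, Function.iterate_zero, id] at h
    linarith
  · obtain ⟨k, hk⟩ := exists_iterate_logb_le_one υ υ (by linarith)
    exact (Set.eq_empty_iff_forall_notMem.1 h) k hk

lemma logStar_one : logStar 1 = 0 := by
  rw [logStar, Nat.sInf_eq_zero]
  left
  simp

theorem solvable_deltaBB (opt : Optimizer) {d υ : ℕ} (hd : 1 ≤ d) (hυ : 1 ≤ υ) {ε δ β : ℝ}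
    (hε : 0 < ε) (hδ : 0 ≤ δ) (hβ : 0 < β) (hopt : opt = Optimizer.binarySearch ∨ 0 < δ) {κ : ℕ}
    (hκ : 1 ≤ κ) : Solvable d υ κ ε δ β (deltaBB 430 0 d υ ε δ β opt) := by
  have hd1 : (1 : ℝ) ≤ d := by exact_mod_cast hd
  have hυ1 : (1 : ℝ) ≤ υ := by exact_mod_cast hυ
  rcases le_or_gt 1 β with hβ1 | hβ1
  · exact solvable_of_one_le_beta hε.le hβ1
  have hd3 : (0 : ℝ) < d ^ 3 := by positivity
  have hβ' : 1 < 1 / β := by rw [lt_div_iff₀ hβ]; linarith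
  have hdβ : 0 ≤ Real.log (d / β) := Real.log_nonneg (by rw [le_div_iff₀ hβ]; linarith)
  have h2 : 0.69 ≤ Real.log 2 := by linarith [Real.log_two_gt_d9]
  rcases le_or_gt 1 δ with hδ1 | hδ1
  · exact solvable_of_one_le_delta hd hκ hδ1 hβ.le
  cases opt with
  | binarySearch =>
    refine (solvable_log_size hd hυ hκ hε hβ hβ1).mono hδ ?_
    simp only [deltaBB]
    gcongr
    norm_num
  | betweenThresholds =>
    have hδ0 : 0 < δ := hopt.resolve_left (by simp)
    by_cases h11 : d = 1 ∧ υ = 1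
    · obtain ⟨rfl, rfl⟩ := h11
      exact solvable_one_one hκ hε.le hβ.le
    have hdυ : 2 ≤ d * υ := by
      rcases Nat.lt_or_ge 1 d with h | h
      · nlinarith
      · obtain rfl : d = 1 := by omega
        omega
    refine (solvable_log_log_size hd hdυ hκ hε hδ0 hδ1 hβ hβ1).mono le_rfl ?_
    simp only [deltaBB, pow_zero, mul_one]
    gcongr
    exact mul_le_of_le_one_left hδ0.le (min_le_right _ _)
  | recConcave =>
    have hδ0 : 0 < δ := hopt.resolve_left (by simp)
    by_cases hυ2 : 2 ≤ υ
    · have hdυ : 2 ≤ d * υ := by nlinarith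
      refine (solvable_log_log_size hd hdυ hκ hε hδ0 hδ1 hβ hβ1).mono le_rfl ?_
      simp only [deltaBB]
      have hL : (1 : ℝ) ≤ logStar υ := by exact_mod_cast one_le_logStar hυ2
      set L := logStar υ
      have hδβ : 0 < δ * β := by positivity
      have hlogL : Real.log (1 / δ) ≤ Real.log (d * L / (δ * β)) := by
        refine Real.log_le_log (by positivity) ?_
        rw [div_le_div_iff₀ hδ0 hδβ]
        nlinarith [one_le_mul_of_one_le_of_one_le hd1 hL]
      have hlδ : 0 ≤ Real.log (1 / δ) := Real.log_nonneg (by rw [le_div_iff₀ hδ0]; linarith)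
      have h8 : (1 : ℝ) ≤ 8 ^ L * L :=
        one_le_mul_of_one_le_of_one_le (one_le_pow₀ (by norm_num)) hL
      have hsplit : Real.log (d * υ / (δ * β)) = Real.log (d * υ / β) + Real.log (1 / δ) := by
        rw [← Real.log_mul (by positivity) (by positivity)]
        congr 1
        field_simp
      -- The part with `log (1 / δ)` goes into the second summand, whose factor `8 ^ L * L` is at
      -- least `1` because `2 ≤ υ`.
      rw [hsplit, mul_add, add_div]
      gcongr 430 * (?_ + ?_ / ε)
      · exact le_rfl
      · calc (d : ℝ) ^ 3 * Real.log (1 / δ) ≤ d ^ 3 * (8 ^ L * L) * Real.log (1 / δ) := by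
              gcongr
              exact le_mul_of_one_le_right hd3.le h8
          _ ≤ d ^ 3 * (8 ^ L * L) * Real.log (d * L / (δ * β)) := by gcongr
          _ = d ^ 3 * 8 ^ L * L * Real.log (d * L / (δ * β)) := by ring
    · obtain rfl : υ = 1 := by omega
      -- Since `log* 1 = 0`, the second summand vanishes, and `δ` with it; so the pure algorithm is
      -- used. Its `172 * (1 + log (d / β))` is at most `430 * log (d / β)` because `log (d / β) ≥
      -- log 2`.
      by_cases hd2 : 2 ≤ d
      · refine (solvable_log_size hd hυ hκ hε hβ hβ1).mono hδ ?_
        have hl : Real.log 2 ≤ Real.log (d / β) := by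
          refine Real.log_le_log (by norm_num) ?_
          rw [le_div_iff₀ hβ]
          have : (2 : ℝ) ≤ d := by exact_mod_cast hd2
          linarith
        simp only [deltaBB, Nat.cast_one, logStar_one, Nat.cast_zero, mul_one, mul_zero, zero_mul,
          zero_div, add_zero, mul_div_assoc']
        rw [div_le_div_iff_of_pos_right hε]
        nlinarith
      · obtain rfl : d = 1 := by omega
        exact solvable_one_one hκ hε.le hβ.le

end TukeyFat

open TukeyFat in
theorem mainTheorem4 :
    ∃ C : ℝ, 0 < C ∧ ∃ k : ℕ,
      ∀ (opt : Optimizer) (d υ : ℕ), 1 ≤ d → 1 ≤ υ →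
      ∀ ε δ β : ℝ, 0 < ε → 0 ≤ δ → 0 < β → (opt = Optimizer.binarySearch ∨ 0 < δ) →
      ∀ κ : ℕ, 1 ≤ κ →
      ∃ A : Finset (E d) → PMF ((E d ≃ᵃ[ℝ] E d) × (E d ≃ᵃ[ℝ] E d)),
        IsDP ε δ A ∧
        ∀ P : Finset (E d), (P : Set (E d)) ⊆ grid d υ →
        ∀ κ' : ℕ, κ' ≤ κ → deltaBB C k d υ ε δ β opt ≤ (κ : ℝ) - (κ' : ℝ) →
          0 < volume (tukeyRegion P κ) →
          volume (tukeyRegion P κ') / 2 ≤ volume (tukeyRegion P κ) →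
          ENNReal.ofReal (1 - β) ≤ (A P).toOuterMeasure
            {T | -- (i) the map `M = T.1`
                 (T.1 '' unitCube d ⊆ unitCube d ∧
                  IsPolytope (T.1 '' tukeyRegion P κ) ∧
                  IsFat T.1 P κ
                    (4 * (d : ℝ) ^ (5 / 2 : ℝ) * 5 ^ d * (d.factorial : ℝ)) (κ - κ')) ∧
                 -- (ii) the map `M̃ = T.2`
                 (T.2 '' tukeyRegion P κ ⊆ unitCube d ∧
                  IsAbsolutelyFat T.2 P κ (2 * (d : ℝ) * 5 ^ d * (d.factorial : ℝ)))} := by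
  -- The exponent `k = 0` suffices: the second bound holds without its polylogarithmic factor.
  refine ⟨430, by norm_num, 0, fun opt d υ hd hυ ε δ β hε hδ hβ hopt κ hκ => ?_⟩
  obtain ⟨A, hA, hP⟩ := solvable_deltaBB opt hd hυ hε hδ hβ hopt hκ
  exact ⟨A, hA, fun P hPg κ' hκ' hgap hpos hhalf => hP P hPg κ' ⟨hκ', hpos, hhalf⟩ hgap⟩
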